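/- **Conventions.** Groups are written additively but need not be commutative; $[x,y]=-x-y+x+y$. For a map $f$ from a group to an abelian group, $(x|y)_f=f(x+y)-f(x)-f(y)$; $f$ is quadratic if $(x|y)_f$ is additive in $x$ and in $y$. All $\otimes$ on abelian groups are over $\mathbb Z$. **Square groups.** A square group $M=(M_e\xrightarrow{H}M_{ee}\xrightarrow{P}M_e)$ consists of a group $M_e$, an abelian group $M_{ee}$, a quadratic map $H$ and a homomorphism $P$ such that $(Pa|y)_H=0=(x|Pb)_H$, $P((x|y)_H)=[x,y]$ and $PHP(a)=P(a)+P(a)$. Morphisms are pairs of homomorphisms $(f_e,f_{ee})$ commuting with $H$ and $P$; the category is $\mathsf{SG}$. Put $T=HP-\mathrm{id}$ on $M_{ee}$ and $\Delta(x)=HPH(x)+H(x+x)-4H(x)$ on $M_e$. The image of $P$ is central, $\mathrm{Coker}\,P=M_e/\mathrm{im}\,P$ is abelian, $\Delta$ is a homomorphism which factors through $\mathrm{Coker}\,P$, and the cross-effect of $H$ induces a homomorphism $\mathrm{Coker}\,P\otimes\mathrm{Coker}\,P\to M_{ee}$. Let $\mathsf{SG}_\Sigma\subset\mathsf{SG}$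 be the full subcategory of those $M$ for which the last homomorphism is an isomorphism. **The product $\circledcirc$.** $(M\circledcirc N)_e$ is the group generated by $x\circledcirc y$ ($x\in M_e,y\in N_e$) and $a\bar\otimes b$ ($a\in M_{ee},b\in N_{ee}$) with relations: $a\bar\otimes b$ is central and additive in $a$ and $b$; $x\circledcirc(y_1+y_2)=x\circledcirc y_1+x\circledcirc y_2$; $(x_1+x_2)\circledcirc y=x_1\circledcirc y+x_2\circledcirc y+(x_2|x_1)_H\bar\otimes H(y)$; $x\circledcirc P(b)=(x|x)_H\bar\otimes b$; $P(a)\circledcirc y=a\bar\otimes\Delta(y)$; $T(a)\bar\otimes T(b)=-a\bar\otimes b$. Further $(M\circledcirc N)_{ee}=M_{ee}\otimes N_{ee}$, $P(a\otimes b)=a\bar\otimes b$, and $H$ is the unique quadratic map with $H(x\circledcirc y)=(x|x)_H\otimes H(y)+H(x)\otimes\Delta(y)$, $H(a\bar\otimes b)=a\otimes b-T(a)\otimes T(b)$, $(x\circledcirc y\,|\,x'\circledcirc y')_H=(x|x')_H\otimes(y|y')_H$, the cross-effect of $H$ being zero when one argument is some $a\bar\otimes b$. With associativity $(x\circledcirc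 y)\circledcirc z\mapsto x\circledcirc(y\circledcirc z)$, symmetry $x\circledcirc y\mapsto y\circledcirc x-H(y)\bar\otimes TH(x)$ (and the evident isomorphisms on the $ee$-level), unit $\mathbb Z_{\rm nil}=(\mathbb Z\to\mathbb Z\to\mathbb Z)$ with $H(n)=\binom n2$, $P=0$, and unit isomorphisms $n\circledcirc x\mapsto nx+\binom n2PH(x)$, $x\circledcirc n\mapsto nx$, $(\mathsf{SG},\circledcirc)$ is a symmetric monoidal category. **The product $\square$.** $(M\square N)_e$ is the group generated by $x\otimes z$ and $[x,y]\otimes c$ ($x,y\in M_e$, $z\in N_e$, $c\in N_{ee}$) with relations: $x\otimes z$ is additive in $z$; $[x,y]\otimes c$ is central and additive in $x$, $y$ and $c$; $(x+y)\otimes z=x\otimes z+y\otimes z+[x,y]\otimes H(z)$; $[x,x]\otimes c=x\otimes P(c)$; $[x,Pa]\otimes c=0$ for $a\in M_{ee}$. Further $$(M\square N)_{ee}=\bigl((M_{ee}\otimes\mathrm{Coker}\,P_N)\oplus(\mathrm{Coker}\,P_M\otimes\mathrm{Coker}\,P_M\otimes N_{ee})\bigr)/\bigl((x|y)_H\otimes\bar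 z\sim\bar y\otimes\bar x\otimes\Delta(z)\bigr),$$ $P(a\otimes\bar z)=P(a)\otimes z$, $P(\bar x\otimes\bar y\otimes c)=[x,y]\otimes c$, and $H$ is the unique quadratic map with $(x\otimes z\,|\,x'\otimes z')_H=\bar x'\otimes\bar x\otimes(z|z')_H$, $H(x\otimes z)=H(x)\otimes\bar z+\bar x\otimes\bar x\otimes H(z)$, $H([x,y]\otimes c)=\bar x\otimes\bar y\otimes c+\bar y\otimes\bar x\otimes T(c)$, the cross-effect of $H$ being zero when one argument is some $[x,y]\otimes c$. The canonical morphism $\sigma:M\square N\to M\circledcirc N$ is given by $\sigma_e(x\otimes z)=x\circledcirc z$, $\sigma_e([x,y]\otimes c)=(y|x)_H\bar\otimes c$, $\sigma_{ee}(a\otimes\bar z)=a\otimes\Delta(z)$, $\sigma_{ee}(\bar x\otimes\bar y\otimes c)=(y|x)_H\otimes c$. **Abelian groups with cosymmetry.** An object of $\mathsf{Cos}$ is an abelian group $A$ with a map $\delta:A\to\mathrm{Sym}^2(A)$ such that $\delta(a+b)=\delta(a)+\delta(b)+ab$; a morphism is a homomorphism $f$ with $\mathrm{Sym}^2(f)\,\delta=\delta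 f$. The tensor product is $A\otimes B$ with $\delta(a\otimes b)=a*\delta(b)+\delta(a)*b-\delta(a)*\delta(b)$, where $a*(bb')=(a\otimes b)(a\otimes b')$, $(aa')*b=(a\otimes b)(a'\otimes b)$ and $(aa')*(bb')=(a\otimes b)(a'\otimes b')+(a'\otimes b)(a\otimes b')$. With the usual associativity, symmetry and unit isomorphisms and the unit $(\mathbb Z,\;n\mapsto\binom n2\,1\cdot 1)$ this is a symmetric monoidal category. **The functor $J:\mathsf{Cos}\to\mathsf{SG}$.** Let $\pi:A\otimes A\to\mathrm{Sym}^2(A)$, $\pi(a\otimes b)=ab$. Then $J(A,\delta)_e=\{(a,x)\in A\times(A\otimes A):\pi(x)=\delta(a)\}$ with $(a,x)+(b,y)=(a+b,\,x+y+a\otimes b)$, $J(A,\delta)_{ee}=A\otimes A$, $H(a,x)=x$, $P(a\otimes b)=(0,\,a\otimes b-b\otimes a)$, and $J(f)=\bigl((a,x)\mapsto(f(a),(f\otimes f)(x)),\;f\otimes f\bigr)$. **Theorem.** (i) $J$ takes values in $\mathsf{SG}_\Sigma$, and $J:\mathsf{Cos}\to\mathsf{SG}_\Sigma$ is an equivalence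 of categories. (ii) A morphism $f:M\to N$ in $\mathsf{SG}_\Sigma$ is an isomorphism if and only if the induced homomorphism $\mathrm{Coker}\,P_M\to\mathrm{Coker}\,P_N$ is an isomorphism. (iii) If $M$ and $N$ are in $\mathsf{SG}_\Sigma$, then $M\circledcirc N$ and $M\square N$ are in $\mathsf{SG}_\Sigma$, and $\sigma:M\square N\to M\circledcirc N$ is an isomorphism. (iv) $J:(\mathsf{Cos},\otimes)\to(\mathsf{SG},\circledcirc)$ carries the structure of a (strong) symmetric monoidal functor; in particular there is a natural isomorphism $J(A,\delta)\circledcirc J(A',\delta')\cong J((A,\delta)\otimes(A',\delta'))$. Moreover, the functor $J$ is full. -/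

import Mathlib

open CategoryTheory MonoidalCategory
open scoped TensorProduct

universe u

/-- The cross-effect `(x | y)_f = f (x + y) - f x - f y` of a map from an (additively written,
possibly nonabelian) group to an abelian group. -/
def crossEffect {G A : Type*} [AddGroup G] [AddCommGroup A] (f : G → A) (x y : G) : A :=
  f (x + y) - f x - f y

/-- Square groups. The group `e` is written additively but need not be commutative. The fields
`cross_add_left` and `cross_add_right` say that `H` is quadratic. -/
structure SquareGroup : Type (u + 1) where
  e : Type u
  ee : Type u
  [instE : AddGroup e]
  [instEE : AddCommGroup ee]
  H : e → ee
  P : ee →+ e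
  cross_add_left : ∀ x y z : e,
    crossEffect H (x + y) z = crossEffect H x z + crossEffect H y z
  cross_add_right : ∀ x y z : e,
    crossEffect H x (y + z) = crossEffect H x y + crossEffect H x z
  cross_P_left : ∀ (a : ee) (y : e), crossEffect H (P a) y = 0
  cross_P_right : ∀ (x : e) (b : ee), crossEffect H x (P b) = 0
  P_cross : ∀ x y : e, P (crossEffect H x y) = -x - y + x + y
  P_H_P : ∀ a : ee, P (H (P a)) = P a + P a

attribute [instance] SquareGroup.instE SquareGroup.instEE

/-! ### Central extensions by bilinear cocycles -/

/-- A biadditive map from an abelian group to the centre of a group. -/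
structure CentralPairing (C G : Type*) [AddCommGroup C] [AddGroup G] where
  toFun : C → C → G
  add_left : ∀ a b c, toFun (a + b) c = toFun a c + toFun b c
  add_right : ∀ a b c, toFun a (b + c) = toFun a b + toFun a c
  central : ∀ a b g, toFun a b + g = g + toFun a b

/-- The set `C × G` with the group structure `(c, g) + (c', g') = (c + c', g + g' + β c c')`. -/
@[ext] structure CentralPairing.Ext {C G : Type*} [AddCommGroup C] [AddGroup G]
    (β : CentralPairing C G) where
  fst : C
  snd : G

namespace CentralPairing

section

variable {C G : Type*} [AddCommGroup C] [AddGroup G] (β : CentralPairing C G)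

theorem zero_left (c : C) : β.toFun 0 c = 0 := by
  have h := β.add_left 0 0 c
  rw [add_zero] at h
  exact left_eq_add.mp h

theorem zero_right (c : C) : β.toFun c 0 = 0 := by
  have h := β.add_right c 0 0
  rw [add_zero] at h
  exact left_eq_add.mp h

theorem neg_left (a c : C) : β.toFun (-a) c = -β.toFun a c := by
  have h := β.add_left a (-a) c
  rw [add_neg_cancel, zero_left] at h
  exact (neg_eq_of_add_eq_zero_right h.symm).symm

instance : Zero β.Ext := ⟨⟨0, 0⟩⟩
instance : Add β.Ext := ⟨fun p q => ⟨p.fst + q.fst, p.snd + q.snd + β.toFun p.fst q.fst⟩⟩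
instance : Neg β.Ext := ⟨fun p => ⟨-p.fst, -p.snd + β.toFun p.fst p.fst⟩⟩

@[simp] theorem zero_fst : (0 : β.Ext).fst = 0 := rfl
@[simp] theorem zero_snd : (0 : β.Ext).snd = 0 := rfl
@[simp] theorem add_fst (p q : β.Ext) : (p + q).fst = p.fst + q.fst := rfl
@[simp] theorem add_snd (p q : β.Ext) :
    (p + q).snd = p.snd + q.snd + β.toFun p.fst q.fst := rfl
@[simp] theorem neg_fst (p : β.Ext) : (-p).fst = -p.fst := rfl
@[simp] theorem neg_snd (p : β.Ext) : (-p).snd = -p.snd + β.toFun p.fst p.fst := rfl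

instance : AddGroup β.Ext :=
  AddGroup.ofLeftAxioms
    (by
      intro p q r
      ext
      · simp [add_assoc]
      · simp only [add_snd, add_fst, β.add_left, β.add_right]
        simp only [add_assoc]
        congr 2
        rw [← add_assoc (β.toFun p.fst q.fst), β.central p.fst q.fst, add_assoc]
        congr 1
        rw [← add_assoc, ← add_assoc, β.central p.fst q.fst]
        rw [add_assoc, β.central p.fst r.fst, β.central p.fst q.fst, add_assoc])
    (by
      intro p
      ext
      · simp
      · simp [β.zero_left])
    (by
      intro p
      ext
      · simp
      · simp only [add_snd, neg_fst, neg_snd, β.neg_left, zero_snd]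
        rw [add_assoc (-p.snd), β.central, ← add_assoc, neg_add_cancel, zero_add, add_neg_cancel])

/-- Projection to the first component. -/
def Ext.fstHom : β.Ext →+ C where
  toFun p := p.fst
  map_zero' := rfl
  map_add' _ _ := rfl

end

/-- A bilinear map of abelian groups, seen as a pairing. -/
def ofBilin {C A : Type*} [AddCommGroup C] [AddCommGroup A] (B : C →ₗ[ℤ] C →ₗ[ℤ] A) :
    CentralPairing C A where
  toFun a b := B a b
  add_left a b c := by simp
  add_right a b c := by simp
  central a b g := add_comm _ _

@[simp] theorem ofBilin_apply {C A : Type*} [AddCommGroup C] [AddCommGroup A]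
    (B : C →ₗ[ℤ] C →ₗ[ℤ] A) (a b : C) : (ofBilin B).toFun a b = B a b := rfl

end CentralPairing

/-! ### Basic identities in square groups -/

namespace SquareGroup

variable (M N K L : SquareGroup.{u})

/-- The cross-effect `(x | y)_H`. -/
def cr (x y : M.e) : M.ee := crossEffect M.H x y

variable {M N K L}

theorem H_add (x y : M.e) : M.H (x + y) = M.H x + M.H y + M.cr x y := by
  simp only [cr, crossEffect]; abel

theorem cr_add_left (x y z : M.e) : M.cr (x + y) z = M.cr x z + M.cr y z :=
  M.cross_add_left x y z

theorem cr_add_right (x y z : M.e) : M.cr x (y + z) = M.cr x y + M.cr x z :=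
  M.cross_add_right x y z

@[simp] theorem cr_P_left (a : M.ee) (y : M.e) : M.cr (M.P a) y = 0 := M.cross_P_left a y

@[simp] theorem cr_P_right (x : M.e) (b : M.ee) : M.cr x (M.P b) = 0 := M.cross_P_right x b

theorem P_cr (x y : M.e) : M.P (M.cr x y) = -x - y + x + y := M.P_cross x y

theorem cr_zero_left (y : M.e) : M.cr 0 y = 0 := by
  have h := cr_P_left 0 y
  rwa [map_zero] at h

theorem cr_zero_right (y : M.e) : M.cr y 0 = 0 := by
  have h := cr_P_right y 0
  rwa [map_zero] at h

@[simp] theorem H_zero : M.H 0 = 0 := by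
  have h := H_add (0 : M.e) 0
  rw [cr_zero_left, add_zero, add_zero] at h
  exact left_eq_add.mp h

theorem cr_neg_left (x y : M.e) : M.cr (-x) y = -M.cr x y := by
  have h := cr_add_left x (-x) y
  rw [add_neg_cancel, cr_zero_left] at h
  exact (neg_eq_of_add_eq_zero_right h.symm).symm

theorem cr_neg_right (x y : M.e) : M.cr x (-y) = -M.cr x y := by
  have h := cr_add_right x y (-y)
  rw [add_neg_cancel, cr_zero_right] at h
  exact (neg_eq_of_add_eq_zero_right h.symm).symm

theorem H_neg (x : M.e) : M.H (-x) = -M.H x + M.cr x x := by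
  have h := H_add x (-x)
  rw [add_neg_cancel, H_zero, cr_neg_right] at h
  have h2 : M.H (-x) = -M.H x + M.cr x x + (M.H x + M.H (-x) + -M.cr x x) := by abel
  rw [h2, ← h, add_zero]

theorem add_eq_swap (x y : M.e) : x + y = y + x + M.P (M.cr x y) := by
  rw [P_cr]
  add_group

theorem P_central (a : M.ee) (x : M.e) : M.P a + x = x + M.P a := by
  have h := add_eq_swap (M.P a) x
  rwa [cr_P_left, map_zero, add_zero] at h

theorem H_P_add (a b : M.ee) : M.H (M.P (a + b)) = M.H (M.P a) + M.H (M.P b) := by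
  rw [map_add, H_add, cr_P_left, add_zero]

/-- The involution `T = H P - id` of `M.ee`. -/
def T (M : SquareGroup.{u}) : M.ee →ₗ[ℤ] M.ee :=
  AddMonoidHom.toIntLinearMap
    (AddMonoidHom.mk' (fun a => M.H (M.P a) - a) (by intro a b; rw [H_P_add]; abel))

theorem T_apply (a : M.ee) : M.T a = M.H (M.P a) - a := rfl

theorem H_P (a : M.ee) : M.H (M.P a) = a + M.T a := by rw [T_apply]; abel

theorem P_T (a : M.ee) : M.P (M.T a) = M.P a := by
  rw [T_apply, map_sub, M.P_H_P, add_sub_cancel_right]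

@[simp] theorem T_T (a : M.ee) : M.T (M.T a) = a := by
  rw [T_apply (M.T a), P_T, H_P]; abel

theorem H_comm (x y : M.e) : M.H (M.P (M.cr x y)) = M.cr x y - M.cr y x := by
  have h := congrArg M.H (add_eq_swap x y)
  rw [H_add, H_add (y + x), H_add y x, cr_P_right] at h
  have h2 : M.H (M.P (M.cr x y))
    = (M.H y + M.H x + M.cr y x + M.H (M.P (M.cr x y)) + 0) - (M.H y + M.H x + M.cr y x) := by abel
  rw [h2, ← h]; abel

theorem T_cr (x y : M.e) : M.T (M.cr x y) = -M.cr y x := by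
  rw [T_apply, H_comm]; abel

/-- The homomorphism `Δ x = H P H x + H (x + x) - 4 H x` on `M.e`. -/
def Δe (M : SquareGroup.{u}) : M.e →+ M.ee :=
  AddMonoidHom.mk' (fun x => M.H (M.P (M.H x)) + M.H (x + x) - (4 : ℤ) • M.H x) (by
    intro x y
    have h1 : M.H (x + y + (x + y)) = M.H (x + y) + M.H (x + y) +
        (M.cr x x + M.cr y x + (M.cr x y + M.cr y y)) := by
      rw [H_add, cr_add_left, cr_add_right, cr_add_right]; abel
    rw [h1, H_add x x, H_add y y, H_add x y, H_P_add, H_P_add, H_comm]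
    abel)

theorem Δe_eq (x : M.e) : M.Δe x = M.cr x x - M.H x + M.T (M.H x) := by
  change M.H (M.P (M.H x)) + M.H (x + x) - (4 : ℤ) • M.H x = _
  rw [H_add, T_apply]; abel

theorem Δe_P (a : M.ee) : M.Δe (M.P a) = 0 := by
  rw [Δe_eq, cr_P_left, H_P, map_add, T_T]; abel

theorem T_Δe (x : M.e) : M.T (M.Δe x) = -M.Δe x := by
  rw [Δe_eq, map_add, map_sub, T_T, T_cr]; abel

/-- The image of `P` is normal, being central. -/
instance normal_range (M : SquareGroup.{u}) : M.P.range.Normal where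
  conj_mem := by
    rintro _ ⟨a, rfl⟩ g
    exact ⟨a, by rw [← P_central, add_neg_cancel_right]⟩

/-- The cokernel of `P`. -/
def Coker (M : SquareGroup.{u}) : Type u := M.e ⧸ M.P.range

theorem quot_add_comm (M : SquareGroup.{u}) (a b : M.e ⧸ M.P.range) : a + b = b + a := by
  obtain ⟨x, rfl⟩ := QuotientAddGroup.mk'_surjective M.P.range a
  obtain ⟨y, rfl⟩ := QuotientAddGroup.mk'_surjective M.P.range b
  rw [← map_add, ← map_add, add_eq_swap, map_add _ (y + x), add_eq_left]
  exact (QuotientAddGroup.eq_zero_iff _).mpr ⟨_, rfl⟩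

instance (M : SquareGroup.{u}) : AddCommGroup (Coker M) :=
  { QuotientAddGroup.Quotient.addGroup M.P.range with
    add_comm := M.quot_add_comm }

/-- The class in the cokernel of `P` of an element of `M.e`. -/
def toCoker (M : SquareGroup.{u}) : M.e →+ Coker M := QuotientAddGroup.mk' M.P.range

theorem toCoker_surjective (M : SquareGroup.{u}) : Function.Surjective M.toCoker :=
  QuotientAddGroup.mk'_surjective M.P.range

@[simp] theorem toCoker_P (a : M.ee) : M.toCoker (M.P a) = 0 :=
  (QuotientAddGroup.eq_zero_iff _).mpr ⟨_, rfl⟩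

/-- Homomorphisms out of the cokernel of `P`. -/
def cokerLift {A : Type*} [AddCommGroup A] (f : M.e →+ A) (hf : ∀ a, f (M.P a) = 0) :
    Coker M →ₗ[ℤ] A :=
  AddMonoidHom.toIntLinearMap
    (QuotientAddGroup.lift M.P.range f (by rintro _ ⟨a, rfl⟩; exact hf a))

@[simp] theorem cokerLift_toCoker {A : Type*} [AddCommGroup A] (f : M.e →+ A)
    (hf : ∀ a, f (M.P a) = 0) (x : M.e) : cokerLift f hf (M.toCoker x) = f x := rfl

/-- The bilinear map on the cokernel of `P` induced by the cross-effect of `H`. -/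
def crC (M : SquareGroup.{u}) : Coker M →ₗ[ℤ] Coker M →ₗ[ℤ] M.ee :=
  cokerLift
    (AddMonoidHom.mk'
      (fun x => cokerLift (AddMonoidHom.mk' (fun y => M.cr x y) (cr_add_right x))
        (cr_P_right x))
      (by
        intro x x'
        ext y
        obtain ⟨y, rfl⟩ := M.toCoker_surjective y
        exact cr_add_left x x' y))
    (by
      intro a
      ext y
      obtain ⟨y, rfl⟩ := M.toCoker_surjective y
      exact cr_P_left a y)

@[simp] theorem crC_apply (x y : M.e) : M.crC (M.toCoker x) (M.toCoker y) = M.cr x y := rfl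

/-- The homomorphism `Δ` on the cokernel of `P`. -/
def Δ (M : SquareGroup.{u}) : Coker M →ₗ[ℤ] M.ee := cokerLift M.Δe Δe_P

@[simp] theorem Δ_toCoker (x : M.e) : M.Δ (M.toCoker x) = M.Δe x := rfl

theorem Δe_add_P (x : M.e) (a : M.ee) : M.Δe (x + M.P a) = M.Δe x := by
  rw [map_add, Δe_P, add_zero]

/-! ### The category of square groups -/

/-- Morphisms of square groups. -/
@[ext] structure Hom (M N : SquareGroup.{u}) : Type u where
  e : M.e →+ N.e
  ee : M.ee →ₗ[ℤ] N.ee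
  e_P : ∀ a : M.ee, e (M.P a) = N.P (ee a)
  ee_H : ∀ x : M.e, ee (M.H x) = N.H (e x)

instance : Category SquareGroup.{u} where
  Hom := Hom
  id M := ⟨AddMonoidHom.id _, LinearMap.id, fun _ => rfl, fun _ => rfl⟩
  comp f g := ⟨g.e.comp f.e, g.ee.comp f.ee,
    fun a => by simp [f.e_P, g.e_P], fun x => by simp [f.ee_H, g.ee_H]⟩

@[ext] theorem hom_ext {f g : M ⟶ N} (h : ∀ x, f.e x = g.e x) (h' : f.ee = g.ee) : f = g :=
  Hom.ext (AddMonoidHom.ext h) h'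

@[simp] theorem id_e (x : M.e) : Hom.e (𝟙 M) x = x := rfl
@[simp] theorem id_ee : Hom.ee (𝟙 M) = LinearMap.id := rfl
@[simp] theorem comp_e (f : M ⟶ N) (g : N ⟶ K) (x : M.e) : (f ≫ g).e x = g.e (f.e x) := rfl
@[simp] theorem comp_ee (f : M ⟶ N) (g : N ⟶ K) : (f ≫ g).ee = g.ee.comp f.ee := rfl

theorem ee_cr (f : M ⟶ N) (x y : M.e) : f.ee (M.cr x y) = N.cr (f.e x) (f.e y) := by
  simp only [cr, crossEffect, map_sub, f.ee_H, map_add]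

theorem ee_T (f : M ⟶ N) (a : M.ee) : f.ee (M.T a) = N.T (f.ee a) := by
  simp only [T_apply, map_sub, f.ee_H, f.e_P]

theorem ee_Δe (f : M ⟶ N) (x : M.e) : f.ee (M.Δe x) = N.Δe (f.e x) := by
  simp only [Δe_eq, map_sub, map_add, ee_cr, ee_T, f.ee_H]

/-- The homomorphism induced on cokernels of `P`. -/
def cokerMap (f : M ⟶ N) : Coker M →ₗ[ℤ] Coker N :=
  cokerLift (N.toCoker.comp f.e) (fun a => by simp [f.e_P])

@[simp] theorem cokerMap_toCoker (f : M ⟶ N) (x : M.e) :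
    cokerMap f (M.toCoker x) = N.toCoker (f.e x) := rfl

/-- A morphism which is bijective on both levels has an inverse. -/
def isoOfInverse (f : M ⟶ N) (g : N.e → M.e) (g' : N.ee →ₗ[ℤ] M.ee)
    (h1 : ∀ x, g (f.e x) = x) (h2 : ∀ y, f.e (g y) = y)
    (h1' : g'.comp f.ee = LinearMap.id) (h2' : f.ee.comp g' = LinearMap.id) : M ≅ N where
  hom := f
  inv :=
    { e := AddMonoidHom.mk' g (by
        intro x y
        rw [← h1 (g x + g y), map_add, h2, h2])
      ee := g'
      e_P := by
        intro a
        change g (N.P a) = M.P (g' a)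
        have : a = f.ee (g' a) := (LinearMap.congr_fun h2' a).symm
        rw [← h1 (M.P (g' a)), f.e_P, ← this]
      ee_H := by
        intro x
        change g' (N.H x) = M.H (g x)
        have := LinearMap.congr_fun h1' (M.H (g x))
        rwa [LinearMap.comp_apply, f.ee_H, h2] at this }
  hom_inv_id := by ext1; exacts [h1 _, h1']
  inv_hom_id := by ext1; exacts [h2 _, h2']

end SquareGroup

/-! ### Groups given by generators and relations -/

/-- The additive group with generators `α` and relations `r`. -/
def PresentedAdd {α : Type*} (r : FreeAddGroup α → FreeAddGroup α → Prop) : Type _ :=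
  (addConGen r).Quotient

namespace PresentedAdd

variable {α : Type*} (r : FreeAddGroup α → FreeAddGroup α → Prop)

instance : AddGroup (PresentedAdd r) := AddCon.addGroup (addConGen r)

/-- The projection from the free group. -/
def mk : FreeAddGroup α →+ PresentedAdd r := AddCon.mk' (addConGen r)

variable {r}

theorem mk_eq {v w : FreeAddGroup α} (h : r v w) : mk r v = mk r w :=
  (AddCon.eq (addConGen r)).2 (AddConGen.Rel.of _ _ h)

/-- Homomorphisms out of a group given by generators and relations. -/
def lift {G : Type*} [AddGroup G] (f : α → G)
    (hf : ∀ v w, r v w → FreeAddGroup.lift f v = FreeAddGroup.lift f w) : PresentedAdd r →+ G :=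
  AddCon.lift (addConGen r) (FreeAddGroup.lift f) (AddCon.addConGen_le.2 hf)

@[simp] theorem lift_mk {G : Type*} [AddGroup G] (f : α → G)
    (hf : ∀ v w, r v w → FreeAddGroup.lift f v = FreeAddGroup.lift f w) (w : FreeAddGroup α) :
    lift f hf (mk r w) = FreeAddGroup.lift f w := rfl

theorem induction {p : PresentedAdd r → Prop} (h0 : p 0) (hof : ∀ a, p (mk r (FreeAddGroup.of a)))
    (hneg : ∀ a, p (-mk r (FreeAddGroup.of a))) (hadd : ∀ u v, p u → p v → p (u + v)) (u) :
    p u := by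
  obtain ⟨w, rfl⟩ : ∃ w, mk r w = u := AddCon.mk'_surjective u
  induction w using FreeAddGroup.induction_on with
  | C1 => simpa using h0
  | of a => exact hof a
  | neg_of a _ => simpa using hneg a
  | add v w hv hw => simpa using hadd _ _ hv hw

end PresentedAdd

/-- A biadditive map of abelian groups, as a bilinear map. -/
def mkBilin {A B C : Type*} [AddCommGroup A] [AddCommGroup B] [AddCommGroup C] (f : A → B → C)
    (h1 : ∀ a a' b, f (a + a') b = f a b + f a' b)
    (h2 : ∀ a b b', f a (b + b') = f a b + f a b') : A →ₗ[ℤ] B →ₗ[ℤ] C :=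
  AddMonoidHom.toIntLinearMap
    (AddMonoidHom.mk' (fun a => AddMonoidHom.toIntLinearMap (AddMonoidHom.mk' (f a) (h2 a)))
      (fun a a' => LinearMap.ext (h1 a a')))

@[simp] theorem mkBilin_apply {A B C : Type*} [AddCommGroup A] [AddCommGroup B] [AddCommGroup C]
    (f : A → B → C) (h1 : ∀ a a' b, f (a + a') b = f a b + f a' b)
    (h2 : ∀ a b b', f a (b + b') = f a b + f a b') (a : A) (b : B) :
    mkBilin f h1 h2 a b = f a b := rfl

/-- The centre of a group is commutative. -/
instance centerAddCommGroup (G : Type*) [AddGroup G] : AddCommGroup (AddSubgroup.center G) :=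
  { (inferInstance : AddGroup (AddSubgroup.center G)) with
    add_comm := fun a b => Subtype.ext (AddSubgroup.mem_center_iff.1 b.2 a) }

/-- The homomorphism from a tensor product to a group induced by a biadditive map with central
values. -/
def liftCentral {A B G : Type*} [AddCommGroup A] [AddCommGroup B] [AddGroup G] (f : A → B → G)
    (hc : ∀ a b g, f a b + g = g + f a b)
    (h1 : ∀ a a' b, f (a + a') b = f a b + f a' b)
    (h2 : ∀ a b b', f a (b + b') = f a b + f a b') : A ⊗[ℤ] B →+ G :=
  (AddSubgroup.center G).subtype.comp
    (TensorProduct.lift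
      (mkBilin (fun a b => (⟨f a b, AddSubgroup.mem_center_iff.2 fun g => (hc a b g).symm⟩ :
          AddSubgroup.center G))
        (fun a a' b => Subtype.ext (h1 a a' b))
        (fun a b b' => Subtype.ext (h2 a b b')))).toAddMonoidHom

@[simp] theorem liftCentral_tmul {A B G : Type*} [AddCommGroup A] [AddCommGroup B] [AddGroup G]
    (f : A → B → G) (hc : ∀ a b g, f a b + g = g + f a b)
    (h1 : ∀ a a' b, f (a + a') b = f a b + f a' b)
    (h2 : ∀ a b b', f a (b + b') = f a b + f a b') (a : A) (b : B) :
    liftCentral f hc h1 h2 (a ⊗ₜ b) = f a b := rfl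

theorem liftCentral_central {A B G : Type*} [AddCommGroup A] [AddCommGroup B] [AddGroup G]
    (f : A → B → G) (hc : ∀ a b g, f a b + g = g + f a b)
    (h1 : ∀ a a' b, f (a + a') b = f a b + f a' b)
    (h2 : ∀ a b b', f a (b + b') = f a b + f a b') (t : A ⊗[ℤ] B) (g : G) :
    liftCentral f hc h1 h2 t + g = g + liftCentral f hc h1 h2 t :=
  (AddSubgroup.mem_center_iff.1 (Subtype.prop _) g).symm

/-! ### The tensor product of square groups -/

namespace SquareGroup

namespace Tensor

/-- Generators `x ⊚ y` and `a ⊗̄ b` of the `e`-level of the tensor product. -/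
inductive Gen (M N : SquareGroup.{u}) : Type u
  | tl (x : M.e) (y : N.e)
  | bar (a : M.ee) (b : N.ee)

open FreeAddGroup Gen in
/-- Relations of the `e`-level of the tensor product. -/
inductive Rel (M N : SquareGroup.{u}) :
    FreeAddGroup (Gen M N) → FreeAddGroup (Gen M N) → Prop
  | bar_central (a : M.ee) (b : N.ee) (w : FreeAddGroup (Gen M N)) :
      Rel M N (of (bar a b) + w) (w + of (bar a b))
  | bar_add_left (a a' : M.ee) (b : N.ee) :
      Rel M N (of (bar (a + a') b)) (of (bar a b) + of (bar a' b))
  | bar_add_right (a : M.ee) (b b' : N.ee) :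
      Rel M N (of (bar a (b + b'))) (of (bar a b) + of (bar a b'))
  | tl_add (x : M.e) (y₁ y₂ : N.e) :
      Rel M N (of (tl x (y₁ + y₂))) (of (tl x y₁) + of (tl x y₂))
  | add_tl (x₁ x₂ : M.e) (y : N.e) :
      Rel M N (of (tl (x₁ + x₂) y))
        (of (tl x₁ y) + of (tl x₂ y) + of (bar (crossEffect M.H x₂ x₁) (N.H y)))
  | tl_P (x : M.e) (b : N.ee) :
      Rel M N (of (tl x (N.P b))) (of (bar (crossEffect M.H x x) b))
  | P_tl (a : M.ee) (y : N.e) :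
      Rel M N (of (tl (M.P a) y)) (of (bar a (N.Δe y)))
  | T_bar_T (a : M.ee) (b : N.ee) :
      Rel M N (of (bar (M.T a) (N.T b))) (-of (bar a b))

/-- The `e`-level of the tensor product. -/
def E (M N : SquareGroup.{u}) : Type u := PresentedAdd (Rel M N)

instance (M N : SquareGroup.{u}) : AddGroup (E M N) :=
  inferInstanceAs (AddGroup (PresentedAdd (Rel M N)))

variable {M N : SquareGroup.{u}}

/-- The generator `x ⊚ y`. -/
def tl (x : M.e) (y : N.e) : E M N := PresentedAdd.mk (Rel M N) (FreeAddGroup.of (Gen.tl x y))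

/-- The generator `a ⊗̄ b`. -/
def bar (a : M.ee) (b : N.ee) : E M N :=
  PresentedAdd.mk (Rel M N) (FreeAddGroup.of (Gen.bar a b))

theorem bar_central (a : M.ee) (b : N.ee) (u : E M N) : bar a b + u = u + bar a b := by
  obtain ⟨w, rfl⟩ : ∃ w, PresentedAdd.mk (Rel M N) w = u := AddCon.mk'_surjective u
  have h := PresentedAdd.mk_eq (Rel.bar_central a b w)
  rwa [map_add, map_add] at h

theorem bar_add_left (a a' : M.ee) (b : N.ee) : (bar (a + a') b : E M N) = bar a b + bar a' b := by
  have h := PresentedAdd.mk_eq (Rel.bar_add_left a a' b)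
  rwa [map_add] at h

theorem bar_add_right (a : M.ee) (b b' : N.ee) :
    (bar a (b + b') : E M N) = bar a b + bar a b' := by
  have h := PresentedAdd.mk_eq (Rel.bar_add_right a b b')
  rwa [map_add] at h

theorem tl_add (x : M.e) (y₁ y₂ : N.e) : (tl x (y₁ + y₂) : E M N) = tl x y₁ + tl x y₂ := by
  have h := PresentedAdd.mk_eq (Rel.tl_add x y₁ y₂)
  rwa [map_add] at h

theorem add_tl (x₁ x₂ : M.e) (y : N.e) :
    (tl (x₁ + x₂) y : E M N) = tl x₁ y + tl x₂ y + bar (M.cr x₂ x₁) (N.H y) := by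
  have h := PresentedAdd.mk_eq (Rel.add_tl x₁ x₂ y)
  rwa [map_add, map_add] at h

theorem tl_P (x : M.e) (b : N.ee) : (tl x (N.P b) : E M N) = bar (M.cr x x) b :=
  PresentedAdd.mk_eq (Rel.tl_P x b)

theorem P_tl (a : M.ee) (y : N.e) : (tl (M.P a) y : E M N) = bar a (N.Δe y) :=
  PresentedAdd.mk_eq (Rel.P_tl a y)

theorem T_bar_T (a : M.ee) (b : N.ee) : (bar (M.T a) (N.T b) : E M N) = -bar a b := by
  have h := PresentedAdd.mk_eq (Rel.T_bar_T a b)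
  rwa [map_neg] at h

/-- Homomorphisms out of the `e`-level of the tensor product. -/
def lift {G : Type*} [AddGroup G] (f : M.e → N.e → G) (g : M.ee → N.ee → G)
    (h1 : ∀ a b u, g a b + u = u + g a b)
    (h2 : ∀ a a' b, g (a + a') b = g a b + g a' b)
    (h3 : ∀ a b b', g a (b + b') = g a b + g a b')
    (h4 : ∀ x y₁ y₂, f x (y₁ + y₂) = f x y₁ + f x y₂)
    (h5 : ∀ x₁ x₂ y, f (x₁ + x₂) y = f x₁ y + f x₂ y + g (M.cr x₂ x₁) (N.H y))
    (h6 : ∀ x b, f x (N.P b) = g (M.cr x x) b)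
    (h7 : ∀ a y, f (M.P a) y = g a (N.Δe y))
    (h8 : ∀ a b, g (M.T a) (N.T b) = -g a b) : E M N →+ G :=
  PresentedAdd.lift (fun | Gen.tl x y => f x y | Gen.bar a b => g a b) (by
    intro v w h
    cases h with
    | bar_central a b w => simpa using h1 a b _
    | bar_add_left a a' b => simpa using h2 a a' b
    | bar_add_right a b b' => simpa using h3 a b b'
    | tl_add x y₁ y₂ => simpa using h4 x y₁ y₂
    | add_tl x₁ x₂ y => simpa [cr] using h5 x₁ x₂ y
    | tl_P x b => simpa [cr] using h6 x b
    | P_tl a y => simpa using h7 a y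
    | T_bar_T a b => simpa using h8 a b)

section

variable {G : Type*} [AddGroup G] (f : M.e → N.e → G) (g : M.ee → N.ee → G)
    (h1 : ∀ a b u, g a b + u = u + g a b)
    (h2 : ∀ a a' b, g (a + a') b = g a b + g a' b)
    (h3 : ∀ a b b', g a (b + b') = g a b + g a b')
    (h4 : ∀ x y₁ y₂, f x (y₁ + y₂) = f x y₁ + f x y₂)
    (h5 : ∀ x₁ x₂ y, f (x₁ + x₂) y = f x₁ y + f x₂ y + g (M.cr x₂ x₁) (N.H y))
    (h6 : ∀ x b, f x (N.P b) = g (M.cr x x) b)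
    (h7 : ∀ a y, f (M.P a) y = g a (N.Δe y))
    (h8 : ∀ a b, g (M.T a) (N.T b) = -g a b)

@[simp] theorem lift_tl (x : M.e) (y : N.e) : lift f g h1 h2 h3 h4 h5 h6 h7 h8 (tl x y) = f x y :=
  FreeAddGroup.lift_apply_of

@[simp] theorem lift_bar (a : M.ee) (b : N.ee) :
    lift f g h1 h2 h3 h4 h5 h6 h7 h8 (bar a b) = g a b :=
  FreeAddGroup.lift_apply_of

end

theorem tl_neg (x : M.e) (y : N.e) : (tl x (-y) : E M N) = -tl x y :=
  map_neg (AddMonoidHom.mk' (fun y => (tl x y : E M N)) (tl_add x)) y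

theorem tl_zero (x : M.e) : (tl x 0 : E M N) = 0 :=
  map_zero (AddMonoidHom.mk' (fun y => (tl x y : E M N)) (tl_add x))

theorem bar_neg (a : M.ee) (b : N.ee) : (bar a (-b) : E M N) = -bar a b :=
  map_neg (AddMonoidHom.mk' (fun b => (bar a b : E M N)) (bar_add_right a)) b

theorem induction {p : E M N → Prop} (htl : ∀ x y, p (tl x y)) (hbar : ∀ a b, p (bar a b))
    (hadd : ∀ u v, p u → p v → p (u + v)) (u : E M N) : p u := by
  refine PresentedAdd.induction (p := p) ?_ ?_ ?_ hadd u
  · have h := htl 0 0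
    rwa [tl_zero] at h
  · rintro (⟨x, y⟩ | ⟨a, b⟩)
    · exact htl x y
    · exact hbar a b
  · rintro (⟨x, y⟩ | ⟨a, b⟩)
    · have h := htl x (-y)
      rwa [tl_neg] at h
    · have h := hbar a (-b)
      rwa [bar_neg] at h

/-- The homomorphism `P`, with `P (a ⊗ b) = a ⊗̄ b`. -/
def P : M.ee ⊗[ℤ] N.ee →+ E M N := liftCentral bar bar_central bar_add_left bar_add_right

@[simp] theorem P_tmul (a : M.ee) (b : N.ee) : (P (a ⊗ₜ b) : E M N) = bar a b := rfl

theorem P_central (t : M.ee ⊗[ℤ] N.ee) (u : E M N) : P t + u = u + P t :=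
  liftCentral_central _ _ _ _ _ _

/-- The bilinear map `ρ (x ⊗ y) (x' ⊗ y') = (x | x')_H ⊗ (y | y')_H`. -/
noncomputable def rho (M N : SquareGroup.{u}) :
    Coker M ⊗[ℤ] Coker N →ₗ[ℤ] Coker M ⊗[ℤ] Coker N →ₗ[ℤ] M.ee ⊗[ℤ] N.ee :=
  TensorProduct.map₂ M.crC N.crC

@[simp] theorem rho_tmul (x x' : M.e) (y y' : N.e) :
    rho M N (M.toCoker x ⊗ₜ N.toCoker y) (M.toCoker x' ⊗ₜ N.toCoker y') =
      M.cr x x' ⊗ₜ N.cr y y' := rfl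

open TensorProduct in
/-- The homomorphism to the extension of `Coker P ⊗ Coker P` by the `ee`-level with cocycle `rho`
whose second component is `H`. -/
noncomputable def HExt (M N : SquareGroup.{u}) :
    E M N →+ (CentralPairing.ofBilin (rho M N)).Ext :=
  lift (fun x y => ⟨M.toCoker x ⊗ₜ N.toCoker y, M.cr x x ⊗ₜ N.H y + M.H x ⊗ₜ N.Δe y⟩)
    (fun a b => ⟨0, a ⊗ₜ b - M.T a ⊗ₜ N.T b⟩)
    (by
      intro a b u
      ext
      · simp
      · simp [add_comm])
    (by
      intro a a' b
      ext
      · simp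
      · simp only [CentralPairing.add_snd, CentralPairing.ofBilin_apply, map_zero, map_add, add_tmul]
        abel)
    (by
      intro a b b'
      ext
      · simp
      · simp only [CentralPairing.add_snd, CentralPairing.ofBilin_apply, map_zero, map_add, tmul_add]
        abel)
    (by
      intro x y y'
      ext
      · simp [tmul_add]
      · simp only [CentralPairing.add_snd, CentralPairing.ofBilin_apply, rho_tmul, H_add, map_add,
          tmul_add]
        abel)
    (by
      intro x x' y
      ext
      · simp [add_tmul]
      · simp only [CentralPairing.add_snd, CentralPairing.add_fst, CentralPairing.ofBilin_apply,
          rho_tmul, H_add, map_add, map_zero, tmul_add, add_tmul, cr_add_left, cr_add_right, T_cr,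
          Δe_eq, tmul_sub, neg_tmul]
        abel)
    (by
      intro x b
      ext
      · simp
      · simp only [H_P, Δe_P, tmul_add, tmul_zero, T_cr, neg_tmul]
        abel)
    (by
      intro a y
      ext
      · simp
      · simp only [H_P, T_Δe, cr_P_left, add_tmul, zero_tmul, tmul_neg]
        abel)
    (by
      intro a b
      ext
      · simp
      · simp)

@[simp] theorem HExt_tl (x : M.e) (y : N.e) : HExt M N (tl x y) =
    ⟨M.toCoker x ⊗ₜ N.toCoker y, M.cr x x ⊗ₜ N.H y + M.H x ⊗ₜ N.Δe y⟩ := lift_tl _ _ _ _ _ _ _ _ _ _ x y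

@[simp] theorem HExt_bar (a : M.ee) (b : N.ee) : HExt M N (bar a b) =
    ⟨0, a ⊗ₜ b - M.T a ⊗ₜ N.T b⟩ := lift_bar _ _ _ _ _ _ _ _ _ _ a b

@[simp] theorem HExt_P_fst (t : M.ee ⊗[ℤ] N.ee) : (HExt M N (P t)).fst = 0 := by
  induction t with
  | zero => simp
  | tmul a b => simp
  | add s t hs ht => simp [hs, ht]

theorem HExt_P_snd (t : M.ee ⊗[ℤ] N.ee) :
    (HExt M N (P t)).snd = t - TensorProduct.map M.T N.T t := by
  induction t with
  | zero => simp
  | tmul a b => simp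
  | add s t hs ht => simp [hs, ht]; abel

theorem P_map_T (t : M.ee ⊗[ℤ] N.ee) :
    (P (TensorProduct.map M.T N.T t) : E M N) = -P t := by
  induction t with
  | zero => simp
  | tmul a b => simp [T_bar_T]
  | add s t hs ht => rw [map_add, map_add, map_add, neg_add_rev, hs, ht, ← map_neg, P_central]

theorem P_rho_tl (x x' : M.e) (y y' : N.e) :
    (tl x' y' + tl x y + bar (M.cr x x') (N.cr y y') : E M N) = tl x y + tl x' y' := by
  have h := tl_add (x' + x) y y'
  rw [add_tl, add_tl, add_tl, tl_add, tl_add, H_add, bar_add_right, bar_add_right] at h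
  have h2 : ∀ p q r s b b' c : E M N, (∀ w, b + w = w + b) → (∀ w, b' + w = w + b') →
      (∀ w, c + w = w + c) →
      p + q + (r + s) + (b + b' + c) = p + r + b + (q + s + b') → q + r + c = r + q := by
    intro p q r s b b' c hb hb' hc e
    have e1 : p + q + (r + s) + (b + b' + c) = p + (q + r + c) + s + (b + b') := by
      rw [← add_assoc (p + q + (r + s)), add_assoc _ (b + b') c, ← hc (b + b'), ← add_assoc,
        add_assoc (p + q), add_assoc r, ← hc s]
      simp only [add_assoc]
    have e2 : p + r + b + (q + s + b') = p + (r + q) + s + (b + b') := by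
      rw [add_assoc (p + r), ← add_assoc b, hb (q + s), add_assoc (q + s)]
      simp only [add_assoc]
    rw [e1, e2] at e
    exact add_left_cancel (add_right_cancel (add_right_cancel e))
  exact h2 _ _ _ _ _ _ _ (bar_central _ _) (bar_central _ _) (bar_central _ _) h

theorem P_rho (u v : E M N) :
    v + u + P (rho M N (HExt M N u).fst (HExt M N v).fst) = u + v := by
  induction u using induction with
  | htl x y =>
    induction v using induction with
    | htl x' y' => simpa using P_rho_tl x x' y y'
    | hbar a b => simp [bar_central]
    | hadd v₁ v₂ h₁ h₂ =>
      rw [map_add, CentralPairing.add_fst, map_add, map_add, ← add_assoc (tl x y), ← h₁,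
        add_assoc (v₁ + tl x y), P_central _ v₂, ← add_assoc (v₁ + tl x y) v₂,
        add_assoc v₁ (tl x y) v₂, ← h₂]
      simp only [add_assoc]
      rw [P_central _ (P _)]
  | hbar a b => simp [bar_central]
  | hadd u₁ u₂ h₁ h₂ =>
    rw [map_add, CentralPairing.add_fst, map_add, LinearMap.add_apply, map_add, add_assoc u₁, ← h₂,
      ← add_assoc u₁, ← add_assoc u₁, ← h₁, add_assoc (v + u₁), P_central _ u₂]
    simp only [add_assoc]

end Tensor

/-- The tensor product of square groups. -/
noncomputable def tensor (M N : SquareGroup.{u}) : SquareGroup.{u} where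
  e := Tensor.E M N
  ee := M.ee ⊗[ℤ] N.ee
  H u := (Tensor.HExt M N u).snd
  P := Tensor.P
  cross_add_left u v w := by simp [crossEffect]; abel
  cross_add_right u v w := by simp [crossEffect]; abel
  cross_P_left t w := by simp [crossEffect]
  cross_P_right t w := by simp [crossEffect]
  P_cross u v := by
    have h : crossEffect (fun u => (Tensor.HExt M N u).snd) u v =
      Tensor.rho M N (Tensor.HExt M N u).fst (Tensor.HExt M N v).fst := by
      simp [crossEffect]; abel
    rw [h]
    have h2 := Tensor.P_rho u v
    rw [add_assoc (-u - v), ← h2]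
    add_group
  P_H_P t := by
    rw [Tensor.HExt_P_snd, map_sub, Tensor.P_map_T, sub_neg_eq_add]

end SquareGroup

namespace SquareGroup

/-! ### Working with the tensor product -/

section API

variable {M N K L X : SquareGroup.{u}}

/-- The element `x ⊚ y` of the tensor product. -/
def tl (x : M.e) (y : N.e) : (tensor M N).e := Tensor.tl x y

/-- The element `a ⊗ b` of the `ee`-level of the tensor product. -/
noncomputable def tm : M.ee →ₗ[ℤ] N.ee →ₗ[ℤ] (tensor M N).ee :=
  mkBilin (C := (tensor M N).ee) (fun a b => (a ⊗ₜ[ℤ] b : M.ee ⊗[ℤ] N.ee))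
    (fun a a' b => TensorProduct.add_tmul a a' b) (fun a b b' => TensorProduct.tmul_add a b b')

theorem tm_induction {p : (tensor M N).ee → Prop} (htm : ∀ a b, p (tm a b))
    (hadd : ∀ s t, p s → p t → p (s + t)) (t : (tensor M N).ee) : p t := by
  refine TensorProduct.induction_on (motive := p) t ?_ htm hadd
  have h := htm 0 0
  rwa [map_zero] at h

/-- Homomorphisms out of the `ee`-level of the tensor product. -/
noncomputable def tmLift {C : Type*} [AddCommGroup C] (f : M.ee →ₗ[ℤ] N.ee →ₗ[ℤ] C) :
    (tensor M N).ee →ₗ[ℤ] C :=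
  AddMonoidHom.toIntLinearMap (TensorProduct.lift f).toAddMonoidHom

@[simp] theorem tmLift_tm {C : Type*} [AddCommGroup C] (f : M.ee →ₗ[ℤ] N.ee →ₗ[ℤ] C) (a : M.ee)
    (b : N.ee) : tmLift f (tm a b) = f a b := rfl

theorem tm_ext {C : Type*} [AddCommGroup C] {f g : (tensor M N).ee →ₗ[ℤ] C}
    (h : ∀ a b, f (tm a b) = g (tm a b)) : f = g := by
  ext t
  induction t using tm_induction with
  | htm a b => exact h a b
  | hadd s t hs ht => rw [map_add, map_add, hs, ht]

theorem tl_induction {p : (tensor M N).e → Prop} (htl : ∀ x y, p (tl x y))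
    (hP : ∀ a b, p ((tensor M N).P (tm a b)))
    (hadd : ∀ u v, p u → p v → p (u + v)) (u : (tensor M N).e) : p u :=
  Tensor.induction (p := p) htl hP hadd u

theorem tl_add (x : M.e) (y₁ y₂ : N.e) : tl x (y₁ + y₂) = tl x y₁ + tl x y₂ :=
  Tensor.tl_add x y₁ y₂

theorem add_tl (x₁ x₂ : M.e) (y : N.e) :
    tl (x₁ + x₂) y = tl x₁ y + tl x₂ y + (tensor M N).P (tm (M.cr x₂ x₁) (N.H y)) :=
  Tensor.add_tl x₁ x₂ y

@[simp] theorem tl_P (x : M.e) (b : N.ee) :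
    tl x (N.P b) = (tensor M N).P (tm (M.cr x x) b) := Tensor.tl_P x b

@[simp] theorem P_tl (a : M.ee) (y : N.e) :
    tl (M.P a) y = (tensor M N).P (tm a (N.Δe y)) := Tensor.P_tl a y

theorem tl_neg (x : M.e) (y : N.e) : tl x (-y) = -tl x y := Tensor.tl_neg x y

@[simp] theorem H_tl (x : M.e) (y : N.e) :
    (tensor M N).H (tl x y) = tm (M.cr x x) (N.H y) + tm (M.H x) (N.Δe y) :=
  congrArg CentralPairing.Ext.snd (Tensor.HExt_tl x y)

theorem cr_eq_rho (u v : (tensor M N).e) : (tensor M N).cr u v =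
    Tensor.rho M N (Tensor.HExt M N u).fst (Tensor.HExt M N v).fst := by
  have key : ∀ r : (tensor M N).ee, (tensor M N).H (u + v) = (tensor M N).H u +
      (tensor M N).H v + r → (tensor M N).cr u v = r := by
    intro r h
    rw [cr, crossEffect, h]
    abel
  exact key _ (congrArg CentralPairing.Ext.snd (map_add (Tensor.HExt M N) u v))

@[simp] theorem cr_tl (x x' : M.e) (y y' : N.e) :
    (tensor M N).cr (tl x y) (tl x' y') = tm (M.cr x x') (N.cr y y') := by
  rw [cr_eq_rho]
  exact congrArg₂ (fun s t => Tensor.rho M N s t)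
    (congrArg CentralPairing.Ext.fst (Tensor.HExt_tl x y))
    (congrArg CentralPairing.Ext.fst (Tensor.HExt_tl x' y'))

@[simp] theorem T_tm (a : M.ee) (b : N.ee) :
    (tensor M N).T (tm a b) = -tm (M.T a) (N.T b) := by
  have h : (tensor M N).H ((tensor M N).P (tm a b)) = tm a b - tm (M.T a) (N.T b) :=
    congrArg CentralPairing.Ext.snd (Tensor.HExt_bar a b)
  rw [T_apply, h]; abel

@[simp] theorem Δe_tl (x : M.e) (y : N.e) :
    (tensor M N).Δe (tl x y) = tm (M.Δe x) (N.Δe y) := by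
  rw [Δe_eq, cr_tl, H_tl, map_add, T_tm, T_tm, T_cr, T_Δe]
  simp only [Δe_eq, map_add, map_sub, map_neg, LinearMap.add_apply, LinearMap.sub_apply,
    LinearMap.neg_apply]
  abel

theorem P_eq_of {s t : M.ee} (w : M.ee) (h : s = t + (w - M.T w)) : M.P s = M.P t := by
  rw [h, map_add, map_sub, P_T, sub_self, add_zero]

theorem P_T_tm (a : M.ee) (b : N.ee) :
    (tensor M N).P (tm (M.T a) (N.T b)) = -(tensor M N).P (tm a b) := by
  rw [← P_T (tm a b), T_tm, map_neg, neg_neg]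

theorem P_cr_H (x₁ x₂ : M.e) (b : N.ee) :
    (tensor M N).P (tm (M.cr x₁ x₂) (N.T b)) = (tensor M N).P (tm (M.cr x₂ x₁) b) := by
  rw [← P_T (tm (M.cr x₂ x₁) b), T_tm, T_cr]
  simp only [map_neg, LinearMap.neg_apply, neg_neg]

theorem neg_tl (x : M.e) (y : N.e) :
    tl (-x) y = -tl x y + (tensor M N).P (tm (M.cr x x) (N.H y)) := by
  have h := add_tl x (-x) y
  have h0 : (tl (0 : M.e) y : (tensor M N).e) = 0 := by
    have := P_tl (0 : M.ee) y
    rwa [map_zero, map_zero, LinearMap.zero_apply, map_zero] at this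
  rw [add_neg_cancel, h0, cr_neg_left, map_neg, LinearMap.neg_apply, map_neg] at h
  rw [← add_right_inj (tl x y), ← add_assoc, ← add_left_inj
    (-(tensor M N).P (tm (M.cr x x) (N.H y))), ← h]
  add_group

/-- A subset of `M.e` which together with the image of `P` generates `M.e` as a monoid. -/
def IsGen (S : Set M.e) : Prop := AddSubmonoid.closure (S ∪ Set.range M.P) = ⊤

theorem IsGen.induction {S : Set M.e} (hS : IsGen S) {p : M.e → Prop} (h : ∀ x ∈ S, p x)
    (hP : ∀ a, p (M.P a)) (hadd : ∀ x y, p x → p y → p (x + y)) (x : M.e) : p x := by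
  have hx : x ∈ AddSubmonoid.closure (S ∪ Set.range M.P) := by
    rw [show AddSubmonoid.closure (S ∪ Set.range M.P) = ⊤ from hS]; trivial
  induction hx using AddSubmonoid.closure_induction with
  | mem x hx =>
    rcases hx with hx | ⟨a, rfl⟩
    · exact h x hx
    · exact hP a
  | zero => simpa using hP 0
  | add x y _ _ hx hy => exact hadd x y hx hy

theorem isGen_of {S : Set M.e} (h : ∀ p : M.e → Prop, (∀ x ∈ S, p x) → (∀ a, p (M.P a)) →
    (∀ x y, p x → p y → p (x + y)) → ∀ x, p x) : IsGen S := by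
  rw [IsGen, eq_top_iff]
  intro x _
  refine h (fun x => x ∈ AddSubmonoid.closure (S ∪ Set.range M.P)) ?_ ?_ ?_ x
  · intro x hx; exact AddSubmonoid.subset_closure (Or.inl hx)
  · intro a; exact AddSubmonoid.subset_closure (Or.inr ⟨a, rfl⟩)
  · intro x y hx hy; exact add_mem hx hy

theorem isGen_univ : IsGen (Set.univ : Set M.e) :=
  isGen_of fun _ h _ _ x => h x trivial

theorem isGen_tensor {S : Set M.e} {S' : Set N.e} (hS : IsGen S) (hS' : IsGen S') :
    IsGen {u : (tensor M N).e | ∃ x ∈ S, ∃ y ∈ S', u = tl x y} := by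
  refine isGen_of fun p h hP hadd u => ?_
  induction u using tl_induction with
  | hP a b => exact hP _
  | hadd u v hu hv => exact hadd u v hu hv
  | htl x y =>
    revert y
    induction x using hS.induction with
    | hP a => intro y; rw [P_tl]; exact hP _
    | hadd x x' hx hx' => intro y; rw [add_tl]; exact hadd _ _ (hadd _ _ (hx y) (hx' y)) (hP _)
    | h x hx =>
      intro y
      induction y using hS'.induction with
      | hP a => rw [tl_P]; exact hP _
      | hadd y y' hy hy' => rw [tl_add]; exact hadd _ _ hy hy'
      | h y hy => exact h _ ⟨x, hx, y, hy, rfl⟩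

/-- Morphisms out of a tensor product are determined by the `ee`-level and by generators. -/
theorem tensor_hom_ext {F G : tensor M N ⟶ X} {S : Set M.e} {S' : Set N.e} (hS : IsGen S)
    (hS' : IsGen S') (h : ∀ x ∈ S, ∀ y ∈ S', F.e (tl x y) = G.e (tl x y))
    (hee : ∀ a b, F.ee (tm a b) = G.ee (tm a b)) : F = G := by
  have hee' : F.ee = G.ee := tm_ext hee
  refine hom_ext (fun u => ?_) hee'
  induction u using (isGen_tensor hS hS').induction with
  | h u hu =>
    obtain ⟨x, hx, y, hy, rfl⟩ := hu
    exact h x hx y hy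
  | hP a => rw [F.e_P, G.e_P, hee']
  | hadd u v hu hv => rw [map_add, map_add, hu, hv]

theorem add4 (a₁ a₂ b₁ b₂ : M.e) (s₁ s₂ : M.ee) :
    a₁ + a₂ + (b₁ + b₂) + M.P (s₁ + s₂ + M.cr b₁ a₂) =
      a₁ + b₁ + M.P s₁ + (a₂ + b₂ + M.P s₂) := by
  have h := add_eq_swap b₁ a₂
  have e1 : a₁ + b₁ + M.P s₁ + (a₂ + b₂ + M.P s₂) = a₁ + (b₁ + a₂) + b₂ + M.P (s₁ + s₂) := by
    rw [add_assoc (a₁ + b₁), ← add_assoc (M.P s₁), P_central s₁, add_assoc (a₂ + b₂), map_add]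
    simp only [add_assoc]
  rw [e1, h, map_add]
  simp only [add_assoc]
  congr 3
  rw [P_central (M.cr b₁ a₂), add_assoc]

theorem add_P_add (u v : M.e) (s t : M.ee) :
    u + M.P s + (v + M.P t) = u + v + M.P (s + t) := by
  rw [add_assoc u, ← add_assoc (M.P s), P_central, map_add]
  simp only [add_assoc]

end API

section Lift

variable {M N X : SquareGroup.{u}}

/-- The construction of morphisms out of a tensor product. -/
theorem exists_lift {S : Set M.e} (hS : IsGen S) (f : M.e → N.e → X.e)
    (φ : (tensor M N).ee →ₗ[ℤ] X.ee)
    (hadd : ∀ x₁ x₂ y, f (x₁ + x₂) y = f x₁ y + f x₂ y + X.P (φ (tm (M.cr x₂ x₁) (N.H y))))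
    (hPl : ∀ a y, f (M.P a) y = X.P (φ (tm a (N.Δe y))))
    (hφ : ∀ a b, X.T (φ (tm a b)) = -φ (tm (M.T a) (N.T b)))
    (haddr : ∀ x ∈ S, ∀ y₁ y₂, f x (y₁ + y₂) = f x y₁ + f x y₂)
    (hPr : ∀ x ∈ S, ∀ b, f x (N.P b) = X.P (φ (tm (M.cr x x) b)))
    (hH : ∀ x ∈ S, ∀ y,
      X.H (f x y) = φ (tm (M.cr x x) (N.H y) + tm (M.H x) (N.Δe y)))
    (hcr : ∀ x ∈ S, ∀ x' ∈ S, ∀ y y',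
      X.cr (f x y) (f x' y') = φ (tm (M.cr x x') (N.cr y y'))) :
    ∃ F : tensor M N ⟶ X, (∀ x y, F.e (tl x y) = f x y) ∧ F.ee = φ := by
  have hcr1 : ∀ x ∈ S, ∀ x' y y',
      X.cr (f x y) (f x' y') = φ (tm (M.cr x x') (N.cr y y')) := by
    intro x hx x'
    induction x' using hS.induction with
    | h x' hx' => exact hcr x hx x' hx'
    | hP a => intro y y'; simp [hPl]
    | hadd x₁ x₂ h₁ h₂ => intro y y'; simp [hadd, cr_add_right, h₁, h₂]
  have hcr2 : ∀ x x' y y',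
      X.cr (f x y) (f x' y') = φ (tm (M.cr x x') (N.cr y y')) := by
    intro x
    induction x using hS.induction with
    | h x hx => exact hcr1 x hx
    | hP a => intro x' y y'; simp [hPl]
    | hadd x₁ x₂ h₁ h₂ => intro x' y y'; simp [hadd, cr_add_left, h₁, h₂]
  have hφ2 : ∀ a b, X.P (φ (tm (M.T a) (N.T b))) = -X.P (φ (tm a b)) := by
    intro a b
    rw [← P_T (φ (tm a b)), hφ, map_neg, neg_neg]
  have hφ3 : ∀ x₁ x₂ b, X.P (φ (tm (M.cr x₁ x₂) (N.T b))) = X.P (φ (tm (M.cr x₂ x₁) b)) := by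
    intro x₁ x₂ b
    rw [← P_T (φ (tm (M.cr x₂ x₁) b)), hφ, T_cr]
    simp only [map_neg, LinearMap.neg_apply, neg_neg]
  have haddr2 : ∀ x y₁ y₂, f x (y₁ + y₂) = f x y₁ + f x y₂ := by
    intro x
    induction x using hS.induction with
    | h x hx => exact haddr x hx
    | hP a => intro y y'; simp [hPl]
    | hadd x₁ x₂ h₁ h₂ =>
      intro y y'
      rw [hadd, hadd, hadd, h₁, h₂, H_add, map_add, map_add, map_add, map_add, ← hcr2, ← add4, map_add X.P,
        map_add φ]
  have hPr2 : ∀ x b, f x (N.P b) = X.P (φ (tm (M.cr x x) b)) := by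
    intro x
    induction x using hS.induction with
    | h x hx => exact hPr x hx
    | hP a => intro b; simp [hPl, Δe_P]
    | hadd x₁ x₂ h₁ h₂ =>
      intro b
      rw [hadd, h₁, h₂, H_P]
      simp only [map_add, cr_add_left, cr_add_right, LinearMap.add_apply, hφ3]
      simp only [← map_add]
      congr 2
      abel
  have hH2 : ∀ x y, X.H (f x y) = φ (tm (M.cr x x) (N.H y) + tm (M.H x) (N.Δe y)) := by
    intro x
    induction x using hS.induction with
    | h x hx => exact hH x hx
    | hP a => intro b; simp only [hPl, H_P, cr_P_left, hφ, T_Δe, map_neg, map_zero,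
        LinearMap.zero_apply, map_add, LinearMap.add_apply, neg_neg, zero_add]
    | hadd x₁ x₂ h₁ h₂ =>
      intro y
      rw [hadd, H_add, H_add, H_P, cr_P_right, hφ, T_cr, h₁, h₂, hcr2]
      simp only [map_add, cr_add_left, cr_add_right, LinearMap.add_apply, H_add, map_neg,
        LinearMap.neg_apply, Δe_eq, map_sub]
      abel
  let Fe : (tensor M N).e →+ X.e := Tensor.lift f (fun a b => X.P (φ (tm a b)))
    (fun a b u => P_central _ _)
    (fun a a' b => by simp)
    (fun a b b' => by simp)
    haddr2 hadd hPr2 hPl hφ2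
  have hFtl : ∀ x y, Fe (tl x y) = f x y := fun x y => Tensor.lift_tl _ _ _ _ _ _ _ _ _ _ x y
  have hFP : ∀ t, Fe ((tensor M N).P t) = X.P (φ t) := by
    intro t
    induction t using tm_induction with
    | htm a b => exact Tensor.lift_bar _ _ _ _ _ _ _ _ _ _ a b
    | hadd s t hs ht => rw [map_add, map_add, hs, ht, map_add, map_add]
  have hFcr1 : ∀ x y v, X.cr (Fe (tl x y)) (Fe v) = φ ((tensor M N).cr (tl x y) v) := by
    intro x y v
    induction v using tl_induction with
    | htl x' y' => rw [hFtl, hFtl, hcr2, cr_tl]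
    | hP a b => rw [hFP, cr_P_right, cr_P_right, map_zero]
    | hadd u v hu hv => rw [map_add, cr_add_right, cr_add_right, hu, hv, map_add]
  have hFcr : ∀ u v, X.cr (Fe u) (Fe v) = φ ((tensor M N).cr u v) := by
    intro u v
    induction u using tl_induction with
    | htl x' y' => exact hFcr1 x' y' v
    | hP a b => rw [hFP, cr_P_left, cr_P_left, map_zero]
    | hadd u v hu hv => rw [map_add, cr_add_left, cr_add_left, hu, hv, map_add]
  refine ⟨⟨Fe, φ, fun t => hFP t, fun u => ?_⟩, hFtl, rfl⟩
  induction u using tl_induction with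
  | htl x y => rw [hFtl, hH2, H_tl]
  | hP a b => rw [hFP, H_P, H_P, hφ, map_add, T_tm, map_neg]
  | hadd u v hu hv => rw [map_add, H_add, H_add, map_add, map_add, hFcr, hu, hv]

/-- Morphisms out of a tensor product. -/
noncomputable def lift {S : Set M.e} (hS : IsGen S) (f : M.e → N.e → X.e)
    (φ : (tensor M N).ee →ₗ[ℤ] X.ee)
    (hadd : ∀ x₁ x₂ y, f (x₁ + x₂) y = f x₁ y + f x₂ y + X.P (φ (tm (M.cr x₂ x₁) (N.H y))))
    (hPl : ∀ a y, f (M.P a) y = X.P (φ (tm a (N.Δe y))))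
    (hφ : ∀ a b, X.T (φ (tm a b)) = -φ (tm (M.T a) (N.T b)))
    (haddr : ∀ x ∈ S, ∀ y₁ y₂, f x (y₁ + y₂) = f x y₁ + f x y₂)
    (hPr : ∀ x ∈ S, ∀ b, f x (N.P b) = X.P (φ (tm (M.cr x x) b)))
    (hH : ∀ x ∈ S, ∀ y,
      X.H (f x y) = φ (tm (M.cr x x) (N.H y) + tm (M.H x) (N.Δe y)))
    (hcr : ∀ x ∈ S, ∀ x' ∈ S, ∀ y y',
      X.cr (f x y) (f x' y') = φ (tm (M.cr x x') (N.cr y y'))) : tensor M N ⟶ X :=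
  (exists_lift hS f φ hadd hPl hφ haddr hPr hH hcr).choose

section

variable {S : Set M.e} (hS : IsGen S) (f : M.e → N.e → X.e)
    (φ : (tensor M N).ee →ₗ[ℤ] X.ee)
    (hadd : ∀ x₁ x₂ y, f (x₁ + x₂) y = f x₁ y + f x₂ y + X.P (φ (tm (M.cr x₂ x₁) (N.H y))))
    (hPl : ∀ a y, f (M.P a) y = X.P (φ (tm a (N.Δe y))))
    (hφ : ∀ a b, X.T (φ (tm a b)) = -φ (tm (M.T a) (N.T b)))
    (haddr : ∀ x ∈ S, ∀ y₁ y₂, f x (y₁ + y₂) = f x y₁ + f x y₂)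
    (hPr : ∀ x ∈ S, ∀ b, f x (N.P b) = X.P (φ (tm (M.cr x x) b)))
    (hH : ∀ x ∈ S, ∀ y,
      X.H (f x y) = φ (tm (M.cr x x) (N.H y) + tm (M.H x) (N.Δe y)))
    (hcr : ∀ x ∈ S, ∀ x' ∈ S, ∀ y y',
      X.cr (f x y) (f x' y') = φ (tm (M.cr x x') (N.cr y y')))

@[simp] theorem lift_e_tl (x : M.e) (y : N.e) :
    (lift hS f φ hadd hPl hφ haddr hPr hH hcr).e (tl x y) = f x y :=
  (exists_lift hS f φ hadd hPl hφ haddr hPr hH hcr).choose_spec.1 x y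

@[simp] theorem lift_ee : (lift hS f φ hadd hPl hφ haddr hPr hH hcr).ee = φ :=
  (exists_lift hS f φ hadd hPl hφ haddr hPr hH hcr).choose_spec.2

end

end Lift

end SquareGroup

namespace SquareGroup

variable {M N K L X M' N' : SquareGroup.{u}}

/-! ### Functoriality of the tensor product -/

/-- The tensor product of morphisms: `x ⊚ y ↦ f x ⊚ g y` and `a ⊗ b ↦ f a ⊗ g b`. -/
noncomputable def tensorMap (f : M ⟶ M') (g : N ⟶ N') : tensor M N ⟶ tensor M' N' :=
  lift isGen_univ (fun x y => tl (f.e x) (g.e y)) (tmLift ((tm.compl₂ g.ee).comp f.ee))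
    (fun x₁ x₂ y => by simp [add_tl, ee_cr, g.ee_H])
    (fun a y => by simp [f.e_P, ee_Δe])
    (fun a b => by simp [ee_T])
    (fun x _ y₁ y₂ => by simp [tl_add])
    (fun x _ b => by simp [g.e_P, ee_cr])
    (fun x _ y => by simp [ee_cr, ee_Δe, f.ee_H, g.ee_H])
    (fun x _ x' _ y y' => by simp [ee_cr])

@[simp] theorem tensorMap_tl (f : M ⟶ M') (g : N ⟶ N') (x : M.e) (y : N.e) :
    (tensorMap f g).e (tl x y) = tl (f.e x) (g.e y) := lift_e_tl _ _ _ _ _ _ _ _ _ _ _ _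

@[simp] theorem tensorMap_tm (f : M ⟶ M') (g : N ⟶ N') (a : M.ee) (b : N.ee) :
    (tensorMap f g).ee (tm a b) = tm (f.ee a) (g.ee b) := by
  rw [tensorMap, lift_ee]; rfl

/-! ### Associativity -/

section Assoc

/-- The associativity isomorphism on the `ee`-level. -/
noncomputable def assocEE (M N K : SquareGroup.{u}) :
    (tensor (tensor M N) K).ee →ₗ[ℤ] (tensor M (tensor N K)).ee :=
  tmLift (tmLift (mkBilin (fun a b => (tm a).comp (tm b))
    (fun a a' b => by ext c; simp) (fun a b b' => by ext c; simp)))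

@[simp] theorem assocEE_tm (a : M.ee) (b : N.ee) (c : K.ee) :
    assocEE M N K (tm (tm a b) c) = tm a (tm b c) := rfl

/-- The inverse of the associativity isomorphism on the `ee`-level. -/
noncomputable def assocEEInv (M N K : SquareGroup.{u}) :
    (tensor M (tensor N K)).ee →ₗ[ℤ] (tensor (tensor M N) K).ee :=
  tmLift (mkBilin (fun a t => tmLift (tm.comp (tm a)) t)
    (fun a a' t => by
      induction t using tm_induction with
      | htm b c => simp
      | hadd s t hs ht => rw [map_add, hs, ht, map_add, map_add]; abel)
    (fun a t t' => map_add _ _ _))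

@[simp] theorem assocEEInv_tm (a : M.ee) (b : N.ee) (c : K.ee) :
    assocEEInv M N K (tm a (tm b c)) = tm (tm a b) c := rfl

theorem P_T_Δ (a : M.ee) (b : N.ee) (z : K.e) :
    (tensor M (tensor N K)).P (tm (M.T a) (tm (N.T b) (K.Δe z))) =
      -(tensor M (tensor N K)).P (tm a (tm b (K.Δe z))) := by
  rw [← P_T_tm, T_tm, T_Δe]
  simp only [map_neg, neg_neg]

/-- Auxiliary map for the associativity isomorphism: for fixed `z`, the second component of
`assocAux z u` is the image of `u ⊚ z`. -/
noncomputable def assocPairing (M N K : SquareGroup.{u}) (z : K.e) :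
    CentralPairing (Coker M ⊗[ℤ] Coker N) (tensor M (tensor N K)).e where
  toFun c c' := (tensor M (tensor N K)).P
    (assocEE M N K (tm (M := tensor M N) (Tensor.rho M N c' c) (K.H z)))
  add_left a b c := by
    rw [map_add]
    exact (congrArg (fun t => (tensor M (tensor N K)).P (assocEE M N K t))
      (LinearMap.map_add₂ (tm (M := tensor M N)) _ _ _)).trans (by rw [map_add, map_add])
  add_right a b c := by
    rw [map_add]
    exact (congrArg (fun t => (tensor M (tensor N K)).P (assocEE M N K t))
      (LinearMap.map_add₂ (tm (M := tensor M N)) _ _ _)).trans (by rw [map_add, map_add])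
  central a b u := P_central _ _

theorem assocPairing_apply (z : K.e) (x x' : M.e) (y y' : N.e) :
    (assocPairing M N K z).toFun (M.toCoker x ⊗ₜ N.toCoker y) (M.toCoker x' ⊗ₜ N.toCoker y') =
      (tensor M (tensor N K)).P (tm (M.cr x' x) (tm (N.cr y' y) (K.H z))) := rfl

theorem assocPairing_eq (z : K.e) (u v : (tensor M N).e) :
    (assocPairing M N K z).toFun (Tensor.HExt M N u).fst (Tensor.HExt M N v).fst =
      (tensor M (tensor N K)).P (assocEE M N K (tm ((tensor M N).cr v u) (K.H z))) := by
  rw [cr_eq_rho]; rfl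

open TensorProduct in
/-- Auxiliary map for the associativity isomorphism. -/
noncomputable def assocAux (M N K : SquareGroup.{u}) (z : K.e) :
    (tensor M N).e →+ (assocPairing M N K z).Ext :=
  Tensor.lift (fun x y => ⟨M.toCoker x ⊗ₜ N.toCoker y, tl x (tl y z)⟩)
    (fun a b => ⟨0, (tensor M (tensor N K)).P (tm a (tm b (K.Δe z)))⟩)
    (fun a b u => by
      ext
      · simp
      · simp [CentralPairing.zero_left, CentralPairing.zero_right, P_central])
    (fun a a' b => by ext <;> simp [CentralPairing.zero_left])
    (fun a b b' => by ext <;> simp [CentralPairing.zero_left])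
    (fun x y y' => by
      ext
      · simp [tmul_add]
      · simp [assocPairing_apply, add_tl, tl_add])
    (fun x x' y => by
      ext
      · simp [add_tmul]
      · simp only [CentralPairing.add_snd, CentralPairing.add_fst, assocPairing_apply,
          CentralPairing.zero_right, add_tl, H_tl, map_add, add_zero, add_assoc]
        congr 2
        exact P_central _ _)
    (fun x b => by
      ext
      · simp
      · simp)
    (fun a y => by
      ext
      · simp
      · simp)
    (fun a b => by
      ext
      · simp
      · simp [P_T_Δ, CentralPairing.zero_left])

theorem assocAux_tl (z : K.e) (x : M.e) (y : N.e) : assocAux M N K z (tl x y) =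
    ⟨M.toCoker x ⊗ₜ N.toCoker y, tl x (tl y z)⟩ := Tensor.lift_tl _ _ _ _ _ _ _ _ _ _ x y

theorem assocAux_P (z : K.e) (a : M.ee) (b : N.ee) :
    assocAux M N K z ((tensor M N).P (tm a b)) =
      ⟨0, (tensor M (tensor N K)).P (tm a (tm b (K.Δe z)))⟩ :=
  Tensor.lift_bar _ _ _ _ _ _ _ _ _ _ a b

theorem assocAux_fst (z : K.e) (u : (tensor M N).e) :
    (assocAux M N K z u).fst = (Tensor.HExt M N u).fst := by
  induction u using tl_induction with
  | htl x y =>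
    rw [assocAux_tl]
    exact (congrArg CentralPairing.Ext.fst (Tensor.HExt_tl x y)).symm
  | hP a b =>
    rw [assocAux_P]
    exact (congrArg CentralPairing.Ext.fst (Tensor.HExt_bar a b)).symm
  | hadd u v hu hv =>
    rw [map_add, CentralPairing.add_fst, hu, hv]
    exact (congrArg CentralPairing.Ext.fst (map_add (Tensor.HExt M N) u v)).symm

theorem assocAux_add (z : K.e) (u v : (tensor M N).e) :
    (assocAux M N K z (u + v)).snd = (assocAux M N K z u).snd + (assocAux M N K z v).snd +
      (tensor M (tensor N K)).P (assocEE M N K (tm ((tensor M N).cr v u) (K.H z))) := by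
  rw [map_add, CentralPairing.add_snd, assocAux_fst, assocAux_fst, assocPairing_eq]

/-- The associativity morphism: `(x ⊚ y) ⊚ z ↦ x ⊚ (y ⊚ z)` and
`(a ⊗ b) ⊗ c ↦ a ⊗ (b ⊗ c)`. -/
noncomputable def assocHom (M N K : SquareGroup.{u}) :
    tensor (tensor M N) K ⟶ tensor M (tensor N K) :=
  lift (isGen_tensor isGen_univ isGen_univ) (fun u z => (assocAux M N K z u).snd) (assocEE M N K)
    (fun u v z => assocAux_add z u v)
    (fun t z => by
      induction t using tm_induction with
      | htm a b => rw [assocAux_P]; rfl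
      | hadd s t hs ht =>
        rw [map_add, assocAux_add, hs, ht, cr_P_left]
        simp)
    (fun t c => by
      induction t using tm_induction with
      | htm a b => simp
      | hadd s t hs ht => simp only [map_add, LinearMap.add_apply, hs, ht]; abel)
    (by
      rintro _ ⟨x, -, y, -, rfl⟩ z z'
      simp [assocAux_tl, tl_add])
    (by
      rintro _ ⟨x, -, y, -, rfl⟩ c
      simp [assocAux_tl])
    (by
      rintro _ ⟨x, -, y, -, rfl⟩ z
      simp [assocAux_tl, add_assoc])
    (by
      rintro _ ⟨x, -, y, -, rfl⟩ _ ⟨x', -, y', -, rfl⟩ z z'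
      simp [assocAux_tl])

@[simp] theorem assocHom_tl (x : M.e) (y : N.e) (z : K.e) :
    (assocHom M N K).e (tl (tl x y) z) = tl x (tl y z) := by
  rw [assocHom, lift_e_tl, assocAux_tl]

@[simp] theorem assocHom_ee : (assocHom M N K).ee = assocEE M N K := lift_ee _ _ _ _ _ _ _ _ _ _

/-- Auxiliary map for the inverse of the associativity isomorphism. -/
noncomputable def assocInvAux (M N K : SquareGroup.{u}) (x : M.e) :
    (tensor N K).e →+ (tensor (tensor M N) K).e :=
  Tensor.lift (fun y z => tl (tl x y) z)
    (fun b c => (tensor (tensor M N) K).P (tm (tm (M.cr x x) b) c))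
    (fun b c u => P_central _ _)
    (fun b b' c => by simp)
    (fun b c c' => by simp)
    (fun y z z' => tl_add _ _ _)
    (fun y y' z => by simp [tl_add, add_tl])
    (fun y c => by simp)
    (fun b z => by simp)
    (fun b c => by
      rw [← P_T_tm, T_tm, T_cr]
      simp only [map_neg, LinearMap.neg_apply, neg_neg])

@[simp] theorem assocInvAux_tl (x : M.e) (y : N.e) (z : K.e) :
    assocInvAux M N K x (tl y z) = tl (tl x y) z := Tensor.lift_tl _ _ _ _ _ _ _ _ _ _ y z

theorem assocInvAux_P (x : M.e) (t : (tensor N K).ee) :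
    assocInvAux M N K x ((tensor N K).P t) =
      (tensor (tensor M N) K).P (assocEEInv M N K (tm (M.cr x x) t)) := by
  induction t using tm_induction with
  | htm b c => exact Tensor.lift_bar _ _ _ _ _ _ _ _ _ _ b c
  | hadd s t hs ht => simp only [map_add, hs, ht]

theorem assocInvAux_cr (x x' : M.e) (u v : (tensor N K).e) :
    (tensor (tensor M N) K).cr (assocInvAux M N K x u) (assocInvAux M N K x' v) =
      assocEEInv M N K (tm (M.cr x x') ((tensor N K).cr u v)) := by
  induction u using tl_induction with
  | htl y z =>
    induction v using tl_induction with
    | htl y' z' => simp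
    | hP a b => rw [assocInvAux_P, cr_P_right, cr_P_right, map_zero, map_zero]
    | hadd u v hu hv => rw [map_add, cr_add_right, cr_add_right, hu, hv, map_add, map_add]
  | hP a b => rw [assocInvAux_P, cr_P_left, cr_P_left, map_zero, map_zero]
  | hadd u u' hu hv => rw [map_add, cr_add_left, cr_add_left, hu, hv, map_add, map_add]

theorem assocInvAux_add (x x' : M.e) (v : (tensor N K).e) :
    assocInvAux M N K (x + x') v = assocInvAux M N K x v + assocInvAux M N K x' v +
      (tensor (tensor M N) K).P (assocEEInv M N K (tm (M.cr x' x) ((tensor N K).H v))) := by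
  induction v using tl_induction with
  | htl y z =>
    simp only [assocInvAux_tl, add_tl, H_tl, map_add, assocEEInv_tm, cr_tl, P_tl, cr_P_left,
      map_zero, LinearMap.zero_apply, add_zero, add_assoc, cr_add_left]
    congr 2
    exact P_central _ _
  | hP b c =>
    rw [assocInvAux_P, assocInvAux_P, assocInvAux_P, H_P, T_tm]
    simp only [← map_add]
    refine P_eq_of (tm (tm (M.cr x x') b) c) ?_
    simp only [map_add, map_neg, cr_add_left, cr_add_right, LinearMap.add_apply, assocEEInv_tm,
      T_tm, T_cr, LinearMap.neg_apply]
    abel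
  | hadd u v hu hv =>
    rw [map_add, map_add, map_add, hu, hv, H_add, map_add, map_add, map_add, map_add,
      ← assocInvAux_cr, ← add4, map_add, map_add,
      map_add (assocEEInv M N K), map_add]

/-- The inverse of the associativity isomorphism on the `e`-level. -/
noncomputable def assocInv (M N K : SquareGroup.{u}) :
    (tensor M (tensor N K)).e →+ (tensor (tensor M N) K).e :=
  Tensor.lift (N := tensor N K) (fun x v => assocInvAux M N K x v)
    (fun a t => (tensor (tensor M N) K).P (assocEEInv M N K (tm a t)))
    (fun a t u => P_central _ _)
    (fun a a' t => by simp)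
    (fun a t t' => by simp)
    (fun x v v' => map_add _ _ _)
    (fun x x' v => assocInvAux_add x x' v)
    (fun x t => assocInvAux_P x t)
    (fun a v => by
      induction v using tl_induction with
      | htl y z => simp
      | hP b c => rw [assocInvAux_P, Δe_P]; simp
      | hadd u v hu hv => simp only [map_add, hu, hv])
    (fun a t => by
      induction t using tm_induction with
      | htm b c =>
        rw [assocEEInv_tm, ← P_T (tm (tm a b) c)]
        simp
      | hadd s t hs ht => simp only [map_add, hs, ht, neg_add_rev]; rw [← map_neg, P_central])

@[simp] theorem assocInv_tl (x : M.e) (y : N.e) (z : K.e) :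
    assocInv M N K (tl x (tl y z)) = tl (tl x y) z :=
  (Tensor.lift_tl (N := tensor N K) _ _ _ _ _ _ _ _ _ _ x (tl y z)).trans (assocInvAux_tl x y z)

theorem assocInv_P (t : (tensor M (tensor N K)).ee) :
    assocInv M N K ((tensor M (tensor N K)).P t) =
      (tensor (tensor M N) K).P (assocEEInv M N K t) := by
  induction t using tm_induction with
  | htm b c => exact Tensor.lift_bar (N := tensor N K) _ _ _ _ _ _ _ _ _ _ b c
  | hadd s t hs ht => simp only [map_add, hs, ht]

theorem assocEEInv_comp : (assocEEInv M N K).comp (assocEE M N K) = LinearMap.id := by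
  refine tm_ext fun t c => ?_
  induction t using tm_induction with
  | htm a b => rfl
  | hadd s t hs ht => simp only [map_add, LinearMap.add_apply, hs, ht]

theorem assocEE_comp : (assocEE M N K).comp (assocEEInv M N K) = LinearMap.id := by
  refine tm_ext fun a t => ?_
  induction t using tm_induction with
  | htm b c => rfl
  | hadd s t hs ht => simp only [map_add, hs, ht]

/-- The associativity isomorphism. -/
noncomputable def assocIso (M N K : SquareGroup.{u}) :
    tensor (tensor M N) K ≅ tensor M (tensor N K) :=
  isoOfInverse (assocHom M N K) (assocInv M N K) (assocEEInv M N K)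
    (fun u => by
      induction u using (isGen_tensor (isGen_tensor isGen_univ isGen_univ)
        isGen_univ).induction with
      | h u hu =>
        obtain ⟨_, ⟨x, -, y, -, rfl⟩, z, -, rfl⟩ := hu
        simp
      | hP t =>
        rw [(assocHom M N K).e_P, assocInv_P, assocHom_ee]
        exact congrArg _ (LinearMap.congr_fun assocEEInv_comp t)
      | hadd u v hu hv => rw [map_add, map_add, hu, hv])
    (fun u => by
      induction u using (isGen_tensor isGen_univ
        (isGen_tensor isGen_univ isGen_univ)).induction with
      | h u hu =>
        obtain ⟨x, -, _, ⟨y, -, z, -, rfl⟩, rfl⟩ := hu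
        simp
      | hP t =>
        rw [assocInv_P, (assocHom M N K).e_P, assocHom_ee]
        exact congrArg _ (LinearMap.congr_fun assocEE_comp t)
      | hadd u v hu hv => rw [map_add, map_add, hu, hv])
    (by rw [assocHom_ee, assocEEInv_comp]) (by rw [assocHom_ee, assocEE_comp])

@[simp] theorem assocIso_hom_tl (x : M.e) (y : N.e) (z : K.e) :
    (assocIso M N K).hom.e (tl (tl x y) z) = tl x (tl y z) := assocHom_tl x y z

@[simp] theorem assocIso_hom_tm (a : M.ee) (b : N.ee) (c : K.ee) :
    (assocIso M N K).hom.ee (tm (tm a b) c) = tm a (tm b c) :=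
  (LinearMap.congr_fun assocHom_ee _).trans (assocEE_tm a b c)

end Assoc

end SquareGroup

/-- The integer `n (n - 1) / 2`. -/
def choose2 (n : ℤ) : ℤ := n * (n - 1) / 2

theorem two_mul_choose2 (n : ℤ) : 2 * choose2 n = n * (n - 1) :=
  Int.mul_ediv_cancel' (Int.even_mul_pred_self n).two_dvd

theorem choose2_add (m n : ℤ) : choose2 (m + n) = choose2 m + choose2 n + m * n := by
  have h1 := two_mul_choose2 (m + n)
  have h2 := two_mul_choose2 m
  have h3 := two_mul_choose2 n
  nlinarith

namespace SquareGroup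

variable {M N K L X M' N' : SquareGroup.{u}}

/-! ### Symmetry -/

/-- The symmetry morphism: `x ⊚ y ↦ y ⊚ x - H y ⊗̄ T H x` and `a ⊗ b ↦ b ⊗ a`. -/
noncomputable def braidHom (M N : SquareGroup.{u}) : tensor M N ⟶ tensor N M :=
  lift isGen_univ (fun x y => tl y x + (tensor N M).P (-tm (N.H y) (M.T (M.H x))))
    (tmLift tm.flip)
    (fun x x' y => by
      rw [tl_add, add_P_add, add_assoc (tl y x + tl y x'), ← map_add]
      congr 2
      simp only [H_add, map_add, tmLift_tm, LinearMap.flip_apply, T_cr, map_neg]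
      abel)
    (fun a y => by
      simp only [tl_P, ← map_add]
      refine P_eq_of (-tm (N.H y) (M.T a)) ?_
      simp only [H_P, tmLift_tm, LinearMap.flip_apply, Δe_eq, map_add, map_sub, map_neg, T_tm, T_T,
        LinearMap.add_apply, LinearMap.sub_apply]
      abel)
    (fun a b => by simp)
    (fun x _ y y' => by
      rw [add_tl, add_P_add, add_assoc (tl y x + tl y' x), ← map_add]
      congr 1
      refine P_eq_of (tm (N.cr y' y) (M.H x)) ?_
      simp only [H_add, map_add, map_neg, T_tm, T_cr, LinearMap.neg_apply, LinearMap.add_apply]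
      abel)
    (fun x _ b => by
      simp only [P_tl, ← map_add]
      refine P_eq_of (-tm b (M.H x)) ?_
      simp only [H_P, tmLift_tm, LinearMap.flip_apply, Δe_eq, map_add, map_sub, map_neg, T_tm,
        LinearMap.add_apply]
      abel)
    (fun x _ y => by
      rw [H_add, H_P, cr_P_right, H_tl]
      simp only [map_add, tmLift_tm, LinearMap.flip_apply, Δe_eq,
        map_neg, map_sub, LinearMap.add_apply, LinearMap.sub_apply, T_tm, T_T]
      abel)
    (fun x _ x' _ y y' => by
      rw [cr_add_left, cr_P_left, cr_add_right, cr_P_right]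
      simp)

@[simp] theorem braidHom_tl (x : M.e) (y : N.e) : (braidHom M N).e (tl x y) =
    tl y x + (tensor N M).P (-tm (N.H y) (M.T (M.H x))) := lift_e_tl _ _ _ _ _ _ _ _ _ _ _ _

@[simp] theorem braidHom_tm (a : M.ee) (b : N.ee) : (braidHom M N).ee (tm a b) = tm b a :=
  LinearMap.congr_fun (lift_ee _ _ _ _ _ _ _ _ _ _) (tm a b)

theorem braidHom_braidHom (M N : SquareGroup.{u}) : braidHom M N ≫ braidHom N M = 𝟙 _ := by
  refine tensor_hom_ext isGen_univ isGen_univ (fun x _ y _ => ?_) (fun a b => ?_)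
  · rw [comp_e, braidHom_tl, map_add, (braidHom N M).e_P, braidHom_tl, map_neg (braidHom N M).ee,
      braidHom_tm, add_assoc, ← map_add, id_e,
      P_eq_of (-tm (M.H x) (N.T (N.H y))) (t := 0), map_zero, add_zero]
    simp only [map_neg, T_tm, T_T]
    abel
  · simp

/-- The symmetry isomorphism. -/
noncomputable def braidIso (M N : SquareGroup.{u}) : tensor M N ≅ tensor N M where
  hom := braidHom M N
  inv := braidHom N M
  hom_inv_id := braidHom_braidHom M N
  inv_hom_id := braidHom_braidHom N M

/-! ### The unit -/

/-- The square group `ℤ_nil`: both levels are `ℤ`, `H n = n (n - 1) / 2` and `P = 0`. -/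
def Znil : SquareGroup.{u} where
  e := ULift.{u} ℤ
  ee := ULift.{u} ℤ
  H n := ⟨choose2 n.down⟩
  P := 0
  cross_add_left x y z := by
    ext; simp [crossEffect, choose2_add]; ring
  cross_add_right x y z := by
    ext; simp [crossEffect, choose2_add]; ring
  cross_P_left a y := by ext; simp [crossEffect, choose2]
  cross_P_right a y := by ext; simp [crossEffect, choose2]
  P_cross x y := by
    change (0 : ULift.{u} ℤ) = -x - y + x + y
    abel
  P_H_P a := by simp

/-- The integer `n` as an element of the `e`-level of `ℤ_nil`. -/
def zn (n : ℤ) : Znil.{u}.e := (⟨n⟩ : ULift.{u} ℤ)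

/-- The integer `n` as an element of the `ee`-level of `ℤ_nil`. -/
def znn : ℤ →ₗ[ℤ] Znil.{u}.ee :=
  AddMonoidHom.toIntLinearMap (AddMonoidHom.mk' (fun n => (⟨n⟩ : ULift.{u} ℤ)) (fun _ _ => rfl))

/-- The integer underlying an element of the `ee`-level of `ℤ_nil`. -/
def zval : Znil.{u}.ee →ₗ[ℤ] ℤ :=
  AddMonoidHom.toIntLinearMap (AddMonoidHom.mk' (fun n : ULift.{u} ℤ => n.down) (fun _ _ => rfl))

@[simp] theorem zval_znn (n : ℤ) : zval.{u} (znn n) = n := rfl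
@[simp] theorem znn_zval (a : Znil.{u}.ee) : znn (zval a) = a := rfl
theorem zn_add (m n : ℤ) : zn.{u} (m + n) = zn m + zn n := rfl
theorem zn_surj (x : Znil.{u}.e) : ∃ n, x = zn n := ⟨ULift.down x, rfl⟩
theorem znn_surj (x : Znil.{u}.ee) : ∃ n, x = znn n := ⟨ULift.down x, rfl⟩
@[simp] theorem H_zn (n : ℤ) : Znil.{u}.H (zn n) = znn (choose2 n) := rfl
@[simp] theorem P_znn (a : Znil.{u}.ee) : Znil.{u}.P a = 0 := rfl

@[simp] theorem cr_zn (m n : ℤ) : Znil.{u}.cr (zn m) (zn n) = znn (m * n) := by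
  have h := H_add (zn.{u} m) (zn n)
  rw [← zn_add, H_zn, H_zn, H_zn, choose2_add, map_add, map_add] at h
  exact (add_left_cancel h).symm

@[simp] theorem T_znn (a : Znil.{u}.ee) : Znil.{u}.T a = -a := by
  rw [T_apply, P_znn, H_zero, zero_sub]

@[simp] theorem Δe_zn (n : ℤ) : Znil.{u}.Δe (zn n) = znn n := by
  rw [Δe_eq, cr_zn, H_zn, T_znn, ← map_neg, ← map_sub, ← map_add]
  congr 1
  have := two_mul_choose2 n
  linarith

theorem isGen_Znil : IsGen {x : Znil.{u}.e | x = zn 1 ∨ x = zn (-1)} := by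
  refine isGen_of fun p h hP hadd x => ?_
  obtain ⟨n, rfl⟩ := zn_surj x
  induction n using Int.induction_on with
  | zero => exact hP 0
  | succ n ih => exact hadd _ _ ih (h _ (Or.inl rfl))
  | pred n ih => exact hadd _ _ ih (h _ (Or.inr rfl))

theorem P_Δe (x : M.e) : M.P (M.Δe x) = 0 := by
  rw [Δe_eq, map_add, map_sub, P_T, P_cr]
  add_group

/-- The value `n x + (n (n - 1) / 2) P H x`. -/
def zact (n : ℤ) (x : M.e) : M.e := n • x + M.P (choose2 n • M.H x)

theorem zact_add (m n : ℤ) (x : M.e) :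
    zact (m + n) x = zact m x + zact n x + M.P ((m * n) • M.H x) := by
  rw [zact, zact, zact, add_P_add, add_assoc, ← map_add, choose2_add, add_zsmul, add_zsmul,
    add_zsmul]

@[simp] theorem zact_one (x : M.e) : zact 1 x = x := by simp [zact, choose2]

@[simp] theorem zact_neg_one (x : M.e) : zact (-1) x = -x + M.P (M.H x) := by
  simp [zact, choose2]

/-- The left unit morphism: `n ⊚ x ↦ n x + (n (n - 1) / 2) P H x` and `n ⊗ a ↦ n a`. -/
noncomputable def leftUnitHom (M : SquareGroup.{u}) : tensor Znil M ⟶ M :=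
  lift isGen_Znil (fun n x => zact (ULift.down n) x)
    (tmLift ((LinearMap.lsmul ℤ M.ee).comp zval))
    (fun m n x => by
      obtain ⟨m, rfl⟩ := zn_surj m
      obtain ⟨n, rfl⟩ := zn_surj n
      rw [cr_zn, mul_comm]
      exact zact_add m n x)
    (fun a x => by
      rw [P_znn, tmLift_tm]
      change zact 0 x = M.P (zval a • M.Δe x)
      rw [map_zsmul, P_Δe, zsmul_zero]
      simp [zact, choose2])
    (fun a b => by simp)
    (by
      rintro x (rfl | rfl) y y'
      · exact (zact_one _).trans (congrArg₂ (· + ·) (zact_one y) (zact_one y')).symm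
      · refine ((zact_neg_one _).trans ?_).trans
          (congrArg₂ (· + ·) (zact_neg_one y) (zact_neg_one y')).symm
        have h : M.cr y y' = M.cr (-y) (-y') := by rw [cr_neg_left, cr_neg_right, neg_neg]
        rw [add_P_add, neg_add_rev, H_add, map_add, P_central, h, ← add_assoc,
          ← add_eq_swap (-y) (-y')])
    (by
      rintro x (rfl | rfl) b
      · rw [cr_zn]
        exact (zact_one _).trans (by simp)
      · rw [cr_zn]
        refine (zact_neg_one _).trans ?_
        simp [M.P_H_P])
    (by
      rintro x (rfl | rfl) y
      · rw [cr_zn, H_zn]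
        refine (congrArg M.H (zact_one _)).trans ?_
        simp [choose2]
      · rw [cr_zn, H_zn]
        refine (congrArg M.H (zact_neg_one _)).trans ?_
        simp only [choose2, H_add, H_neg, H_P, cr_P_right, Δe_zn, map_add, tmLift_tm]
        simp [Δe_eq]
        abel)
    (by
      rintro x (rfl | rfl) x' (rfl | rfl) y y' <;> rw [cr_zn]
      · refine (congrArg₂ M.cr (zact_one _) (zact_one _)).trans ?_
        simp
      · refine (congrArg₂ M.cr (zact_one _) (zact_neg_one _)).trans ?_
        simp [cr_add_right, cr_neg_right]
      · refine (congrArg₂ M.cr (zact_neg_one _) (zact_one _)).trans ?_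
        simp [cr_add_left, cr_neg_left]
      · refine (congrArg₂ M.cr (zact_neg_one _) (zact_neg_one _)).trans ?_
        simp [cr_add_left, cr_neg_left, cr_add_right, cr_neg_right])

@[simp] theorem leftUnitHom_tl (n : ℤ) (x : M.e) :
    (leftUnitHom M).e (tl (zn n) x) = zact n x := lift_e_tl _ _ _ _ _ _ _ _ _ _ _ _

@[simp] theorem leftUnitHom_tm (n : Znil.{u}.ee) (a : M.ee) :
    (leftUnitHom M).ee (tm n a) = zval n • a :=
  LinearMap.congr_fun (lift_ee _ _ _ _ _ _ _ _ _ _) (tm n a)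

/-- The left unit isomorphism. -/
noncomputable def leftUnitIso (M : SquareGroup.{u}) : tensor Znil M ≅ M where
  hom := leftUnitHom M
  inv :=
    { e := AddMonoidHom.mk' (fun x => tl (zn 1) x) (tl_add (zn 1))
      ee := tm (znn 1)
      e_P := fun a => by simp
      ee_H := fun x => by simp [choose2] }
  hom_inv_id := by
    refine tensor_hom_ext isGen_Znil isGen_univ ?_ ?_
    · rintro x (rfl | rfl) y -
      · simp
      · simp [tl_add, tl_neg]
        rw [show zn.{u} (-1) = -zn 1 from rfl, neg_tl, cr_zn]
        simp
    · intro n a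
      obtain ⟨n, rfl⟩ := znn_surj n
      have h : znn.{u} n = n • znn 1 := by rw [← map_zsmul]; simp
      simp [h]
  inv_hom_id := by
    refine hom_ext (fun x => ?_) (LinearMap.ext fun a => ?_)
    · simp
    · simp

/-- The right unit isomorphism: `x ⊚ n ↦ n x` and `a ⊗ n ↦ n a`. -/
noncomputable def rightUnitIso (M : SquareGroup.{u}) : tensor M Znil ≅ M :=
  braidIso M Znil ≪≫ leftUnitIso M

@[simp] theorem rightUnitIso_hom_tl (n : ℤ) (x : M.e) :
    (rightUnitIso M).hom.e (tl x (zn n)) = n • x := by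
  simp [rightUnitIso, braidIso, leftUnitIso, (leftUnitHom M).e_P, zact, P_T]

@[simp] theorem rightUnitIso_hom_tm (n : Znil.{u}.ee) (a : M.ee) :
    (rightUnitIso M).hom.ee (tm a n) = zval n • a := by
  simp [rightUnitIso, braidIso, leftUnitIso]

end SquareGroup

namespace SquareGroup

variable {M N K L X Y M' N' K' L' : SquareGroup.{u}}

/-! ### The symmetric monoidal category of square groups -/

@[simp] theorem assocIso_inv_tl (x : M.e) (y : N.e) (z : K.e) :
    (assocIso M N K).inv.e (tl x (tl y z)) = tl (tl x y) z := assocInv_tl x y z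

@[simp] theorem assocIso_inv_tm (a : M.ee) (b : N.ee) (c : K.ee) :
    (assocIso M N K).inv.ee (tm a (tm b c)) = tm (tm a b) c := rfl

@[simp] theorem leftUnitIso_hom_tl (n : ℤ) (x : M.e) :
    (leftUnitIso M).hom.e (tl (zn n) x) = zact n x := leftUnitHom_tl n x

@[simp] theorem leftUnitIso_hom_tm (n : Znil.{u}.ee) (a : M.ee) :
    (leftUnitIso M).hom.ee (tm n a) = zval n • a := leftUnitHom_tm n a

@[simp] theorem braidIso_hom_tl (x : M.e) (y : N.e) : (braidIso M N).hom.e (tl x y) =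
    tl y x + (tensor N M).P (-tm (N.H y) (M.T (M.H x))) := braidHom_tl x y

@[simp] theorem braidIso_hom_tm (a : M.ee) (b : N.ee) :
    (braidIso M N).hom.ee (tm a b) = tm b a := braidHom_tm a b

theorem e_zact (f : M ⟶ N) (n : ℤ) (x : M.e) : f.e (zact n x) = zact n (f.e x) := by
  simp [zact, f.e_P, f.ee_H]

theorem tensorMap_id (M N : SquareGroup.{u}) : tensorMap (𝟙 M) (𝟙 N) = 𝟙 (tensor M N) :=
  tensor_hom_ext isGen_univ isGen_univ (fun x _ y _ => by simp) (fun a b => by simp)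

theorem tensorMap_comp (f : M ⟶ N) (f' : M' ⟶ N') (g : N ⟶ K) (g' : N' ⟶ K') :
    tensorMap f f' ≫ tensorMap g g' = tensorMap (f ≫ g) (f' ≫ g') :=
  tensor_hom_ext isGen_univ isGen_univ (fun x _ y _ => by simp) (fun a b => by simp)

theorem assoc_naturality (f : M ⟶ M') (g : N ⟶ N') (h : K ⟶ K') :
    tensorMap (tensorMap f g) h ≫ (assocIso M' N' K').hom =
      (assocIso M N K).hom ≫ tensorMap f (tensorMap g h) := by
  refine tensor_hom_ext (isGen_tensor isGen_univ isGen_univ) isGen_univ ?_ (fun t c => ?_)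
  · rintro _ ⟨x, -, y, -, rfl⟩ z -
    simp
  · induction t using tm_induction with
    | htm a b => simp
    | hadd s t hs ht => simp only [map_add, LinearMap.add_apply, hs, ht]

theorem leftUnit_naturality (f : M ⟶ N) :
    tensorMap (𝟙 Znil) f ≫ (leftUnitIso N).hom = (leftUnitIso M).hom ≫ f := by
  refine tensor_hom_ext isGen_univ isGen_univ (fun n _ x _ => ?_) (fun a b => by simp)
  obtain ⟨n, rfl⟩ := zn_surj n
  simp [e_zact]

theorem rightUnit_naturality (f : M ⟶ N) :
    tensorMap f (𝟙 Znil) ≫ (rightUnitIso N).hom = (rightUnitIso M).hom ≫ f := by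
  refine tensor_hom_ext isGen_univ isGen_univ (fun x _ n _ => ?_) (fun a b => by simp)
  obtain ⟨n, rfl⟩ := zn_surj n
  simp

theorem assoc_pentagon (M N K L : SquareGroup.{u}) :
    tensorMap (assocIso M N K).hom (𝟙 L) ≫ (assocIso M (tensor N K) L).hom ≫
        tensorMap (𝟙 M) (assocIso N K L).hom =
      (assocIso (tensor M N) K L).hom ≫ (assocIso M N (tensor K L)).hom := by
  refine tensor_hom_ext (isGen_tensor (isGen_tensor isGen_univ isGen_univ) isGen_univ)
    isGen_univ ?_ (fun s d => ?_)
  · rintro _ ⟨_, ⟨x, -, y, -, rfl⟩, z, -, rfl⟩ w -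
    simp
  · induction s using tm_induction with
    | htm t c =>
      induction t using tm_induction with
      | htm a b => simp
      | hadd s t hs ht => simp only [map_add, LinearMap.add_apply, hs, ht]
    | hadd s t hs ht => simp only [map_add, LinearMap.add_apply, hs, ht]

theorem unit_triangle (M N : SquareGroup.{u}) :
    (assocIso M Znil N).hom ≫ tensorMap (𝟙 M) (leftUnitIso N).hom =
      tensorMap (rightUnitIso M).hom (𝟙 N) := by
  refine tensor_hom_ext (isGen_tensor isGen_univ isGen_Znil) isGen_univ ?_ (fun t c => ?_)
  · rintro _ ⟨x, -, _, (rfl | rfl), rfl⟩ y -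
    · simp
    · simp [tl_add, tl_neg, neg_tl]
  · induction t using tm_induction with
    | htm a b => simp
    | hadd s t hs ht => simp only [map_add, LinearMap.add_apply, hs, ht]

theorem braid_naturality (f : M ⟶ M') (g : N ⟶ N') :
    tensorMap f g ≫ (braidIso M' N').hom = (braidIso M N).hom ≫ tensorMap g f := by
  refine tensor_hom_ext isGen_univ isGen_univ (fun x _ y _ => ?_) (fun a b => by simp)
  simp [(tensorMap g f).e_P, f.ee_H, g.ee_H, ee_T]

theorem braid_hexagon (M N K : SquareGroup.{u}) :
    (assocIso M N K).hom ≫ (braidIso M (tensor N K)).hom ≫ (assocIso N K M).hom =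
      tensorMap (braidIso M N).hom (𝟙 K) ≫ (assocIso N M K).hom ≫
        tensorMap (𝟙 N) (braidIso M K).hom := by
  refine tensor_hom_ext (isGen_tensor isGen_univ isGen_univ) isGen_univ ?_ (fun t c => ?_)
  · rintro _ ⟨x, -, y, -, rfl⟩ z -
    simp only [comp_e, assocIso_hom_tl, braidIso_hom_tl, map_add, (assocIso N K M).hom.e_P,
      tensorMap_tl, id_e, add_tl, tl_add, (assocIso N M K).hom.e_P, tl_P, P_tl,
      (tensorMap (𝟙 N) (braidIso M K).hom).e_P]
    simp only [map_neg, H_tl, map_add, LinearMap.neg_apply, LinearMap.add_apply, assocIso_hom_tm,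
      tensorMap_tm, id_ee, LinearMap.id_apply, braidIso_hom_tm]
    rw [← map_neg (tensor N M).P, cr_P_left, map_zero, LinearMap.zero_apply, map_zero, map_zero,
      map_zero, add_zero, neg_add_rev, ← map_neg, ← map_neg, P_central, add_assoc]
  · induction t using tm_induction with
    | htm a b => simp
    | hadd s t hs ht => simp only [map_add, LinearMap.add_apply, hs, ht]

theorem braid_hexagon_reverse (M N K : SquareGroup.{u}) :
    (assocIso M N K).inv ≫ (braidIso (tensor M N) K).hom ≫ (assocIso K M N).inv =
      tensorMap (𝟙 M) (braidIso N K).hom ≫ (assocIso M K N).inv ≫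
        tensorMap (braidIso M K).hom (𝟙 N) := by
  let i : tensor (tensor K M) N ≅ tensor (tensor M K) N :=
    { hom := tensorMap (braidIso K M).hom (𝟙 N)
      inv := tensorMap (braidIso M K).hom (𝟙 N)
      hom_inv_id := by
        rw [tensorMap_comp, Category.comp_id, ← tensorMap_id]
        exact congrArg (fun f => tensorMap f (𝟙 N)) (braidHom_braidHom K M)
      inv_hom_id := by
        rw [tensorMap_comp, Category.comp_id, ← tensorMap_id]
        exact congrArg (fun f => tensorMap f (𝟙 N)) (braidHom_braidHom M K) }
  let j : tensor M (tensor K N) ≅ tensor M (tensor N K) :=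
    { hom := tensorMap (𝟙 M) (braidIso K N).hom
      inv := tensorMap (𝟙 M) (braidIso N K).hom
      hom_inv_id := by
        rw [tensorMap_comp, Category.comp_id, ← tensorMap_id]
        exact congrArg (fun f => tensorMap (𝟙 M) f) (braidHom_braidHom K N)
      inv_hom_id := by
        rw [tensorMap_comp, Category.comp_id, ← tensorMap_id]
        exact congrArg (fun f => tensorMap (𝟙 M) f) (braidHom_braidHom N K) }
  have h : assocIso K M N ≪≫ braidIso K (tensor M N) ≪≫ assocIso M N K =
      i ≪≫ assocIso M K N ≪≫ j := Iso.ext (braid_hexagon K M N)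
  have h2 := congrArg Iso.inv h
  simp only [Iso.trans_inv, Category.assoc] at h2
  exact h2

noncomputable instance : MonoidalCategoryStruct SquareGroup.{u} where
  tensorObj := tensor
  whiskerLeft M _ _ f := tensorMap (𝟙 M) f
  whiskerRight f N := tensorMap f (𝟙 N)
  tensorHom f g := tensorMap f g
  tensorUnit := Znil
  associator := assocIso
  leftUnitor := leftUnitIso
  rightUnitor := rightUnitIso

noncomputable instance : MonoidalCategory SquareGroup.{u} :=
  MonoidalCategory.ofTensorHom
    (id_tensorHom_id := tensorMap_id)
    (id_tensorHom := fun _ _ _ _ => rfl)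
    (tensorHom_id := fun _ _ => rfl)
    (tensorHom_comp_tensorHom := tensorMap_comp)
    (associator_naturality := assoc_naturality)
    (leftUnitor_naturality := leftUnit_naturality)
    (rightUnitor_naturality := rightUnit_naturality)
    (pentagon := assoc_pentagon)
    (triangle := unit_triangle)

noncomputable instance : SymmetricCategory SquareGroup.{u} where
  braiding := braidIso
  braiding_naturality_right M _ _ f := braid_naturality (𝟙 M) f
  braiding_naturality_left f N := braid_naturality f (𝟙 N)
  hexagon_forward := braid_hexagon
  hexagon_reverse := braid_hexagon_reverse
  symmetry := braidHom_braidHom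

end SquareGroup

namespace SquareGroup

/-! ### The product corresponding to composition of functors -/

namespace Square

/-- Generators `x ⊗ z` and `[x, y] ⊗ c` of the `e`-level of the product `□`. -/
inductive Gen (M N : SquareGroup.{u}) : Type u
  | ts (x : M.e) (z : N.e)
  | br (x y : M.e) (c : N.ee)

open FreeAddGroup Gen in
/-- Relations of the `e`-level of the product `□`. -/
inductive Rel (M N : SquareGroup.{u}) :
    FreeAddGroup (Gen M N) → FreeAddGroup (Gen M N) → Prop
  | ts_add (x : M.e) (z z' : N.e) :
      Rel M N (of (ts x (z + z'))) (of (ts x z) + of (ts x z'))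
  | br_central (x y : M.e) (c : N.ee) (w : FreeAddGroup (Gen M N)) :
      Rel M N (of (br x y c) + w) (w + of (br x y c))
  | br_add_left (x x' y : M.e) (c : N.ee) :
      Rel M N (of (br (x + x') y c)) (of (br x y c) + of (br x' y c))
  | br_add_mid (x y y' : M.e) (c : N.ee) :
      Rel M N (of (br x (y + y') c)) (of (br x y c) + of (br x y' c))
  | br_add_right (x y : M.e) (c c' : N.ee) :
      Rel M N (of (br x y (c + c'))) (of (br x y c) + of (br x y c'))
  | add_ts (x y : M.e) (z : N.e) :
      Rel M N (of (ts (x + y) z)) (of (ts x z) + of (ts y z) + of (br x y (N.H z)))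
  | br_self (x : M.e) (c : N.ee) : Rel M N (of (br x x c)) (of (ts x (N.P c)))
  | br_P (x : M.e) (a : M.ee) (c : N.ee) : Rel M N (of (br x (M.P a) c)) 0

/-- The `e`-level of the product `□`. -/
def E (M N : SquareGroup.{u}) : Type u := PresentedAdd (Rel M N)

instance (M N : SquareGroup.{u}) : AddGroup (E M N) :=
  inferInstanceAs (AddGroup (PresentedAdd (Rel M N)))

variable {M N : SquareGroup.{u}}

/-- The generator `x ⊗ z`. -/
def ts (x : M.e) (z : N.e) : E M N := PresentedAdd.mk (Rel M N) (FreeAddGroup.of (Gen.ts x z))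

/-- The generator `[x, y] ⊗ c`. -/
def br (x y : M.e) (c : N.ee) : E M N :=
  PresentedAdd.mk (Rel M N) (FreeAddGroup.of (Gen.br x y c))

theorem br_central (x y : M.e) (c : N.ee) (u : E M N) : br x y c + u = u + br x y c := by
  obtain ⟨w, rfl⟩ : ∃ w, PresentedAdd.mk (Rel M N) w = u := AddCon.mk'_surjective u
  have h := PresentedAdd.mk_eq (Rel.br_central x y c w)
  rwa [map_add, map_add] at h

theorem ts_add (x : M.e) (z z' : N.e) : (ts x (z + z') : E M N) = ts x z + ts x z' := by
  have h := PresentedAdd.mk_eq (Rel.ts_add x z z')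
  rwa [map_add] at h

theorem br_add_left (x x' y : M.e) (c : N.ee) :
    (br (x + x') y c : E M N) = br x y c + br x' y c := by
  have h := PresentedAdd.mk_eq (Rel.br_add_left x x' y c)
  rwa [map_add] at h

theorem br_add_mid (x y y' : M.e) (c : N.ee) :
    (br x (y + y') c : E M N) = br x y c + br x y' c := by
  have h := PresentedAdd.mk_eq (Rel.br_add_mid x y y' c)
  rwa [map_add] at h

theorem br_add_right (x y : M.e) (c c' : N.ee) :
    (br x y (c + c') : E M N) = br x y c + br x y c' := by
  have h := PresentedAdd.mk_eq (Rel.br_add_right x y c c')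
  rwa [map_add] at h

theorem add_ts (x y : M.e) (z : N.e) :
    (ts (x + y) z : E M N) = ts x z + ts y z + br x y (N.H z) := by
  have h := PresentedAdd.mk_eq (Rel.add_ts x y z)
  rwa [map_add, map_add] at h

theorem ts_P (x : M.e) (c : N.ee) : (ts x (N.P c) : E M N) = br x x c :=
  (PresentedAdd.mk_eq (Rel.br_self x c)).symm

theorem br_P_right (x : M.e) (a : M.ee) (c : N.ee) : (br x (M.P a) c : E M N) = 0 :=
  PresentedAdd.mk_eq (Rel.br_P x a c)

/-- Homomorphisms out of the `e`-level of the product `□`. -/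
def lift {G : Type*} [AddGroup G] (f : M.e → N.e → G) (g : M.e → M.e → N.ee → G)
    (h1 : ∀ x z z', f x (z + z') = f x z + f x z')
    (h2 : ∀ x y c u, g x y c + u = u + g x y c)
    (h3 : ∀ x x' y c, g (x + x') y c = g x y c + g x' y c)
    (h4 : ∀ x y y' c, g x (y + y') c = g x y c + g x y' c)
    (h5 : ∀ x y c c', g x y (c + c') = g x y c + g x y c')
    (h6 : ∀ x y z, f (x + y) z = f x z + f y z + g x y (N.H z))
    (h7 : ∀ x c, g x x c = f x (N.P c))
    (h8 : ∀ x a c, g x (M.P a) c = 0) : E M N →+ G :=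
  PresentedAdd.lift (fun | Gen.ts x z => f x z | Gen.br x y c => g x y c) (by
    intro v w h
    cases h with
    | ts_add x z z' => simpa using h1 x z z'
    | br_central x y c w => simpa using h2 x y c _
    | br_add_left x x' y c => simpa using h3 x x' y c
    | br_add_mid x y y' c => simpa using h4 x y y' c
    | br_add_right x y c c' => simpa using h5 x y c c'
    | add_ts x y z => simpa using h6 x y z
    | br_self x c => simpa using h7 x c
    | br_P x a c => simpa using h8 x a c)

section

variable {G : Type*} [AddGroup G] (f : M.e → N.e → G) (g : M.e → M.e → N.ee → G)
    (h1 : ∀ x z z', f x (z + z') = f x z + f x z')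
    (h2 : ∀ x y c u, g x y c + u = u + g x y c)
    (h3 : ∀ x x' y c, g (x + x') y c = g x y c + g x' y c)
    (h4 : ∀ x y y' c, g x (y + y') c = g x y c + g x y' c)
    (h5 : ∀ x y c c', g x y (c + c') = g x y c + g x y c')
    (h6 : ∀ x y z, f (x + y) z = f x z + f y z + g x y (N.H z))
    (h7 : ∀ x c, g x x c = f x (N.P c))
    (h8 : ∀ x a c, g x (M.P a) c = 0)

@[simp] theorem lift_ts (x : M.e) (z : N.e) :
    lift f g h1 h2 h3 h4 h5 h6 h7 h8 (ts x z) = f x z := FreeAddGroup.lift_apply_of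

@[simp] theorem lift_br (x y : M.e) (c : N.ee) :
    lift f g h1 h2 h3 h4 h5 h6 h7 h8 (br x y c) = g x y c := FreeAddGroup.lift_apply_of

end

theorem ts_neg (x : M.e) (z : N.e) : (ts x (-z) : E M N) = -ts x z :=
  map_neg (AddMonoidHom.mk' (fun z => (ts x z : E M N)) (ts_add x)) z

theorem ts_zero (x : M.e) : (ts x 0 : E M N) = 0 :=
  map_zero (AddMonoidHom.mk' (fun z => (ts x z : E M N)) (ts_add x))

theorem br_neg (x y : M.e) (c : N.ee) : (br x y (-c) : E M N) = -br x y c :=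
  map_neg (AddMonoidHom.mk' (fun c => (br x y c : E M N)) (br_add_right x y)) c

theorem induction {p : E M N → Prop} (hts : ∀ x z, p (ts x z)) (hbr : ∀ x y c, p (br x y c))
    (hadd : ∀ u v, p u → p v → p (u + v)) (u : E M N) : p u := by
  refine PresentedAdd.induction (p := p) ?_ ?_ ?_ hadd u
  · have h := hts 0 0
    rwa [ts_zero] at h
  · rintro (⟨x, z⟩ | ⟨x, y, c⟩)
    · exact hts x z
    · exact hbr x y c
  · rintro (⟨x, z⟩ | ⟨x, y, c⟩)
    · have h := hts x (-z)
      rwa [ts_neg] at h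
    · have h := hbr x y (-c)
      rwa [br_neg] at h

theorem br_swap (x y : M.e) (c : N.ee) : (br y x c : E M N) = br x y (N.T c) := by
  have h := ts_P (N := N) (x + y) c
  rw [add_ts, ts_P, ts_P, H_P, br_add_left, br_add_mid, br_add_mid, br_add_right] at h
  have e1 : br x x c + br y y c + (br x y c + br x y (N.T c)) =
      br x x c + br x y c + (br x y (N.T c) + br y y c) := by
    rw [← br_central y y c (br x y (N.T c)), add_assoc, ← add_assoc (br y y c), br_central y y]
    simp only [add_assoc]
  rw [e1] at h
  exact (add_right_cancel (add_left_cancel h)).symm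

theorem br_P_left (a : M.ee) (y : M.e) (c : N.ee) : (br (M.P a) y c : E M N) = 0 := by
  rw [br_swap, br_P_right]

theorem ts_comm (x x' : M.e) (z z' : N.e) :
    (ts x' z' + ts x z + br x' x (N.cr z z') : E M N) = ts x z + ts x' z' := by
  have h := ts_add (x' + x) z z'
  rw [add_ts, add_ts, add_ts, ts_add, ts_add, H_add, br_add_right, br_add_right] at h
  have h2 : ∀ p q r s b b' c : E M N, (∀ w, b + w = w + b) → (∀ w, b' + w = w + b') →
      (∀ w, c + w = w + c) →
      p + q + (r + s) + (b + b' + c) = p + r + b + (q + s + b') → q + r + c = r + q := by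
    intro p q r s b b' c hb hb' hc e
    have e1 : p + q + (r + s) + (b + b' + c) = p + (q + r + c) + s + (b + b') := by
      rw [← add_assoc (p + q + (r + s)), add_assoc _ (b + b') c, ← hc (b + b'), ← add_assoc,
        add_assoc (p + q), add_assoc r, ← hc s]
      simp only [add_assoc]
    have e2 : p + r + b + (q + s + b') = p + (r + q) + s + (b + b') := by
      rw [add_assoc (p + r), ← add_assoc b, hb (q + s), add_assoc (q + s)]
      simp only [add_assoc]
    rw [e1, e2] at e
    exact add_left_cancel (add_right_cancel (add_right_cancel e))
  exact h2 _ _ _ _ _ _ _ (br_central _ _ _) (br_central _ _ _) (br_central _ _ _) h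

theorem ts_P_cr (x y : M.e) (z : N.e) :
    (ts (M.P (M.cr x y)) z : E M N) = br y x (N.Δe z) := by
  have h := add_ts x y z
  rw [add_eq_swap x y, add_ts, add_ts, br_P_right, add_zero, ← ts_comm x y z z,
    br_swap y x (N.H z)] at h
  simp only [add_assoc, add_right_inj] at h
  rw [Δe_eq, br_add_right, sub_eq_add_neg, br_add_right, ← br_central y x (-N.H z), br_neg,
    add_assoc, ← h, neg_add_cancel_left]

/-- The relations of the `ee`-level of the product `□`. -/
def relEE (M N : SquareGroup.{u}) :
    AddSubgroup ((M.ee ⊗[ℤ] Coker N) × ((Coker M ⊗[ℤ] Coker M) ⊗[ℤ] N.ee)) :=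
  AddSubgroup.closure {w | ∃ (x y : M.e) (z : N.e),
    w = (M.cr x y ⊗ₜ N.toCoker z, 0) - (0, (M.toCoker y ⊗ₜ M.toCoker x) ⊗ₜ N.Δe z)}

/-- The `ee`-level of the product `□`. -/
def EE (M N : SquareGroup.{u}) : Type u :=
  ((M.ee ⊗[ℤ] Coker N) × ((Coker M ⊗[ℤ] Coker M) ⊗[ℤ] N.ee)) ⧸ relEE M N

noncomputable instance (M N : SquareGroup.{u}) : AddCommGroup (EE M N) :=
  inferInstanceAs (AddCommGroup
    (((M.ee ⊗[ℤ] Coker N) × ((Coker M ⊗[ℤ] Coker M) ⊗[ℤ] N.ee)) ⧸ relEE M N))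

/-- The projection onto the `ee`-level. -/
noncomputable def mkEE (M N : SquareGroup.{u}) :
    (M.ee ⊗[ℤ] Coker N) × ((Coker M ⊗[ℤ] Coker M) ⊗[ℤ] N.ee) →+ EE M N :=
  QuotientAddGroup.mk' (relEE M N)

/-- The class of `a ⊗ z`. -/
noncomputable def ta : M.ee →ₗ[ℤ] Coker N →ₗ[ℤ] EE M N :=
  mkBilin (fun a z => mkEE M N (a ⊗ₜ z, 0))
    (fun a a' z => by rw [← map_add, Prod.mk_add_mk, add_zero, TensorProduct.add_tmul])
    (fun a z z' => by rw [← map_add, Prod.mk_add_mk, add_zero, TensorProduct.tmul_add])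

/-- The class of `x ⊗ y ⊗ c`. -/
noncomputable def tb : Coker M →ₗ[ℤ] Coker M →ₗ[ℤ] N.ee →ₗ[ℤ] EE M N :=
  mkBilin (fun x y => AddMonoidHom.toIntLinearMap (AddMonoidHom.mk'
      (fun c => mkEE M N (0, (x ⊗ₜ y) ⊗ₜ c))
      (fun c c' => by rw [← map_add, Prod.mk_add_mk, add_zero, TensorProduct.tmul_add])))
    (fun x x' y => by
      ext c
      change mkEE M N _ = mkEE M N _ + mkEE M N _
      rw [← map_add, Prod.mk_add_mk, add_zero, TensorProduct.add_tmul, TensorProduct.add_tmul])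
    (fun x y y' => by
      ext c
      change mkEE M N _ = mkEE M N _ + mkEE M N _
      rw [← map_add, Prod.mk_add_mk, add_zero, TensorProduct.tmul_add, TensorProduct.add_tmul])

theorem ta_cr (x y : M.e) (z : N.e) :
    (ta (M.cr x y) (N.toCoker z) : EE M N) = tb (M.toCoker y) (M.toCoker x) (N.Δe z) := by
  rw [← sub_eq_zero]
  refine (map_sub (mkEE M N) _ _).symm.trans ?_
  exact (QuotientAddGroup.eq_zero_iff _).2 (AddSubgroup.subset_closure ⟨x, y, z, rfl⟩)

theorem EE_induction {p : EE M N → Prop} (ha : ∀ a z, p (ta a (N.toCoker z)))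
    (hb : ∀ x y c, p (tb (M.toCoker x) (M.toCoker y) c))
    (hadd : ∀ s t, p s → p t → p (s + t)) (s : EE M N) : p s := by
  obtain ⟨⟨s, t⟩, rfl⟩ : ∃ w, mkEE M N w = s := QuotientAddGroup.mk'_surjective (relEE M N) s
  have h0 : p 0 := by
    have := ha 0 0
    rwa [map_zero, LinearMap.zero_apply] at this
  have e : ((s, t) : (M.ee ⊗[ℤ] Coker N) × ((Coker M ⊗[ℤ] Coker M) ⊗[ℤ] N.ee)) =
      (s, 0) + (0, t) := by rw [Prod.mk_add_mk, add_zero, zero_add]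
  rw [e, map_add]
  clear e
  refine hadd _ _ ?_ ?_
  · induction s with
    | zero => exact (map_zero (mkEE M N)).symm ▸ h0
    | tmul a z =>
      obtain ⟨z, rfl⟩ := N.toCoker_surjective z
      exact ha a z
    | add s t hs ht =>
      have := hadd _ _ hs ht
      rwa [← map_add, Prod.mk_add_mk, add_zero] at this
  · induction t with
    | zero => exact (map_zero (mkEE M N)).symm ▸ h0
    | tmul t c =>
      induction t with
      | zero =>
        rw [TensorProduct.zero_tmul]
        exact (map_zero (mkEE M N)).symm ▸ h0
      | tmul x y =>
        obtain ⟨x, rfl⟩ := M.toCoker_surjective x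
        obtain ⟨y, rfl⟩ := M.toCoker_surjective y
        exact hb x y c
      | add s t hs ht =>
        have := hadd _ _ hs ht
        rwa [← map_add, Prod.mk_add_mk, add_zero, ← TensorProduct.add_tmul] at this
    | add s t hs ht =>
      have := hadd _ _ hs ht
      rwa [← map_add, Prod.mk_add_mk, add_zero] at this

/-- Auxiliary map for `liftEE`. -/
noncomputable def liftEE₂ {C : Type*} [AddCommGroup C]
    (g : Coker M →ₗ[ℤ] Coker M →ₗ[ℤ] N.ee →ₗ[ℤ] C) :
    Coker M ⊗[ℤ] Coker M →ₗ[ℤ] N.ee →ₗ[ℤ] C :=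
  AddMonoidHom.toIntLinearMap (TensorProduct.lift g).toAddMonoidHom

/-- Homomorphisms out of the `ee`-level of the product `□`. -/
noncomputable def liftEE {C : Type*} [AddCommGroup C] (f : M.ee →ₗ[ℤ] Coker N →ₗ[ℤ] C)
    (g : Coker M →ₗ[ℤ] Coker M →ₗ[ℤ] N.ee →ₗ[ℤ] C)
    (h : ∀ x y z, f (M.cr x y) (N.toCoker z) = g (M.toCoker y) (M.toCoker x) (N.Δe z)) :
    EE M N →ₗ[ℤ] C :=
  AddMonoidHom.toIntLinearMap (QuotientAddGroup.lift (relEE M N)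
    (AddMonoidHom.mk' (fun w => TensorProduct.lift f w.1 + TensorProduct.lift (liftEE₂ g) w.2)
      (fun v w => by rw [Prod.fst_add, Prod.snd_add, map_add, map_add]; abel))
    ((AddSubgroup.closure_le _).2 (by
      rintro _ ⟨x, y, z, rfl⟩
      rw [SetLike.mem_coe, AddMonoidHom.mem_ker, map_sub, sub_eq_zero]
      change TensorProduct.lift f _ + TensorProduct.lift (liftEE₂ g) 0 =
        TensorProduct.lift f 0 + TensorProduct.lift (liftEE₂ g) _
      rw [map_zero, map_zero, add_zero, zero_add]
      exact h x y z)))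

section

variable {C : Type*} [AddCommGroup C] (f : M.ee →ₗ[ℤ] Coker N →ₗ[ℤ] C)
    (g : Coker M →ₗ[ℤ] Coker M →ₗ[ℤ] N.ee →ₗ[ℤ] C)
    (h : ∀ x y z, f (M.cr x y) (N.toCoker z) = g (M.toCoker y) (M.toCoker x) (N.Δe z))

@[simp] theorem liftEE_ta (a : M.ee) (z : Coker N) : liftEE f g h (ta a z) = f a z :=
  (congrArg (f a z + ·) (map_zero (TensorProduct.lift (liftEE₂ g)))).trans
    (add_zero (f a z))

@[simp] theorem liftEE_tb (x y : Coker M) (c : N.ee) : liftEE f g h (tb x y c) = g x y c :=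
  (congrArg (· + g x y c) (map_zero (TensorProduct.lift f))).trans (zero_add (g x y c))

end

/-- A central element of the `e`-level. -/
def central (u : E M N) (hu : ∀ v, u + v = v + u) : AddSubgroup.center (E M N) :=
  ⟨u, AddSubgroup.mem_center_iff.2 fun v => (hu v).symm⟩

theorem ts_P_left_central (a : M.ee) (z : N.e) (u : E M N) :
    ts (M.P a) z + u = u + ts (M.P a) z := by
  induction u using induction with
  | hts x' z' =>
    have h := ts_comm (M.P a) x' z z'
    rwa [br_P_right, add_zero, eq_comm] at h
  | hbr x y c => exact (br_central _ _ _ _).symm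
  | hadd u v hu hv => rw [← add_assoc, hu, add_assoc, hv, add_assoc]

/-- The elements `P a ⊗ z` as a bilinear map. -/
def tsC : M.ee →ₗ[ℤ] Coker N →ₗ[ℤ] AddSubgroup.center (E M N) :=
  AddMonoidHom.toIntLinearMap (AddMonoidHom.mk'
    (fun a => cokerLift
      (AddMonoidHom.mk' (fun z => central (ts (M.P a) z) (ts_P_left_central a z))
        (fun z z' => Subtype.ext (ts_add _ _ _)))
      (fun c => Subtype.ext ((ts_P _ _).trans (br_P_right _ _ _))))
    (fun a a' => LinearMap.ext fun z => by
      obtain ⟨z, rfl⟩ := N.toCoker_surjective z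
      refine Subtype.ext ?_
      change ts (M.P (a + a')) z = ts (M.P a) z + ts (M.P a') z
      rw [map_add, add_ts, br_P_right, add_zero]))

/-- The elements `[x, y] ⊗ c` as a trilinear map. -/
def brC : Coker M →ₗ[ℤ] Coker M →ₗ[ℤ] N.ee →ₗ[ℤ] AddSubgroup.center (E M N) :=
  cokerLift
    (AddMonoidHom.mk' (fun x => cokerLift
        (AddMonoidHom.mk' (fun y => AddMonoidHom.toIntLinearMap (AddMonoidHom.mk'
            (fun c => central (br x y c) (br_central x y c))
            (fun c c' => Subtype.ext (br_add_right x y c c'))))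
          (fun y y' => LinearMap.ext fun c => Subtype.ext (br_add_mid x y y' c)))
        (fun a => LinearMap.ext fun c => Subtype.ext (br_P_right x a c)))
      (fun x x' => LinearMap.ext fun y => LinearMap.ext fun c => by
        obtain ⟨y, rfl⟩ := M.toCoker_surjective y
        exact Subtype.ext (br_add_left x x' y c)))
    (fun a => LinearMap.ext fun y => LinearMap.ext fun c => by
      obtain ⟨y, rfl⟩ := M.toCoker_surjective y
      exact Subtype.ext (br_P_left a y c))

theorem tsC_cr (x y : M.e) (z : N.e) : (tsC (M.cr x y) (N.toCoker z) :
    AddSubgroup.center (E M N)) = brC (M.toCoker y) (M.toCoker x) (N.Δe z) :=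
  Subtype.ext (ts_P_cr x y z)

/-- The homomorphism `P` with values in the centre. -/
noncomputable def PC (M N : SquareGroup.{u}) : EE M N →ₗ[ℤ] AddSubgroup.center (E M N) :=
  liftEE tsC brC tsC_cr

/-- The homomorphism `P`. -/
noncomputable def P (M N : SquareGroup.{u}) : EE M N →+ E M N :=
  (AddSubgroup.center (E M N)).subtype.comp (PC M N).toAddMonoidHom

@[simp] theorem P_ta (a : M.ee) (z : N.e) : P M N (ta a (N.toCoker z)) = ts (M.P a) z :=
  congrArg Subtype.val (liftEE_ta tsC brC tsC_cr a (N.toCoker z))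

@[simp] theorem P_tb (x y : M.e) (c : N.ee) :
    P M N (tb (M.toCoker x) (M.toCoker y) c) = br x y c :=
  congrArg Subtype.val (liftEE_tb tsC brC tsC_cr (M.toCoker x) (M.toCoker y) c)

theorem P_central (t : EE M N) (u : E M N) : P M N t + u = u + P M N t :=
  (AddSubgroup.mem_center_iff.1 (PC M N t).2 u).symm

/-- The bilinear map `(x ⊗ z, x' ⊗ z') ↦ x' ⊗ x ⊗ (z | z')_H`. -/
noncomputable def rho (M N : SquareGroup.{u}) :
    Coker M ⊗[ℤ] Coker N →ₗ[ℤ] Coker M ⊗[ℤ] Coker N →ₗ[ℤ] EE M N :=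
  TensorProduct.lift (mkBilin (fun x z => TensorProduct.lift
    (mkBilin (fun x' z' => tb x' x (N.crC z z')) (by simp) (by simp)))
    (fun x x' z => TensorProduct.ext' fun y w => by
      change tb y (x + x') (N.crC z w) = tb y x (N.crC z w) + tb y x' (N.crC z w)
      rw [map_add, LinearMap.add_apply])
    (fun x z z' => TensorProduct.ext' fun y w => by
      change tb y x (N.crC (z + z') w) = tb y x (N.crC z w) + tb y x (N.crC z' w)
      rw [map_add, LinearMap.add_apply, map_add]))

@[simp] theorem rho_tmul (x x' : M.e) (z z' : N.e) :
    rho M N (M.toCoker x ⊗ₜ N.toCoker z) (M.toCoker x' ⊗ₜ N.toCoker z') =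
      tb (M.toCoker x') (M.toCoker x) (N.cr z z') := rfl

open TensorProduct in
/-- The homomorphism to the extension of `Coker P ⊗ Coker P` by the `ee`-level with cocycle `rho`
whose second component is `H`. -/
noncomputable def HExt (M N : SquareGroup.{u}) :
    E M N →+ (CentralPairing.ofBilin (rho M N)).Ext :=
  lift (fun x z => ⟨M.toCoker x ⊗ₜ N.toCoker z,
      ta (M.H x) (N.toCoker z) + tb (M.toCoker x) (M.toCoker x) (N.H z)⟩)
    (fun x y c => ⟨0, tb (M.toCoker x) (M.toCoker y) c + tb (M.toCoker y) (M.toCoker x) (N.T c)⟩)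
    (by
      intro x z z'
      ext
      · simp [tmul_add]
      · simp only [CentralPairing.add_snd, CentralPairing.ofBilin_apply, rho_tmul, H_add, map_add]
        abel)
    (by
      intro x y c u
      ext
      · simp
      · simp [add_comm])
    (by
      intro x x' y c
      ext
      · simp
      · simp only [CentralPairing.add_snd, CentralPairing.ofBilin_apply, map_zero, map_add,
          LinearMap.add_apply]
        abel)
    (by
      intro x y y' c
      ext
      · simp
      · simp only [CentralPairing.add_snd, CentralPairing.ofBilin_apply, map_zero, map_add,
          LinearMap.add_apply]
        abel)
    (by
      intro x y c c'
      ext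
      · simp
      · simp only [CentralPairing.add_snd, CentralPairing.ofBilin_apply, map_zero, map_add]
        abel)
    (by
      intro x y z
      ext
      · simp [add_tmul]
      · simp only [CentralPairing.add_snd, CentralPairing.add_fst, CentralPairing.ofBilin_apply,
          rho_tmul, H_add, map_add, map_zero, LinearMap.add_apply, ta_cr, Δe_eq, map_sub]
        abel)
    (by
      intro x c
      ext
      · simp
      · simp only [toCoker_P, map_zero, zero_add, H_P, map_add])
    (by
      intro x a c
      ext
      · simp
      · simp)

@[simp] theorem HExt_ts (x : M.e) (z : N.e) : HExt M N (ts x z) =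
    ⟨M.toCoker x ⊗ₜ N.toCoker z,
      ta (M.H x) (N.toCoker z) + tb (M.toCoker x) (M.toCoker x) (N.H z)⟩ :=
  lift_ts _ _ _ _ _ _ _ _ _ _ x z

@[simp] theorem HExt_br (x y : M.e) (c : N.ee) : HExt M N (br x y c) =
    ⟨0, tb (M.toCoker x) (M.toCoker y) c + tb (M.toCoker y) (M.toCoker x) (N.T c)⟩ :=
  lift_br _ _ _ _ _ _ _ _ _ _ x y c

@[simp] theorem HExt_P_fst (t : EE M N) : (HExt M N (P M N t)).fst = 0 := by
  induction t using EE_induction with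
  | ha a z => simp
  | hb x y c => simp
  | hadd s t hs ht => simp [hs, ht]

theorem P_HExt_P_snd (t : EE M N) :
    P M N (HExt M N (P M N t)).snd = P M N t + P M N t := by
  induction t using EE_induction with
  | ha a z =>
    rw [P_ta, HExt_ts]
    simp only [toCoker_P, map_zero, LinearMap.zero_apply, add_zero, P_ta]
    rw [M.P_H_P, add_ts, br_P_right, add_zero]
  | hb x y c =>
    rw [P_tb, HExt_br, map_add, P_tb, P_tb, br_swap x y, T_T]
  | hadd s t hs ht =>
    rw [map_add, map_add, CentralPairing.add_snd, HExt_P_fst, HExt_P_fst,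
      CentralPairing.zero_left, add_zero, map_add, hs, ht, add_assoc,
      add_assoc, P_central s (P M N t + P M N t), P_central s (P M N t), add_assoc]

theorem P_rho (u v : E M N) :
    v + u + P M N (rho M N (HExt M N u).fst (HExt M N v).fst) = u + v := by
  induction u using induction with
  | hts x y =>
    induction v using induction with
    | hts x' y' => simpa using ts_comm x x' y y'
    | hbr x y c => simp [br_central]
    | hadd v₁ v₂ h₁ h₂ =>
      rw [map_add, CentralPairing.add_fst, map_add, map_add, ← add_assoc (ts x y), ← h₁,
        add_assoc (v₁ + ts x y), P_central _ v₂, ← add_assoc (v₁ + ts x y) v₂,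
        add_assoc v₁ (ts x y) v₂, ← h₂]
      simp only [add_assoc]
      rw [P_central _ (P M N _)]
  | hbr x y c => simp [br_central]
  | hadd u₁ u₂ h₁ h₂ =>
    rw [map_add, CentralPairing.add_fst, map_add, LinearMap.add_apply, map_add, add_assoc u₁, ← h₂,
      ← add_assoc u₁, ← add_assoc u₁, ← h₁, add_assoc (v + u₁), P_central _ u₂]
    simp only [add_assoc]

end Square

/-- The product `M □ N`. -/
noncomputable def square (M N : SquareGroup.{u}) : SquareGroup.{u} where
  e := Square.E M N
  ee := Square.EE M N
  H u := (Square.HExt M N u).snd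
  P := Square.P M N
  cross_add_left u v w := by simp [crossEffect]; abel
  cross_add_right u v w := by simp [crossEffect]; abel
  cross_P_left t w := by simp [crossEffect]
  cross_P_right t w := by simp [crossEffect]
  P_cross u v := by
    have h : crossEffect (fun u => (Square.HExt M N u).snd) u v =
      Square.rho M N (Square.HExt M N u).fst (Square.HExt M N v).fst := by
      simp [crossEffect]; abel
    rw [h]
    have h2 := Square.P_rho u v
    rw [add_assoc (-u - v), ← h2]
    add_group
  P_H_P t := Square.P_HExt_P_snd t

end SquareGroup

namespace SquareGroup

namespace Square

variable {M N : SquareGroup.{u}}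

/-- The comparison homomorphism on the `e`-level: `x ⊗ z ↦ x ⊚ z` and
`[x, y] ⊗ c ↦ (y | x)_H ⊗̄ c`. -/
noncomputable def sigmaE (M N : SquareGroup.{u}) : E M N →+ (tensor M N).e :=
  lift (fun x z => tl x z) (fun x y c => (tensor M N).P (tm (M.cr y x) c))
    (fun x z z' => tl_add x z z')
    (fun x y c u => SquareGroup.P_central _ u)
    (fun x x' y c => by rw [cr_add_right, map_add, LinearMap.add_apply, map_add])
    (fun x y y' c => by rw [cr_add_left, map_add, LinearMap.add_apply, map_add])
    (fun x y c c' => by rw [map_add, map_add])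
    (fun x y z => add_tl x y z)
    (fun x c => (tl_P x c).symm)
    (fun x a c => by rw [cr_P_left, map_zero, LinearMap.zero_apply, map_zero])

@[simp] theorem sigmaE_ts (x : M.e) (z : N.e) : sigmaE M N (ts x z) = tl x z :=
  lift_ts _ _ _ _ _ _ _ _ _ _ x z

@[simp] theorem sigmaE_br (x y : M.e) (c : N.ee) :
    sigmaE M N (br x y c) = (tensor M N).P (tm (M.cr y x) c) := lift_br _ _ _ _ _ _ _ _ _ _ x y c

/-- The comparison homomorphism on the `ee`-level: `a ⊗ z ↦ a ⊗ Δ z` and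
`x ⊗ y ⊗ c ↦ (y | x)_H ⊗ c`. -/
noncomputable def sigmaEE (M N : SquareGroup.{u}) : EE M N →ₗ[ℤ] (tensor M N).ee :=
  liftEE (tm.compl₂ N.Δ)
    (mkBilin (fun x y => tm (M.crC y x)) (fun x x' y => by rw [map_add, map_add])
      (fun x y y' => by rw [map_add, LinearMap.add_apply, map_add]))
    (fun _ _ _ => rfl)

@[simp] theorem sigmaEE_ta (a : M.ee) (z : N.e) :
    sigmaEE M N (ta a (N.toCoker z)) = tm a (N.Δe z) := liftEE_ta _ _ _ a (N.toCoker z)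

@[simp] theorem sigmaEE_tb (x y : M.e) (c : N.ee) :
    sigmaEE M N (tb (M.toCoker x) (M.toCoker y) c) = tm (M.cr y x) c :=
  liftEE_tb _ _ _ (M.toCoker x) (M.toCoker y) c

theorem sigma_P (t : EE M N) : sigmaE M N (P M N t) = (tensor M N).P (sigmaEE M N t) := by
  induction t using EE_induction with
  | ha a z => simp
  | hb x y c => simp
  | hadd s t hs ht => simp only [map_add, hs, ht]

theorem sigma_rho (u v : E M N) : (tensor M N).cr (sigmaE M N u) (sigmaE M N v) =
    sigmaEE M N (rho M N (HExt M N u).fst (HExt M N v).fst) := by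
  induction u using induction with
  | hts x z =>
    induction v using induction with
    | hts x' z' => simp
    | hbr x y c => simp
    | hadd v w hv hw =>
      simp only [map_add, CentralPairing.add_fst, cr_add_right, hv, hw]
  | hbr x y c => simp
  | hadd v w hv hw =>
    simp only [map_add, CentralPairing.add_fst, cr_add_left, LinearMap.add_apply, hv, hw]

theorem sigma_H (u : E M N) :
    sigmaEE M N (HExt M N u).snd = (tensor M N).H (sigmaE M N u) := by
  induction u using induction with
  | hts x z => simp [add_comm]
  | hbr x y c => simp [SquareGroup.H_P, T_cr]
  | hadd v w hv hw =>
    rw [map_add, CentralPairing.add_snd, map_add, map_add (sigmaEE M N), map_add (sigmaE M N),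
      H_add, hv, hw, sigma_rho, CentralPairing.ofBilin_apply]

end Square

/-- The comparison morphism `σ : M □ N ⟶ M ⊚ N`. -/
noncomputable def sigma (M N : SquareGroup.{u}) : square M N ⟶ tensor M N :=
  Hom.mk (M := square M N) (Square.sigmaE M N) (Square.sigmaEE M N) Square.sigma_P Square.sigma_H

/-- The full subcategory of square groups whose cross-effect homomorphism
`Coker P ⊗ Coker P ⟶ M_ee` is an isomorphism. -/
def isSigma : ObjectProperty SquareGroup.{u} :=
  fun M => Function.Bijective (TensorProduct.lift M.crC)

end SquareGroup

/-! ### Tensor products and symmetric squares of abelian groups -/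

section AbelianGroups

variable {A B C D A' B' : Type u} [AddCommGroup A] [AddCommGroup B] [AddCommGroup C]
  [AddCommGroup D] [AddCommGroup A'] [AddCommGroup B']

/-- The tensor product of abelian groups. -/
def TP (A B : Type u) [AddCommGroup A] [AddCommGroup B] : Type u := A ⊗[ℤ] B

noncomputable instance : AddCommGroup (TP A B) := inferInstanceAs (AddCommGroup (A ⊗[ℤ] B))

/-- The element `a ⊗ b`. -/
noncomputable def tp : A →ₗ[ℤ] B →ₗ[ℤ] TP A B :=
  mkBilin (C := TP A B) (fun a b => (a ⊗ₜ[ℤ] b : A ⊗[ℤ] B))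
    (fun a a' b => TensorProduct.add_tmul a a' b) (fun a b b' => TensorProduct.tmul_add a b b')

theorem tp_induction {p : TP A B → Prop} (htp : ∀ a b, p (tp a b))
    (hadd : ∀ s t, p s → p t → p (s + t)) (t : TP A B) : p t := by
  refine TensorProduct.induction_on (motive := p) t ?_ htp hadd
  have h := htp 0 0
  rwa [map_zero] at h

/-- Homomorphisms out of a tensor product. -/
noncomputable def tpLift (f : A →ₗ[ℤ] B →ₗ[ℤ] C) : TP A B →ₗ[ℤ] C :=
  AddMonoidHom.toIntLinearMap (TensorProduct.lift f).toAddMonoidHom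

@[simp] theorem tpLift_tp (f : A →ₗ[ℤ] B →ₗ[ℤ] C) (a : A) (b : B) :
    tpLift f (tp a b) = f a b := rfl

theorem tp_ext {f g : TP A B →ₗ[ℤ] C} (h : ∀ a b, f (tp a b) = g (tp a b)) : f = g := by
  ext t
  induction t using tp_induction with
  | htp a b => exact h a b
  | hadd s t hs ht => rw [map_add, map_add, hs, ht]

/-- The tensor product of homomorphisms. -/
noncomputable def tpMap (f : A →ₗ[ℤ] A') (g : B →ₗ[ℤ] B') : TP A B →ₗ[ℤ] TP A' B' :=
  tpLift ((tp.compl₂ g).comp f)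

@[simp] theorem tpMap_tp (f : A →ₗ[ℤ] A') (g : B →ₗ[ℤ] B') (a : A) (b : B) :
    tpMap f g (tp a b) = tp (f a) (g b) := rfl

/-- The symmetry `a ⊗ b ↦ b ⊗ a`. -/
noncomputable def tpComm (A B : Type u) [AddCommGroup A] [AddCommGroup B] :
    TP A B →ₗ[ℤ] TP B A := tpLift tp.flip

@[simp] theorem tpComm_tp (a : A) (b : B) : tpComm A B (tp a b) = tp b a := rfl

@[simp] theorem tpComm_tpComm (t : TP A B) : tpComm B A (tpComm A B t) = t := by
  induction t using tp_induction with
  | htp a b => simp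
  | hadd s t hs ht => rw [map_add, map_add, hs, ht]

/-- The associativity isomorphism `(a ⊗ b) ⊗ c ↦ a ⊗ (b ⊗ c)`. -/
noncomputable def tpAssoc (A B C : Type u) [AddCommGroup A] [AddCommGroup B] [AddCommGroup C] :
    TP (TP A B) C →ₗ[ℤ] TP A (TP B C) :=
  tpLift (tpLift (mkBilin (fun a b => (tp a).comp (tp b))
    (fun a a' b => by ext c; simp) (fun a b b' => by ext c; simp)))

@[simp] theorem tpAssoc_tp (a : A) (b : B) (c : C) :
    tpAssoc A B C (tp (tp a b) c) = tp a (tp b c) := rfl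

/-- The inverse of the associativity isomorphism. -/
noncomputable def tpAssocInv (A B C : Type u) [AddCommGroup A] [AddCommGroup B] [AddCommGroup C] :
    TP A (TP B C) →ₗ[ℤ] TP (TP A B) C :=
  tpLift (mkBilin (fun a t => tpLift (tp.comp (tp a)) t)
    (fun a a' t => by
      induction t using tp_induction with
      | htp b c => simp
      | hadd s t hs ht => rw [map_add, hs, ht, map_add, map_add]; abel)
    (fun a t t' => map_add _ _ _))

@[simp] theorem tpAssocInv_tp (a : A) (b : B) (c : C) :
    tpAssocInv A B C (tp a (tp b c)) = tp (tp a b) c := rfl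

theorem tpAssocInv_comp (A B C : Type u) [AddCommGroup A] [AddCommGroup B] [AddCommGroup C] :
    (tpAssocInv A B C).comp (tpAssoc A B C) = LinearMap.id := by
  refine tp_ext fun t c => ?_
  induction t using tp_induction with
  | htp a b => rfl
  | hadd s t hs ht => simp only [map_add, LinearMap.add_apply, hs, ht]

theorem tpAssoc_comp (A B C : Type u) [AddCommGroup A] [AddCommGroup B] [AddCommGroup C] :
    (tpAssoc A B C).comp (tpAssocInv A B C) = LinearMap.id := by
  refine tp_ext fun a t => ?_
  induction t using tp_induction with
  | htp b c => rfl
  | hadd s t hs ht => simp only [map_add, hs, ht]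

/-- The symmetric square of an abelian group. -/
def SymSq (A : Type u) [AddCommGroup A] : Type u := Sym[ℤ]^2 A

noncomputable instance : AddCommGroup (SymSq A) := inferInstanceAs (AddCommGroup (Sym[ℤ]^2 A))

theorem update_zero (a b c : A) : Function.update ![a, b] 0 c = ![c, b] := by
  ext i
  fin_cases i <;> simp

theorem update_one (a b c : A) : Function.update ![a, b] 1 c = ![a, c] := by
  ext i
  fin_cases i <;> simp

/-- The product `a b` in the symmetric square. -/
noncomputable def sm : A →ₗ[ℤ] A →ₗ[ℤ] SymSq A :=
  mkBilin (C := SymSq A) (fun a b => (SymmetricPower.tprod ℤ ![a, b] : Sym[ℤ]^2 A))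
    (fun a a' b => by
      have h := (SymmetricPower.tprod ℤ (ι := Fin 2) (M := A)).map_update_add ![a, b] 0 a a'
      rwa [update_zero, update_zero, update_zero] at h)
    (fun a b b' => by
      have h := (SymmetricPower.tprod ℤ (ι := Fin 2) (M := A)).map_update_add ![a, b] 1 b b'
      rwa [update_one, update_one, update_one] at h)

theorem sm_comm (a b : A) : sm a b = sm b a := by
  have h := SymmetricPower.tprod_equiv (R := ℤ) (Equiv.swap (0 : Fin 2) 1) ![b, a]
  refine Eq.trans ?_ h
  refine congrArg (SymmetricPower.tprod ℤ (ι := Fin 2) (M := A)) ?_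
  ext i
  fin_cases i <;> simp

/-- A bilinear map as a multilinear map. -/
def bilinToMulti (f : A →ₗ[ℤ] A →ₗ[ℤ] C) : MultilinearMap ℤ (fun _ : Fin 2 => A) C where
  toFun v := f (v 0) (v 1)
  map_update_add' v i x y := by
    fin_cases i <;> simp [Function.update]
  map_update_smul' v i r x := by
    fin_cases i <;> simp [Function.update]

/-- Homomorphisms out of the symmetric square. -/
noncomputable def symLift (f : A →ₗ[ℤ] A →ₗ[ℤ] C) (hf : ∀ a b, f a b = f b a) :
    SymSq A →ₗ[ℤ] C :=
  AddMonoidHom.toIntLinearMap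
    (AddCon.lift (addConGen (SymmetricPower.Rel ℤ (Fin 2) A))
      (PiTensorProduct.lift (bilinToMulti f)).toAddMonoidHom
      (AddCon.addConGen_le.2 (by
        rintro _ _ ⟨e, v⟩
        rw [AddCon.ker_rel]
        refine (PiTensorProduct.lift.tprod (φ := bilinToMulti f) v).trans
          (Eq.trans ?_ (PiTensorProduct.lift.tprod (φ := bilinToMulti f) fun i => v (e i)).symm)
        have key : ∀ i j : Fin 2, i ≠ j → f (v 0) (v 1) = f (v i) (v j) := by
          intro i j hij
          fin_cases i <;> fin_cases j <;> first | exact absurd rfl hij | rfl | exact hf _ _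
        exact key (e 0) (e 1) (by simp))))

@[simp] theorem symLift_sm (f : A →ₗ[ℤ] A →ₗ[ℤ] C) (hf : ∀ a b, f a b = f b a) (a b : A) :
    symLift f hf (sm a b) = f a b :=
  PiTensorProduct.lift.tprod (φ := bilinToMulti f) ![a, b]

theorem sym_induction {p : SymSq A → Prop} (hsm : ∀ a b, p (sm a b))
    (hadd : ∀ s t, p s → p t → p (s + t)) (s : SymSq A) : p s := by
  obtain ⟨t, rfl⟩ : ∃ t, SymmetricPower.mk ℤ (Fin 2) A t = s := AddCon.mk'_surjective s
  induction t using PiTensorProduct.induction_on with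
  | smul_tprod r v =>
    have h := hsm (r • v 0) (v 1)
    have e : sm (r • v 0) (v 1) = SymmetricPower.mk ℤ (Fin 2) A (r • PiTensorProduct.tprod ℤ v) := by
      rw [map_smul, LinearMap.smul_apply]
      refine congrArg (fun w => r • SymmetricPower.tprod ℤ (ι := Fin 2) (M := A) w) ?_
      ext i
      fin_cases i <;> rfl
    exact e ▸ h
  | add s t hs ht => exact hadd _ _ hs ht

theorem sym_ext {f g : SymSq A →ₗ[ℤ] C} (h : ∀ a b, f (sm a b) = g (sm a b)) : f = g := by
  ext s
  induction s using sym_induction with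
  | hsm a b => exact h a b
  | hadd s t hs ht => rw [map_add, map_add, hs, ht]

/-- The functoriality of the symmetric square. -/
noncomputable def symMap (f : A →ₗ[ℤ] B) : SymSq A →ₗ[ℤ] SymSq B :=
  symLift ((sm.compl₂ f).comp f) (fun _ _ => sm_comm _ _)

@[simp] theorem symMap_sm (f : A →ₗ[ℤ] B) (a b : A) : symMap f (sm a b) = sm (f a) (f b) :=
  symLift_sm _ _ a b

@[simp] theorem symMap_id (s : SymSq A) : symMap LinearMap.id s = s :=
  LinearMap.congr_fun (sym_ext (g := LinearMap.id) (by simp)) s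

theorem symMap_comp (f : A →ₗ[ℤ] B) (g : B →ₗ[ℤ] C) (s : SymSq A) :
    symMap (g.comp f) s = symMap g (symMap f s) :=
  LinearMap.congr_fun (sym_ext (g := (symMap g).comp (symMap f)) (by simp)) s

/-- The projection `a ⊗ b ↦ a b`. -/
noncomputable def tpToSym (A : Type u) [AddCommGroup A] : TP A A →ₗ[ℤ] SymSq A := tpLift sm

@[simp] theorem tpToSym_tp (a b : A) : tpToSym A (tp a b) = sm a b := rfl

/-- The map `a * (b b') = (a ⊗ b) (a ⊗ b')`. -/
noncomputable def mulL (a : A) : SymSq B →ₗ[ℤ] SymSq (TP A B) := symMap (tp a)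

/-- The map `(a a') * b = (a ⊗ b) (a' ⊗ b)`. -/
noncomputable def mulR (b : B) : SymSq A →ₗ[ℤ] SymSq (TP A B) := symMap (tp.flip b)

/-- The map `(a a') * (b b') = (a ⊗ b) (a' ⊗ b') + (a' ⊗ b) (a ⊗ b')`. -/
noncomputable def mulS : SymSq A →ₗ[ℤ] SymSq B →ₗ[ℤ] SymSq (TP A B) :=
  symLift
    (mkBilin (fun a a' => symLift
        (mkBilin (fun b b' => sm (tp a b) (tp a' b') + sm (tp a' b) (tp a b'))
          (fun b₁ b₂ b' => by simp only [map_add, LinearMap.add_apply]; abel)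
          (fun b b₁ b₂ => by simp only [map_add]; abel))
        (fun b b' => by
          simp only [mkBilin_apply]
          rw [sm_comm (tp a b), sm_comm (tp a' b), add_comm]))
      (fun a₁ a₂ a' => sym_ext fun b b' => by simp; abel)
      (fun a a₁ a₂ => sym_ext fun b b' => by simp; abel))
    (fun a a' => sym_ext fun b b' => by simp [add_comm])

@[simp] theorem mulL_sm (a : A) (b b' : B) : mulL a (sm b b') = sm (tp a b) (tp a b') :=
  symMap_sm _ _ _

@[simp] theorem mulR_sm (a a' : A) (b : B) : mulR b (sm a a') = sm (tp a b) (tp a' b) :=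
  symMap_sm _ _ _

@[simp] theorem mulS_sm (a a' : A) (b b' : B) : mulS (sm a a') (sm b b') =
    sm (tp a b) (tp a' b') + sm (tp a' b) (tp a b') := by
  simp [mulS]

end AbelianGroups

/-! ### Abelian groups with cosymmetry -/

/-- Abelian groups with cosymmetry. -/
structure Cos : Type (u + 1) where
  carrier : Type u
  [inst : AddCommGroup carrier]
  δ : carrier → SymSq carrier
  δ_add : ∀ a b : carrier, δ (a + b) = δ a + δ b + sm a b

attribute [instance] Cos.inst

namespace Cos

variable {A B C D A' B' C' : Cos.{u}}

/-- Morphisms of abelian groups with cosymmetry. -/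
@[ext] structure Hom (A B : Cos.{u}) : Type u where
  f : A.carrier →ₗ[ℤ] B.carrier
  map_δ : ∀ a, symMap f (A.δ a) = B.δ (f a)

instance : Category Cos.{u} where
  Hom := Hom
  id A := ⟨LinearMap.id, fun a => symMap_id (A.δ a)⟩
  comp g h := ⟨h.f.comp g.f, fun a => by
    rw [symMap_comp, g.map_δ, h.map_δ, LinearMap.comp_apply]⟩

@[ext] theorem hom_ext {g h : A ⟶ B} (e : g.f = h.f) : g = h := Hom.ext e

@[simp] theorem id_f : Hom.f (𝟙 A) = LinearMap.id := rfl
@[simp] theorem comp_f (g : A ⟶ B) (h : B ⟶ C) : (g ≫ h).f = h.f.comp g.f := rfl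

@[simp] theorem δ_zero (A : Cos.{u}) : A.δ 0 = 0 := by
  have h := A.δ_add 0 0
  rw [add_zero, map_zero, add_zero] at h
  exact left_eq_add.mp h

theorem δ_neg (a : A.carrier) : A.δ (-a) = sm a a - A.δ a := by
  have h := A.δ_add a (-a)
  rw [add_neg_cancel, δ_zero, map_neg] at h
  rw [eq_sub_iff_add_eq, ← sub_eq_zero, h]
  abel

/-- Isomorphisms from mutually inverse homomorphisms, the first of which is a morphism. -/
def isoMk (g : A ⟶ B) (h : B.carrier →ₗ[ℤ] A.carrier) (h1 : h.comp g.f = LinearMap.id)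
    (h2 : g.f.comp h = LinearMap.id) : A ≅ B where
  hom := g
  inv := ⟨h, fun b => by
    have e : b = g.f (h b) := (LinearMap.congr_fun h2 b).symm
    rw [e, ← g.map_δ, ← symMap_comp, h1, symMap_id, ← e]⟩
  hom_inv_id := hom_ext h1
  inv_hom_id := hom_ext h2

/-! ### The tensor product -/

/-- The value `a * δ b + δ a * b - δ a * δ b` of the cosymmetry of the tensor product. -/
noncomputable def tensorVal (A B : Cos.{u}) (a : A.carrier) (b : B.carrier) :
    SymSq (TP A.carrier B.carrier) :=
  mulL a (B.δ b) + mulR b (A.δ a) - mulS (A.δ a) (B.δ b)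

theorem mulL_add_left (a a' : A.carrier) (s : SymSq B.carrier) :
    mulL (a + a') s = mulL a s + mulL a' s + mulS (sm a a') s := by
  induction s using sym_induction with
  | hsm b b' =>
    simp only [mulL_sm, mulS_sm, map_add, LinearMap.add_apply]
    rw [sm_comm (tp a' b) (tp a b')]
    abel
  | hadd s t hs ht => simp only [map_add, hs, ht]; abel

theorem mulR_add_left (b b' : B.carrier) (s : SymSq A.carrier) :
    mulR (b + b') s = mulR b s + mulR b' s + mulS s (sm b b') := by
  induction s using sym_induction with
  | hsm a a' =>
    simp only [mulR_sm, mulS_sm, map_add, LinearMap.add_apply]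
    rw [sm_comm (tp a' b) (tp a b')]
    abel
  | hadd s t hs ht => simp only [map_add, hs, ht, LinearMap.add_apply]; abel

/-- The homomorphism from `A ⊗ B` to the extension of `A ⊗ B` by its symmetric square whose
second component is the cosymmetry. -/
noncomputable def tensorExt (A B : Cos.{u}) : TP A.carrier B.carrier →+
    (CentralPairing.ofBilin (sm (A := TP A.carrier B.carrier))).Ext :=
  liftCentral (fun a b => ⟨tp a b, tensorVal A B a b⟩)
    (fun a b g => by
      ext
      · simp [add_comm]
      · simp [sm_comm, add_comm])
    (fun a a' b => by
      ext
      · simp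
      · simp only [tensorVal, A.δ_add, mulL_add_left, map_add, LinearMap.add_apply,
          CentralPairing.add_snd, CentralPairing.ofBilin_apply, mulR_sm]
        abel)
    (fun a b b' => by
      ext
      · simp
      · simp only [tensorVal, B.δ_add, mulR_add_left, map_add, LinearMap.add_apply,
          CentralPairing.add_snd, CentralPairing.ofBilin_apply, mulL_sm]
        abel)

@[simp] theorem tensorExt_tp (a : A.carrier) (b : B.carrier) :
    tensorExt A B (tp a b) = ⟨tp a b, tensorVal A B a b⟩ := rfl

@[simp] theorem tensorExt_fst (t : TP A.carrier B.carrier) : (tensorExt A B t).fst = t := by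
  induction t using tp_induction with
  | htp a b => rfl
  | hadd s t hs ht => rw [map_add, CentralPairing.add_fst, hs, ht]

/-- The cosymmetry of the tensor product. -/
noncomputable def tensorδ (A B : Cos.{u}) (t : TP A.carrier B.carrier) :
    SymSq (TP A.carrier B.carrier) := (tensorExt A B t).snd

theorem tensorδ_tp (a : A.carrier) (b : B.carrier) : tensorδ A B (tp a b) =
    mulL a (B.δ b) + mulR b (A.δ a) - mulS (A.δ a) (B.δ b) := rfl

theorem tensorδ_add (s t : TP A.carrier B.carrier) :
    tensorδ A B (s + t) = tensorδ A B s + tensorδ A B t + sm s t := by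
  rw [tensorδ, map_add, CentralPairing.add_snd, tensorExt_fst, tensorExt_fst,
    CentralPairing.ofBilin_apply]
  rfl

/-- The tensor product of abelian groups with cosymmetry. -/
noncomputable def tensor (A B : Cos.{u}) : Cos.{u} where
  carrier := TP A.carrier B.carrier
  δ := tensorδ A B
  δ_add := tensorδ_add

/-- Compatibility of a homomorphism with cosymmetries at an element. -/
def PresAt (A B : Cos.{u}) (f : A.carrier →ₗ[ℤ] B.carrier) (a : A.carrier) : Prop :=
  symMap f (A.δ a) = B.δ (f a)

theorem PresAt.add {f : A.carrier →ₗ[ℤ] B.carrier} {a a' : A.carrier} (h : PresAt A B f a)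
    (h' : PresAt A B f a') : PresAt A B f (a + a') := by
  rw [PresAt] at *
  rw [A.δ_add, map_add, map_add, map_add, B.δ_add, h, h', symMap_sm]

/-- Morphisms out of a tensor product. -/
noncomputable def tensorHom (C : Cos.{u}) (f : TP A.carrier B.carrier →ₗ[ℤ] C.carrier)
    (h : ∀ a b, symMap f (tensorδ A B (tp a b)) = C.δ (f (tp a b))) : tensor A B ⟶ C :=
  Hom.mk (A := tensor A B) f (fun t => by
    change PresAt (tensor A B) C f t
    induction t using tp_induction with
    | htp a b => exact h a b
    | hadd s t hs ht => exact hs.add ht)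

theorem tensor_hom_ext {g h : tensor A B ⟶ C}
    (e : ∀ a b, g.f (tp (A := A.carrier) (B := B.carrier) a b) = h.f (tp a b)) : g = h :=
  hom_ext (tp_ext e)

theorem map_mulL (f : A.carrier →ₗ[ℤ] A'.carrier) (g : B.carrier →ₗ[ℤ] B'.carrier) (a : A.carrier)
    (s : SymSq B.carrier) : symMap (tpMap f g) (mulL a s) = mulL (f a) (symMap g s) := by
  induction s using sym_induction with
  | hsm b b' => simp
  | hadd s t hs ht => simp only [map_add, hs, ht]

theorem map_mulR (f : A.carrier →ₗ[ℤ] A'.carrier) (g : B.carrier →ₗ[ℤ] B'.carrier) (b : B.carrier)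
    (s : SymSq A.carrier) : symMap (tpMap f g) (mulR b s) = mulR (g b) (symMap f s) := by
  induction s using sym_induction with
  | hsm b b' => simp
  | hadd s t hs ht => simp only [map_add, hs, ht]

theorem map_mulS (f : A.carrier →ₗ[ℤ] A'.carrier) (g : B.carrier →ₗ[ℤ] B'.carrier)
    (s : SymSq A.carrier) (t : SymSq B.carrier) :
    symMap (tpMap f g) (mulS s t) = mulS (symMap f s) (symMap g t) := by
  induction s using sym_induction with
  | hsm a a' =>
    induction t using sym_induction with
    | hsm b b' => simp
    | hadd s t hs ht => simp only [map_add, hs, ht]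
  | hadd s t hs ht => simp only [map_add, LinearMap.add_apply, hs, ht]

theorem map_tensorδ (g : A ⟶ A') (h : B ⟶ B') (a : A.carrier) (b : B.carrier) :
    symMap (tpMap g.f h.f) (tensorδ A B (tp a b)) = tensorδ A' B' (tp (g.f a) (h.f b)) := by
  rw [tensorδ_tp, tensorδ_tp, map_sub, map_add, map_mulL, map_mulR, map_mulS, g.map_δ, h.map_δ]

/-- The tensor product of morphisms. -/
noncomputable def tensorMap (g : A ⟶ A') (h : B ⟶ B') : tensor A B ⟶ tensor A' B' :=
  tensorHom (tensor A' B') (tpMap g.f h.f) (map_tensorδ g h)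

@[simp] theorem tensorMap_tp (g : A ⟶ A') (h : B ⟶ B') (a : A.carrier) (b : B.carrier) :
    (tensorMap g h).f (tp a b : TP A.carrier B.carrier) = tp (g.f a) (h.f b) := rfl

section Assoc

variable {X Y Z : Type u} [AddCommGroup X] [AddCommGroup Y] [AddCommGroup Z]

theorem assoc_LL (x : X) (y : Y) (s : SymSq Z) :
    symMap (tpAssoc X Y Z) (mulL (tp x y) s) = mulL x (mulL y s) := by
  induction s using sym_induction with
  | hsm b b' => simp
  | hadd s t hs ht => simp only [map_add, hs, ht]

theorem assoc_LR (x : X) (z : Z) (s : SymSq Y) :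
    symMap (tpAssoc X Y Z) (mulR z (mulL x s)) = mulL x (mulR z s) := by
  induction s using sym_induction with
  | hsm b b' => simp
  | hadd s t hs ht => simp only [map_add, hs, ht]

theorem assoc_RR (y : Y) (z : Z) (s : SymSq X) :
    symMap (tpAssoc X Y Z) (mulR z (mulR y s)) = mulR (tp y z) s := by
  induction s using sym_induction with
  | hsm b b' => simp
  | hadd s t hs ht => simp only [map_add, hs, ht]

theorem assoc_RS (z : Z) (s : SymSq X) (t : SymSq Y) :
    symMap (tpAssoc X Y Z) (mulR z (mulS s t)) = mulS s (mulR z t) := by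
  induction s using sym_induction with
  | hsm a a' =>
    induction t using sym_induction with
    | hsm b b' => simp
    | hadd s t hs ht => simp only [map_add, hs, ht]
  | hadd s t hs ht => simp only [map_add, LinearMap.add_apply, hs, ht]

theorem assoc_SL (x : X) (s : SymSq Y) (t : SymSq Z) :
    symMap (tpAssoc X Y Z) (mulS (mulL x s) t) = mulL x (mulS s t) := by
  induction s using sym_induction with
  | hsm a a' =>
    induction t using sym_induction with
    | hsm b b' => simp
    | hadd s t hs ht => simp only [map_add, hs, ht]
  | hadd s t hs ht => simp only [map_add, LinearMap.add_apply, hs, ht]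

theorem assoc_SR (y : Y) (s : SymSq X) (t : SymSq Z) :
    symMap (tpAssoc X Y Z) (mulS (mulR y s) t) = mulS s (mulL y t) := by
  induction s using sym_induction with
  | hsm a a' =>
    induction t using sym_induction with
    | hsm b b' => simp
    | hadd s t hs ht => simp only [map_add, hs, ht]
  | hadd s t hs ht => simp only [map_add, LinearMap.add_apply, hs, ht]

theorem assoc_SS (s : SymSq X) (t : SymSq Y) (w : SymSq Z) :
    symMap (tpAssoc X Y Z) (mulS (mulS s t) w) = mulS s (mulS t w) := by
  induction s using sym_induction with
  | hsm a a' =>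
    induction t using sym_induction with
    | hsm b b' =>
      induction w using sym_induction with
      | hsm c c' =>
        simp
        abel
      | hadd s t hs ht => simp only [map_add, hs, ht]
    | hadd s t hs ht => simp only [map_add, LinearMap.add_apply, hs, ht]
  | hadd s t hs ht => simp only [map_add, LinearMap.add_apply, hs, ht]

end Assoc

theorem assoc_δ (a : A.carrier) (b : B.carrier) (c : C.carrier) :
    symMap (tpAssoc A.carrier B.carrier C.carrier) (mulL (tp a b) (C.δ c) +
      mulR c (tensorδ A B (tp a b)) - mulS (tensorδ A B (tp a b)) (C.δ c)) =
    mulL a (tensorδ B C (tp b c)) + mulR (tp b c) (A.δ a) -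
      mulS (A.δ a) (tensorδ B C (tp b c)) := by
  simp only [tensorδ_tp, map_add, map_sub, LinearMap.add_apply, LinearMap.sub_apply, assoc_LL,
    assoc_LR, assoc_RR, assoc_RS, assoc_SL, assoc_SR, assoc_SS]
  abel

/-- The associativity isomorphism. -/
noncomputable def assocIso (A B C : Cos.{u}) :
    tensor (tensor A B) C ≅ tensor A (tensor B C) :=
  isoMk (B := tensor A (tensor B C))
    (Hom.mk (A := tensor (tensor A B) C) (B := tensor A (tensor B C))
      (tpAssoc A.carrier B.carrier C.carrier) (fun t => by
        change PresAt (tensor (tensor A B) C) (tensor A (tensor B C))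
          (tpAssoc A.carrier B.carrier C.carrier) t
        induction t using tp_induction with
        | htp t c =>
          induction t using tp_induction with
          | htp a b => exact assoc_δ a b c
          | hadd s t hs ht =>
            have h := hs.add ht
            exact (LinearMap.map_add₂ tp s t c).symm ▸ h
        | hadd s t hs ht => exact hs.add ht))
    (tpAssocInv A.carrier B.carrier C.carrier)
    (tpAssocInv_comp A.carrier B.carrier C.carrier)
    (tpAssoc_comp A.carrier B.carrier C.carrier)

theorem comm_L (a : A.carrier) (s : SymSq B.carrier) :
    symMap (tpComm A.carrier B.carrier) (mulL a s) = mulR a s := by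
  induction s using sym_induction with
  | hsm b b' => simp
  | hadd s t hs ht => simp only [map_add, hs, ht]

theorem comm_R (b : B.carrier) (s : SymSq A.carrier) :
    symMap (tpComm A.carrier B.carrier) (mulR b s) = mulL b s := by
  induction s using sym_induction with
  | hsm a a' => simp
  | hadd s t hs ht => simp only [map_add, hs, ht]

theorem comm_S (s : SymSq A.carrier) (t : SymSq B.carrier) :
    symMap (tpComm A.carrier B.carrier) (mulS s t) = mulS t s := by
  induction s using sym_induction with
  | hsm a a' =>
    induction t using sym_induction with
    | hsm b b' =>
      simp only [mulS_sm, map_add, symMap_sm, tpComm_tp]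
      rw [sm_comm (tp b a')]
    | hadd s t hs ht => simp only [map_add, LinearMap.add_apply, hs, ht]
  | hadd s t hs ht => simp only [map_add, LinearMap.add_apply, hs, ht]

theorem comm_δ (a : A.carrier) (b : B.carrier) :
    symMap (tpComm A.carrier B.carrier) (tensorδ A B (tp a b)) = tensorδ B A (tp b a) := by
  rw [tensorδ_tp, tensorδ_tp, map_sub, map_add, comm_L, comm_R, comm_S, add_comm (mulR a (B.δ b))]

/-- The symmetry isomorphism. -/
noncomputable def braidIso (A B : Cos.{u}) : tensor A B ≅ tensor B A :=
  isoMk (B := tensor B A) (tensorHom (tensor B A) (tpComm A.carrier B.carrier) comm_δ)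
    (tpComm B.carrier A.carrier)
    (LinearMap.ext fun t => tpComm_tpComm (A := A.carrier) (B := B.carrier) t)
    (LinearMap.ext fun t => tpComm_tpComm (A := B.carrier) (B := A.carrier) t)

/-- The unit: the group `ℤ` with `δ n = n (n - 1) / 2`. -/
noncomputable def unit : Cos.{u} where
  carrier := ULift.{u} ℤ
  δ n := choose2 n.down • sm ⟨1⟩ ⟨1⟩
  δ_add m n := by
    have e : ∀ k : ULift.{u} ℤ, k = k.down • (⟨1⟩ : ULift.{u} ℤ) := by
      intro k
      ext
      simp
    have h : sm m n = (m.down * n.down) • sm (⟨1⟩ : ULift.{u} ℤ) ⟨1⟩ := by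
      conv_lhs => rw [e m, e n]
      rw [map_zsmul, map_zsmul, LinearMap.smul_apply, mul_zsmul, ← mul_zsmul, ← mul_zsmul,
        mul_comm]
    rw [ULift.add_down, choose2_add, add_zsmul, add_zsmul, h]

/-- The unit isomorphism on underlying groups. -/
noncomputable def unitMap (A : Type u) [AddCommGroup A] : TP (ULift.{u} ℤ) A →ₗ[ℤ] A :=
  tpLift (mkBilin (fun n a => n.down • a) (fun m n a => add_zsmul _ _ _)
    (fun n a b => zsmul_add _ _ _))

@[simp] theorem unitMap_tp {A : Type u} [AddCommGroup A] (n : ULift.{u} ℤ) (a : A) :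
    unitMap A (tp n a) = n.down • a := rfl

theorem tp_eq_one {A : Type u} [AddCommGroup A] (n : ULift.{u} ℤ) (a : A) :
    tp n a = tp (⟨1⟩ : ULift.{u} ℤ) (n.down • a) := by
  have e : n = n.down • (⟨1⟩ : ULift.{u} ℤ) := by
    ext
    simp
  conv_lhs => rw [e]
  rw [map_zsmul, map_zsmul, LinearMap.smul_apply]

theorem unit_L {A : Type u} [AddCommGroup A] (s : SymSq A) :
    symMap (unitMap A) (mulL ⟨1⟩ s) = s := by
  induction s using sym_induction with
  | hsm b b' => simp
  | hadd s t hs ht => simp only [map_add, hs, ht]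

theorem unit_δ (n : ULift.{u} ℤ) (a : A.carrier) :
    symMap (unitMap A.carrier) (tensorδ unit A (tp n a)) = A.δ (n.down • a) := by
  rw [tp_eq_one]
  refine (congrArg (symMap (unitMap A.carrier)) (tensorδ_tp (A := unit) _ _)).trans ?_
  have h : unit.δ (⟨1⟩ : ULift.{u} ℤ) = 0 := by
    change choose2 1 • sm (⟨1⟩ : ULift.{u} ℤ) ⟨1⟩ = 0
    rw [show choose2 1 = 0 from rfl, zero_zsmul]
  rw [h, map_zero, map_zero, LinearMap.zero_apply, sub_zero, add_zero]
  exact unit_L _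

/-- The left unit isomorphism. -/
noncomputable def leftUnitIso (A : Cos.{u}) : tensor unit A ≅ A :=
  isoMk (tensorHom (A := unit) A (unitMap A.carrier) unit_δ) (tp (⟨1⟩ : ULift.{u} ℤ))
    (tp_ext (A := ULift.{u} ℤ) fun n a => (tp_eq_one n a).symm)
    (LinearMap.ext fun a => one_zsmul a)

/-- The right unit isomorphism. -/
noncomputable def rightUnitIso (A : Cos.{u}) : tensor A unit ≅ A :=
  braidIso A unit ≪≫ leftUnitIso A

noncomputable instance : MonoidalCategoryStruct Cos.{u} where
  tensorObj := tensor
  whiskerLeft A _ _ f := tensorMap (𝟙 A) f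
  whiskerRight f B := tensorMap f (𝟙 B)
  tensorHom f g := tensorMap f g
  tensorUnit := unit
  associator := assocIso
  leftUnitor := leftUnitIso
  rightUnitor := rightUnitIso

theorem tensor₃_hom_ext {g h : tensor (tensor A B) C ⟶ D}
    (e : ∀ (a : A.carrier) (b : B.carrier) (c : C.carrier),
      g.f (tp (tp a b) c) = h.f (tp (tp a b) c)) : g = h := by
  refine tensor_hom_ext (A := tensor A B) fun t c => ?_
  have key : (g.f.comp (tp (A := TP A.carrier B.carrier).flip c)) = h.f.comp (tp.flip c) :=
    tp_ext fun a b => e a b c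
  exact LinearMap.congr_fun key t

theorem tensor₃_hom_ext' {g h : tensor A (tensor B C) ⟶ D}
    (e : ∀ (a : A.carrier) (b : B.carrier) (c : C.carrier),
      g.f (tp a (tp b c)) = h.f (tp a (tp b c))) : g = h := by
  refine tensor_hom_ext (B := tensor B C) fun a t => ?_
  have key : (g.f.comp (tp (B := TP B.carrier C.carrier) a)) = h.f.comp (tp a) :=
    tp_ext fun b c => e a b c
  exact LinearMap.congr_fun key t

theorem tensor₄_hom_ext {g h : tensor (tensor (tensor A B) C) D ⟶ A'}
    (e : ∀ (a : A.carrier) (b : B.carrier) (c : C.carrier) (d : D.carrier),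
      g.f (tp (tp (tp a b) c) d) = h.f (tp (tp (tp a b) c) d)) : g = h := by
  refine tensor₃_hom_ext (A := tensor A B) fun t c d => ?_
  have key : (g.f.comp ((tp (A := TP (TP A.carrier B.carrier) C.carrier).flip d).comp
      (tp (A := TP A.carrier B.carrier).flip c))) = h.f.comp ((tp.flip d).comp (tp.flip c)) :=
    tp_ext fun a b => e a b c d
  exact LinearMap.congr_fun key t

theorem tp_zsmul {X Y : Type u} [AddCommGroup X] [AddCommGroup Y] (n : ℤ) (x : X) (y : Y) :
    tp x (n • y) = tp (n • x) y := by
  rw [map_zsmul, map_zsmul, LinearMap.smul_apply]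

noncomputable instance : MonoidalCategory Cos.{u} :=
  MonoidalCategory.ofTensorHom
    (id_tensorHom_id := fun A B => tensor_hom_ext fun _ _ => rfl)
    (id_tensorHom := fun _ _ _ _ => rfl)
    (tensorHom_id := fun _ _ => rfl)
    (tensorHom_comp_tensorHom := fun _ _ _ _ => tensor_hom_ext fun _ _ => rfl)
    (associator_naturality := fun _ _ _ => tensor₃_hom_ext fun _ _ _ => rfl)
    (leftUnitor_naturality := fun f => tensor_hom_ext (A := unit) fun n a => (map_zsmul f.f _ _).symm)
    (rightUnitor_naturality := fun f => tensor_hom_ext (B := unit) fun a n => (map_zsmul f.f _ _).symm)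
    (pentagon := fun _ _ _ _ => tensor₄_hom_ext fun _ _ _ _ => rfl)
    (triangle := fun _ _ => tensor₃_hom_ext (B := unit) fun a n b => tp_zsmul _ _ _)

noncomputable instance : SymmetricCategory Cos.{u} where
  braiding := braidIso
  braiding_naturality_right _ _ _ _ := tensor_hom_ext fun _ _ => rfl
  braiding_naturality_left _ _ := tensor_hom_ext fun _ _ => rfl
  hexagon_forward _ _ _ := tensor₃_hom_ext fun _ _ _ => rfl
  hexagon_reverse _ _ _ := tensor₃_hom_ext' fun _ _ _ => rfl
  symmetry _ _ := tensor_hom_ext fun _ _ => rfl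

end Cos

/-! ### The functor from abelian groups with cosymmetry to square groups -/

namespace Cos

variable {A B C : Cos.{u}}

/-- The bilinear pairing `a, b ↦ a ⊗ b`. -/
noncomputable def tpPairing (A : Cos.{u}) : CentralPairing A.carrier (TP A.carrier A.carrier) :=
  CentralPairing.ofBilin tp

/-- The group of pairs `(a, x)` with `x ∈ A ⊗ A` and `π x = δ a`, with the addition
`(a, x) + (b, y) = (a + b, x + y + a ⊗ b)`. -/
noncomputable def JE (A : Cos.{u}) : AddSubgroup (tpPairing A).Ext where
  carrier := {p | tpToSym A.carrier p.snd = A.δ p.fst}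
  zero_mem' := by simp
  add_mem' := by
    intro p q hp hq
    simp only [Set.mem_setOf_eq] at *
    rw [CentralPairing.add_snd, map_add, map_add, hp, hq, CentralPairing.add_fst, A.δ_add]
    rfl
  neg_mem' := by
    intro p hp
    simp only [Set.mem_setOf_eq] at *
    rw [CentralPairing.neg_snd, map_add, map_neg, hp, CentralPairing.neg_fst, δ_neg,
      sub_eq_neg_add]
    rfl

theorem tpToSym_comm {X : Type u} [AddCommGroup X] (t : TP X X) :
    tpToSym X (tpComm X X t) = tpToSym X t := by
  induction t using tp_induction with
  | htp a b => exact sm_comm b a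
  | hadd s t hs ht => simp only [map_add, hs, ht]

/-- The homomorphism `P (a ⊗ b) = (0, a ⊗ b - b ⊗ a)`. -/
noncomputable def JP (A : Cos.{u}) : TP A.carrier A.carrier →+ JE A :=
  AddMonoidHom.mk' (fun t => ⟨⟨0, t - tpComm A.carrier A.carrier t⟩, by
      change tpToSym A.carrier _ = A.δ 0
      rw [map_sub, tpToSym_comm, sub_self, δ_zero]⟩)
    (fun s t => by
      refine Subtype.ext (CentralPairing.Ext.ext (add_zero 0).symm ?_)
      change s + t - tpComm A.carrier A.carrier (s + t) =
        s - tpComm A.carrier A.carrier s + (t - tpComm A.carrier A.carrier t) + tp 0 0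
      rw [map_add, map_zero]
      abel)

theorem JE_cross (p q : JE A) :
    crossEffect (fun p : JE A => p.1.snd) p q = tp p.1.fst q.1.fst := by
  change p.1.snd + q.1.snd + tp p.1.fst q.1.fst - p.1.snd - q.1.snd = _
  abel

/-- The square group associated with an abelian group with cosymmetry. -/
noncomputable def JObj (A : Cos.{u}) : SquareGroup.{u} where
  e := JE A
  ee := TP A.carrier A.carrier
  H p := p.1.snd
  P := JP A
  cross_add_left p q r := by
    rw [JE_cross, JE_cross, JE_cross]
    exact LinearMap.map_add₂ tp _ _ _
  cross_add_right p q r := by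
    rw [JE_cross, JE_cross, JE_cross]
    exact map_add (tp p.1.fst) _ _
  cross_P_left t q := (JE_cross _ _).trans (LinearMap.map_zero₂ tp _)
  cross_P_right p t := (JE_cross _ _).trans (map_zero (tp p.1.fst))
  P_cross p q := by
    rw [JE_cross]
    have h : q + p + JP A (tp p.1.fst q.1.fst) = p + q := by
      refine Subtype.ext (CentralPairing.Ext.ext ?_ ?_)
      · change q.1.fst + p.1.fst + 0 = p.1.fst + q.1.fst
        rw [add_zero, add_comm]
      · change q.1.snd + p.1.snd + tp q.1.fst p.1.fst +
          (tp p.1.fst q.1.fst - tp q.1.fst p.1.fst) + tp (q.1.fst + p.1.fst) 0 =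
            p.1.snd + q.1.snd + tp p.1.fst q.1.fst
        rw [map_zero]
        abel
    rw [add_assoc (-p - q), ← h]
    add_group
  P_H_P t := by
    rw [← map_add]
    refine Subtype.ext (CentralPairing.Ext.ext rfl ?_)
    change t - tpComm A.carrier A.carrier t -
        tpComm A.carrier A.carrier (t - tpComm A.carrier A.carrier t) =
      t + t - tpComm A.carrier A.carrier (t + t)
    rw [map_sub, map_add, tpComm_tpComm]
    abel

theorem tpToSym_map {X Y : Type u} [AddCommGroup X] [AddCommGroup Y] (f : X →ₗ[ℤ] Y)
    (t : TP X X) : tpToSym Y (tpMap f f t) = symMap f (tpToSym X t) := by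
  induction t using tp_induction with
  | htp a b => exact (symMap_sm f a b).symm
  | hadd s t hs ht => simp only [map_add, hs, ht]

theorem tpComm_map {X Y : Type u} [AddCommGroup X] [AddCommGroup Y] (f : X →ₗ[ℤ] Y)
    (t : TP X X) : tpMap f f (tpComm X X t) = tpComm Y Y (tpMap f f t) := by
  induction t using tp_induction with
  | htp a b => rfl
  | hadd s t hs ht => simp only [map_add, hs, ht]

/-- The morphism `(a, x) ↦ (f a, (f ⊗ f) x)` of square groups. -/
noncomputable def JMap (g : A ⟶ B) : JObj A ⟶ JObj B :=
  SquareGroup.Hom.mk (M := JObj A) (N := JObj B)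
    (AddMonoidHom.mk' (fun p : JE A => (⟨⟨g.f p.1.fst, tpMap g.f g.f p.1.snd⟩, by
        change tpToSym B.carrier _ = B.δ _
        rw [tpToSym_map, ← g.map_δ]
        exact congrArg _ p.2⟩ : JE B))
      (fun p q => Subtype.ext (CentralPairing.Ext.ext (map_add g.f _ _) (by
        change tpMap g.f g.f (p.1.snd + q.1.snd + tp p.1.fst q.1.fst) =
          tpMap g.f g.f p.1.snd + tpMap g.f g.f q.1.snd + tp (g.f p.1.fst) (g.f q.1.fst)
        rw [map_add, map_add, tpMap_tp]))))
    (tpMap g.f g.f)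
    (fun t : TP A.carrier A.carrier => Subtype.ext (CentralPairing.Ext.ext (map_zero g.f) (by
      change tpMap g.f g.f (t - tpComm A.carrier A.carrier t) =
        tpMap g.f g.f t - tpComm B.carrier B.carrier (tpMap g.f g.f t)
      rw [map_sub, tpComm_map])))
    (fun _ => rfl)

theorem tpMap_id {X : Type u} [AddCommGroup X] (t : TP X X) :
    tpMap LinearMap.id LinearMap.id t = t :=
  LinearMap.congr_fun (tp_ext (f := tpMap LinearMap.id LinearMap.id) (g := LinearMap.id)
    fun _ _ => rfl) t

theorem tpMap_comp {X Y Z : Type u} [AddCommGroup X] [AddCommGroup Y] [AddCommGroup Z]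
    (f : X →ₗ[ℤ] Y) (g : Y →ₗ[ℤ] Z) (t : TP X X) :
    tpMap (g.comp f) (g.comp f) t = tpMap g g (tpMap f f t) :=
  LinearMap.congr_fun (tp_ext (f := tpMap (g.comp f) (g.comp f)) (g := (tpMap g g).comp (tpMap f f))
    fun _ _ => rfl) t

/-- The functor from abelian groups with cosymmetry to square groups. -/
noncomputable def J : Cos.{u} ⥤ SquareGroup.{u} where
  obj := JObj
  map := JMap
  map_id A := SquareGroup.hom_ext
    (fun _ => Subtype.ext (CentralPairing.Ext.ext rfl (tpMap_id _))) (LinearMap.ext tpMap_id)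
  map_comp g h := SquareGroup.hom_ext
    (fun _ => Subtype.ext (CentralPairing.Ext.ext rfl (tpMap_comp g.f h.f _)))
    (LinearMap.ext (tpMap_comp g.f h.f))

end Cos

/-! A square group M in SG_Σ is determined by the abelian group A = Coker P together with the
classes of the values of H in Sym²(A). The cross-effect isomorphism identifies M_ee with A ⊗ A.
Since T(x|y)_H = -(y|x)_H, the involution T becomes -τ, where τ interchanges the two factors.
Replacing x by x + P(a) therefore changes H(x) by a + T(a) = a - τ(a), which dies in Sym²(A). So
π(H(x)) depends only on the class of x and defines a cosymmetry δ on A (`cokerδ_toCoker`), and x ↦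
(class of x, H(x)) is a morphism M → J(A, δ).

That this morphism loses nothing is the injectivity statement `isSigma.eq_zero`: im P ∩ ker H = 0.
If H(P(a)) = a - τ(a) vanishes, then a is a symmetric tensor. Symmetric tensors over any abelian
group are integral combinations of squares x ⊗ x (`SymmetricTensor.mem_squares`), and P kills a
square because P((x|x)_H) is the commutator [x,x] = 0. The fact on symmetric tensors is the one
arithmetic input. It reduces to finitely generated groups, hence to direct sums of cyclic groups;
there the off-diagonal components of a symmetric tensor come in pairs s + τ(s), and the diagonal
ones are multiples of squares of generators.

With this, a five lemma argument gives (ii) in `isIso_of_cokerMap_bijective`: an isomorphism on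
cokernels is one on the ee-level, through the cross-effects, and then one on the e-level. The
isomorphism claims in (i), (iii) and (iv) thereby become computations of cokernels.

For (i), the cokernel of P for J(A, δ) is A because ker π = im(1 - τ), and its cross-effect is then
the identity of A ⊗ A (`JCoker_bijective`, `isSigma_JObj`). A morphism between objects in the image
of J is g ⊗ g on the ee-level, g being the map on cokernels, and π H = δ forces g to respect δ
(`exists_map_eq`). Essential surjectivity comes from `isIso_toJOfSigma`.

For (iii), the cokernel of M ⊚ N is the tensor product of the cokernels and its cross-effect is the
tensor product of the two cross-effects (`isSigma_tensor`). The morphism σ is always bijective on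
cokernels; it is bijective on the ee-level once the cross-effect of M is invertible, because the
first summand of (M □ N)_ee is then absorbed into the second (`sigmaEE_bijective`).

For (iv), the formula H(p ⊚ q) = (p|p)_H ⊗ H(q) + H(p) ⊗ Δ(q) with Δ(q) = (q|q)_H - H(q) + T(H(q))
projects to a * δ(b) + δ(a) * b - δ(a) * δ(b), the cosymmetry of the tensor product
(`tpToSym_muEE_H`). The coherence diagrams start at objects of SG_Σ and end at values of J, so by
`homToJ_ext` they need only be compared in the first coordinate on generators; there all terms from
P vanish and the corresponding identities for abelian groups remain. -/

/-! ### Symmetric tensors -/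

namespace SymmetricTensor

section

variable {A B : Type*} [AddCommGroup A] [AddCommGroup B]

/-- The subgroup of `A ⊗ A` generated by the squares `a ⊗ a`. -/
def squares (A : Type*) [AddCommGroup A] : Submodule ℤ (A ⊗[ℤ] A) :=
  Submodule.span ℤ (Set.range fun a : A => a ⊗ₜ[ℤ] a)

theorem tmul_self_mem (a : A) : a ⊗ₜ[ℤ] a ∈ squares A := Submodule.subset_span ⟨a, rfl⟩

/-- Polarisation: a ⊗ b + b ⊗ a is the square of a + b minus the squares of a and of b. -/
theorem add_comm_mem (t : A ⊗[ℤ] A) : t + TensorProduct.comm ℤ A A t ∈ squares A := by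
  induction t with
  | zero => simp
  | tmul a b =>
    have h := (squares A).sub_mem ((squares A).sub_mem (tmul_self_mem (a + b)) (tmul_self_mem a))
      (tmul_self_mem b)
    have e : (a + b) ⊗ₜ[ℤ] (a + b) - a ⊗ₜ a - b ⊗ₜ b = a ⊗ₜ b + b ⊗ₜ a := by
      simp only [TensorProduct.add_tmul, TensorProduct.tmul_add]; abel
    rwa [e] at h
  | add s t hs ht =>
    have h := add_mem hs ht
    rw [map_add]
    rwa [add_add_add_comm] at h

theorem map_squares (f : A →ₗ[ℤ] B) {t : A ⊗[ℤ] A} (ht : t ∈ squares A) :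
    TensorProduct.map f f t ∈ squares B := by
  have h : squares A ≤ (squares B).comap (TensorProduct.map f f) := by
    refine Submodule.span_le.2 ?_
    rintro _ ⟨a, rfl⟩
    exact tmul_self_mem (f a)
  exact h ht

/-! ### Symmetric tensors over finitely generated groups -/

/-- Symmetric tensors over a finite direct sum of cyclic groups are combinations of squares. -/
theorem mem_squares_of_cyclic {ι : Type*} [Fintype ι] (p : ι → A →ₗ[ℤ] A) (e : ι → A)
    (hp : ∑ i, p i = LinearMap.id) (he : ∀ i x, ∃ n : ℤ, p i x = n • e i) {t : A ⊗[ℤ] A}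
    (ht : TensorProduct.comm ℤ A A t = t) : t ∈ squares A := by
  classical
  -- Both factors of a diagonal component are multiples of the same element e i, so the component is
  -- a multiple of e i ⊗ e i.
  have hdiag : ∀ (i : ι) (s : A ⊗[ℤ] A), TensorProduct.map (p i) (p i) s ∈ squares A := by
    intro i s
    induction s with
    | zero => simp
    | tmul a b =>
      obtain ⟨m, hm⟩ := he i a
      obtain ⟨n, hn⟩ := he i b
      rw [TensorProduct.map_tmul, hm, hn, ← TensorProduct.smul_tmul', TensorProduct.tmul_smul]
      exact Submodule.smul_mem _ _ (Submodule.smul_mem _ _ (tmul_self_mem _))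
    | add s t hs ht => rw [map_add]; exact add_mem hs ht
  have hswap : ∀ i j (s : A ⊗[ℤ] A), TensorProduct.map (p j) (p i) (TensorProduct.comm ℤ A A s) =
      TensorProduct.comm ℤ A A (TensorProduct.map (p i) (p j) s) := by
    intro i j s
    induction s with
    | zero => simp
    | tmul a b => simp
    | add s t hs ht => simp only [map_add, hs, ht]
  -- Inserting ∑ p i = id in both factors decomposes t into its matrix of components.
  have hsum : t = ∑ k : ι × ι, TensorProduct.map (p k.1) (p k.2) t := by
    have h : TensorProduct.map (∑ i, p i) (∑ i, p i) t =
        ∑ k : ι × ι, TensorProduct.map (p k.1) (p k.2) t := by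
      clear ht
      induction t with
      | zero => simp
      | tmul a b =>
        simp only [TensorProduct.map_tmul, LinearMap.sum_apply, TensorProduct.sum_tmul,
          TensorProduct.tmul_sum]
        rw [Fintype.sum_prod_type, Finset.sum_comm]
      | add s t hs ht => simp only [map_add, hs, ht, Finset.sum_add_distrib]
    rw [← h, hp, TensorProduct.map_id, LinearMap.id_apply]
  -- Modulo squares the sum of all components cancels under the involution (i, j) ↦ (j, i): by
  -- symmetry of t the component at (j, i) is the interchange of the one at (i, j), so the two add
  -- up to a polarised square.
  rw [← Submodule.Quotient.mk_eq_zero, hsum, ← Submodule.mkQ_apply, map_sum]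
  refine Finset.sum_involution (fun k _ => k.swap) ?_ ?_ (by simp) (by simp)
  · rintro ⟨i, j⟩ -
    rw [← map_add, Submodule.mkQ_apply, Submodule.Quotient.mk_eq_zero]
    have h := hswap i j t
    rw [ht] at h
    simp only [Prod.fst_swap, Prod.snd_swap, h]
    exact add_comm_mem _
  -- A fixed point of the involution is a diagonal component, which is already zero in the quotient.
  · rintro ⟨i, j⟩ - h0 h
    obtain rfl : j = i := (Prod.ext_iff.1 h).1
    exact h0 ((Submodule.Quotient.mk_eq_zero _).2 (hdiag j t))

/-- The structure theorem for finitely generated abelian groups supplies the decomposition into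
cyclic summands: `p` consists of the projections onto the infinite and the finite summands, `e` of
their generators. -/
theorem mem_squares_of_finite [Module.Finite ℤ A] {t : A ⊗[ℤ] A}
    (ht : TensorProduct.comm ℤ A A t = t) : t ∈ squares A := by
  classical
  obtain ⟨n, ι, _, q, -, k, ⟨g⟩⟩ := Module.equiv_free_prod_directSum ℤ A
  let C : ι → Type := fun i => ℤ ⧸ Submodule.span ℤ {q i ^ k i}
  let p : Fin n ⊕ ι → A →ₗ[ℤ] A := Sum.elim
    (fun i => g.symm.toLinearMap ∘ₗ LinearMap.inl ℤ _ _ ∘ₗ Finsupp.lsingle i ∘ₗ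
      Finsupp.lapply i ∘ₗ LinearMap.fst ℤ _ _ ∘ₗ g.toLinearMap)
    (fun i => g.symm.toLinearMap ∘ₗ LinearMap.inr ℤ _ _ ∘ₗ DirectSum.lof ℤ ι C i ∘ₗ
      DirectSum.component ℤ ι C i ∘ₗ LinearMap.snd ℤ _ _ ∘ₗ g.toLinearMap)
  let e : Fin n ⊕ ι → A := Sum.elim (fun i => g.symm (Finsupp.single i 1, 0))
    (fun i => g.symm (0, DirectSum.lof ℤ ι C i (Submodule.Quotient.mk 1)))
  refine mem_squares_of_cyclic p e ?_ ?_ ht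
  · ext x
    obtain ⟨⟨v, w⟩, rfl⟩ := g.symm.surjective x
    have hv : ∑ i, Finsupp.single i (v i) = v := Finsupp.univ_sum_single v
    have hw : ∑ i, DirectSum.lof ℤ ι C i (DirectSum.component ℤ ι C i w) = w :=
      DirectSum.sum_univ_of w
    rw [LinearMap.sum_apply, Fintype.sum_sum_type]
    simp only [p, Sum.elim_inl, Sum.elim_inr, LinearMap.comp_apply, LinearEquiv.coe_coe,
      LinearEquiv.apply_symm_apply, LinearMap.fst_apply, LinearMap.snd_apply, ← map_sum,
      Finsupp.lapply_apply, Finsupp.lsingle_apply, LinearMap.id_apply, hv, hw]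
    rw [← map_add]
    simp
  · rintro (i | i) x
    · refine ⟨(g x).1 i, ?_⟩
      change g.symm _ = _ • g.symm _
      rw [← map_zsmul]
      simp
    · obtain ⟨m, hm⟩ := Submodule.Quotient.mk_surjective _ (DirectSum.component ℤ ι C i (g x).2)
      refine ⟨m, ?_⟩
      change g.symm (0, DirectSum.lof ℤ ι C i (DirectSum.component ℤ ι C i (g x).2)) =
        _ • g.symm _
      rw [← map_zsmul, ← hm, Prod.smul_mk, smul_zero, ← map_zsmul]
      simp

/-! ### From finitely generated groups to arbitrary ones -/

/-- A tensor over a finitely generated submodule which vanishes in the ambient module vanishes over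
a larger finitely generated submodule. -/
theorem exists_fg_map_inclusion_eq {N : Submodule ℤ A} (hN : N.FG) {x y : N ⊗[ℤ] N}
    (h : TensorProduct.map N.subtype N.subtype x = TensorProduct.map N.subtype N.subtype y) :
    ∃ N' : Submodule ℤ A, N'.FG ∧ ∃ i : N ≤ N',
      TensorProduct.map (Submodule.inclusion i) (Submodule.inclusion i) x =
        TensorProduct.map (Submodule.inclusion i) (Submodule.inclusion i) y := by
  -- The factors are treated one at a time. The images of x and y in N ⊗ A agree in A ⊗ A, hence
  -- already in N₁ ⊗ A for some finitely generated N₁ above N.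
  obtain ⟨N₁, h₁, i₁, e₁⟩ := hN.exists_rTensor_fg_inclusion_eq
    (x := N.subtype.lTensor N x) (y := N.subtype.lTensor N y) (by
      rwa [← LinearMap.comp_apply, ← LinearMap.comp_apply, LinearMap.rTensor_comp_lTensor])
  have hc : ∀ s : N ⊗[ℤ] N, N.subtype.rTensor N₁
      (TensorProduct.comm ℤ N₁ N ((Submodule.inclusion i₁).rTensor N s)) =
      TensorProduct.comm ℤ N₁ A ((Submodule.inclusion i₁).rTensor A (N.subtype.lTensor N s)) := by
    intro s
    induction s with
    | zero => simp
    | tmul a b => simp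
    | add s t hs ht => simp only [map_add, hs, ht]
  -- After interchanging the factors the same argument applies to the other one: the elements of N ⊗
  -- N₁ agree in A ⊗ N₁, hence in N₂ ⊗ N₁.
  obtain ⟨N₂, h₂, i₂, e₂⟩ := hN.exists_rTensor_fg_inclusion_eq
    (x := TensorProduct.comm ℤ N₁ N ((Submodule.inclusion i₁).rTensor N x))
    (y := TensorProduct.comm ℤ N₁ N ((Submodule.inclusion i₁).rTensor N y)) (by
      rw [hc, hc, e₁])
  refine ⟨N₁ ⊔ N₂, h₁.sup h₂, i₁.trans le_sup_left, ?_⟩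
  -- The inclusion into the tensor square of N₁ ⊔ N₂ passes through N₂ ⊗ N₁, where the equality is
  -- known.
  have hc' : ∀ s : N ⊗[ℤ] N, TensorProduct.map (Submodule.inclusion (i₁.trans le_sup_left))
      (Submodule.inclusion (i₁.trans le_sup_left)) s =
      TensorProduct.comm ℤ _ _ (TensorProduct.map
        (Submodule.inclusion (le_sup_right : N₂ ≤ N₁ ⊔ N₂))
        (Submodule.inclusion (le_sup_left : N₁ ≤ N₁ ⊔ N₂))
        ((Submodule.inclusion i₂).rTensor N₁
          (TensorProduct.comm ℤ N₁ N ((Submodule.inclusion i₁).rTensor N s)))) := by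
    intro s
    induction s with
    | zero => simp
    | tmul a b => simp; rfl
    | add s t hs ht => simp only [map_add, hs, ht]
  rw [hc', hc', e₂]

/-- Symmetric tensors are combinations of squares. -/
theorem mem_squares {t : A ⊗[ℤ] A} (ht : TensorProduct.comm ℤ A A t = t) : t ∈ squares A := by
  -- A single tensor involves only finitely many elements of A, so it lifts to some r over a
  -- finitely generated subgroup.
  obtain ⟨N₁, N₂, h₁, h₂, h⟩ := TensorProduct.exists_finite_submodule_of_setFinite {t}
    (Set.finite_singleton t)
  obtain ⟨s, hs⟩ := h rfl
  rw [Module.Finite.iff_fg] at h₁ h₂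
  have hc : ∀ (N : Submodule ℤ A) (r : N ⊗[ℤ] N), TensorProduct.map N.subtype N.subtype
      (TensorProduct.comm ℤ N N r) =
        TensorProduct.comm ℤ A A (TensorProduct.map N.subtype N.subtype r) := by
    intro N r
    induction r with
    | zero => simp
    | tmul a b => simp
    | add s t hs ht => simp only [map_add, hs, ht]
  obtain ⟨r, hr⟩ : ∃ r : ↥(N₁ ⊔ N₂) ⊗[ℤ] ↥(N₁ ⊔ N₂),
      TensorProduct.map (N₁ ⊔ N₂).subtype (N₁ ⊔ N₂).subtype r = t := by
    refine ⟨TensorProduct.map (Submodule.inclusion le_sup_left)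
      (Submodule.inclusion le_sup_right) s, ?_⟩
    rw [← hs, ← LinearMap.comp_apply, ← TensorProduct.map_comp]
    rfl
  -- The lift r need not be symmetric, but r and its interchange have the same image in A ⊗ A, so
  -- they agree over a larger finitely generated N'. There the finite case applies, and squares map
  -- to squares.
  obtain ⟨N', h', i, e⟩ := exists_fg_map_inclusion_eq (h₁.sup h₂) (x := r)
    (y := TensorProduct.comm ℤ _ _ r) (by rw [hc, hr, ht])
  have : Module.Finite ℤ N' := Module.Finite.iff_fg.2 h'
  have hm : TensorProduct.map (Submodule.inclusion i) (Submodule.inclusion i) r ∈ squares N' := by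
    refine mem_squares_of_finite ?_
    rw [TensorProduct.map_comm] at e
    exact e.symm
  have h := map_squares N'.subtype hm
  rw [← LinearMap.comp_apply, ← TensorProduct.map_comp] at h
  exact hr ▸ h

end

end SymmetricTensor

/-! ### Square groups with invertible cross-effect -/

namespace SquareGroup

section Sigma

variable {M N : SquareGroup.{u}}

theorem exists_P_of_toCoker_eq_zero {x : M.e} (h : M.toCoker x = 0) : ∃ a, x = M.P a := by
  obtain ⟨a, ha⟩ := (QuotientAddGroup.eq_zero_iff (N := M.P.range) x).1 h
  exact ⟨a, ha.symm⟩

theorem exists_add_P_of_toCoker_eq {x y : M.e} (h : M.toCoker x = M.toCoker y) :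
    ∃ a, x = y + M.P a := by
  obtain ⟨a, ha⟩ := exists_P_of_toCoker_eq_zero (x := -y + x) (by
    rw [map_add, map_neg, h, neg_add_cancel])
  exact ⟨a, by rw [← ha, add_neg_cancel_left]⟩

/-- On a cross-effect this is T(x|y)_H = -(y|x)_H, so T corresponds to minus the interchange of
factors. -/
theorem T_lift_crC (t : Coker M ⊗[ℤ] Coker M) : M.T (TensorProduct.lift M.crC t) =
    -TensorProduct.lift M.crC (TensorProduct.comm ℤ _ _ t) := by
  induction t with
  | zero => simp
  | tmul a b =>
    obtain ⟨x, rfl⟩ := M.toCoker_surjective a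
    obtain ⟨y, rfl⟩ := M.toCoker_surjective b
    simp [T_cr]
  | add s t hs ht => simp only [map_add, hs, ht, neg_add]

/-- The image of a square under P is a commutator [x, x]. -/
theorem P_lift_crC_of_mem_squares {t : Coker M ⊗[ℤ] Coker M} (ht : t ∈ SymmetricTensor.squares _) :
    M.P (TensorProduct.lift M.crC t) = 0 := by
  induction ht using Submodule.span_induction with
  | mem t ht =>
    obtain ⟨a, rfl⟩ := ht
    obtain ⟨x, rfl⟩ := M.toCoker_surjective a
    rw [TensorProduct.lift.tmul, crC_apply, P_cr]
    add_group
  | zero => simp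
  | add s t _ _ hs ht => rw [map_add, map_add, hs, ht, add_zero]
  | smul n t _ ht => rw [map_zsmul, map_zsmul, ht, zsmul_zero]

/-- Write x = P(a) and let t be the tensor whose cross-effect is a. Then H(x) = a + T(a) corresponds
to t minus its interchange. Injectivity of the cross-effect homomorphism makes t symmetric, hence a
combination of squares, and P kills those. -/
theorem isSigma.eq_zero (hM : isSigma M) {x : M.e} (hx : M.toCoker x = 0) (hH : M.H x = 0) :
    x = 0 := by
  obtain ⟨a, rfl⟩ := exists_P_of_toCoker_eq_zero hx
  obtain ⟨t, rfl⟩ := hM.2 a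
  rw [H_P, T_lift_crC, ← sub_eq_add_neg, sub_eq_zero] at hH
  exact P_lift_crC_of_mem_squares (SymmetricTensor.mem_squares (hM.1 hH).symm)

/-- Naturality of the cross-effect; this commutative square carries bijectivity between the
cokernels and the ee-level. -/
theorem ee_lift_crC (f : M ⟶ N) (t : Coker M ⊗[ℤ] Coker M) :
    f.ee (TensorProduct.lift M.crC t) =
      TensorProduct.lift N.crC (TensorProduct.map (cokerMap f) (cokerMap f) t) := by
  induction t with
  | zero => simp
  | tmul a b =>
    obtain ⟨x, rfl⟩ := M.toCoker_surjective a
    obtain ⟨y, rfl⟩ := M.toCoker_surjective b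
    simp [ee_cr]
  | add s t hs ht => simp only [map_add, hs, ht]

theorem map_bijective {A B C D : Type*} [AddCommGroup A] [AddCommGroup B] [AddCommGroup C]
    [AddCommGroup D] {f : A →ₗ[ℤ] B} {g : C →ₗ[ℤ] D} (hf : Function.Bijective f)
    (hg : Function.Bijective g) : Function.Bijective (TensorProduct.map f g) :=
  (TensorProduct.congr (LinearEquiv.ofBijective f hf) (LinearEquiv.ofBijective g hg)).bijective

theorem ee_comp_lift_crC (f : M ⟶ N) : f.ee ∘ TensorProduct.lift M.crC =
    TensorProduct.lift N.crC ∘ TensorProduct.map (cokerMap f) (cokerMap f) :=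
  funext (ee_lift_crC f)

/-- In the naturality square of the cross-effects three sides are bijective, hence so is the fourth.
This is how membership in SG_Σ passes from M ⊚ N to M □ N. -/
theorem isSigma_of_bijective (f : M ⟶ N) (hN : isSigma N) (hf : Function.Bijective (cokerMap f))
    (hf' : Function.Bijective f.ee) : isSigma M := by
  have h := hN.comp (map_bijective hf hf)
  rw [← ee_comp_lift_crC] at h
  exact (Function.Bijective.of_comp_iff' hf' _).1 h

theorem ee_bijective (f : M ⟶ N) (hM : isSigma M) (hN : isSigma N)
    (hf : Function.Bijective (cokerMap f)) : Function.Bijective f.ee := by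
  have h := hN.comp (map_bijective hf hf)
  rw [← ee_comp_lift_crC] at h
  exact (Function.Bijective.of_comp_iff _ hM).1 h

theorem isIso_of_bijective (f : M ⟶ N) (h : Function.Bijective f.e) (h' : Function.Bijective f.ee) :
    IsIso f :=
  (isoOfInverse f (Equiv.ofBijective f.e h).symm (LinearEquiv.ofBijective f.ee h').symm.toLinearMap
    (Equiv.ofBijective f.e h).symm_apply_apply (Equiv.ofBijective f.e h).apply_symm_apply
    (LinearMap.ext (LinearEquiv.ofBijective f.ee h').symm_apply_apply)
    (LinearMap.ext (LinearEquiv.ofBijective f.ee h').apply_symm_apply)).isIso_hom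

/-- A five lemma argument for M_ee → M_e → Coker P → 0, in which the exactness missing on the left
is replaced by `isSigma.eq_zero`: an element killed by f has trivial class in the cokernel and
trivial H. -/
theorem isIso_of_cokerMap_bijective (f : M ⟶ N) (hM : isSigma M) (hN : isSigma N)
    (hf : Function.Bijective (cokerMap f)) : IsIso f := by
  have hee := ee_bijective f hM hN hf
  refine isIso_of_bijective f ⟨(injective_iff_map_eq_zero f.e).2 fun x hx => ?_, fun y => ?_⟩ hee
  · refine hM.eq_zero (hf.1 ?_) (hee.1 ?_)
    · rw [cokerMap_toCoker, hx, map_zero, map_zero]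
    · rw [f.ee_H, hx, H_zero, map_zero]
  -- Lift y first up to an element P(b), then lift b on the ee-level and correct.
  · obtain ⟨u, hu⟩ := hf.2 (N.toCoker y)
    obtain ⟨x, rfl⟩ := M.toCoker_surjective u
    rw [cokerMap_toCoker] at hu
    obtain ⟨b, rfl⟩ := exists_add_P_of_toCoker_eq hu.symm
    obtain ⟨a, rfl⟩ := hee.2 b
    exact ⟨x + M.P a, by rw [map_add, f.e_P]⟩

theorem cokerMap_bijective (f : M ⟶ N) [IsIso f] : Function.Bijective (cokerMap f) := by
  refine Function.bijective_iff_has_inverse.2 ⟨cokerMap (inv f), fun u => ?_, fun u => ?_⟩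
  · obtain ⟨x, rfl⟩ := M.toCoker_surjective u
    rw [cokerMap_toCoker, cokerMap_toCoker, ← comp_e, IsIso.hom_inv_id, id_e]
  · obtain ⟨x, rfl⟩ := N.toCoker_surjective u
    rw [cokerMap_toCoker, cokerMap_toCoker, ← comp_e, IsIso.inv_hom_id, id_e]

/-- The inclusion of the full subcategory preserves and reflects isomorphisms, so the statement can
be checked among all square groups. -/
theorem isIso_iff_cokerMap_bijective {M N : isSigma.{u}.FullSubcategory} (f : M ⟶ N) :
    IsIso f ↔ Function.Bijective (cokerMap f.hom) := by
  constructor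
  · intro h
    have : IsIso f.hom := inferInstanceAs (IsIso (isSigma.ι.map f))
    exact cokerMap_bijective f.hom
  · intro h
    have : IsIso (isSigma.ι.map f) := isIso_of_cokerMap_bijective f.hom M.2 N.2 h
    exact isIso_of_fully_faithful isSigma.ι f

end Sigma

/-! ### The cokernels of the products -/

section Products

variable {M N : SquareGroup.{u}}

/-- Bilinear maps on cokernels from biadditive maps which vanish on the images of `P`. -/
def cokerLift₂ {C : Type*} [AddCommGroup C] (f : M.e → N.e → C)
    (h1 : ∀ x x' y, f (x + x') y = f x y + f x' y) (h2 : ∀ x y y', f x (y + y') = f x y + f x y')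
    (h3 : ∀ a y, f (M.P a) y = 0) (h4 : ∀ x b, f x (N.P b) = 0) :
    Coker M →ₗ[ℤ] Coker N →ₗ[ℤ] C :=
  cokerLift
    (AddMonoidHom.mk' (fun x => cokerLift (AddMonoidHom.mk' (f x) (h2 x)) (h4 x))
      (fun x x' => LinearMap.ext fun v => by
        obtain ⟨y, rfl⟩ := N.toCoker_surjective v
        exact h1 x x' y))
    (fun a => LinearMap.ext fun v => by
      obtain ⟨y, rfl⟩ := N.toCoker_surjective v
      exact h3 a y)

/-! ### The cokernel and the cross-effect of M ⊚ N -/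

/-- The homomorphism `x ⊚ y ↦ x ⊗ y` to the tensor product of the cokernels. -/
noncomputable def tensorFst (M N : SquareGroup.{u}) : (tensor M N).e →+ Coker M ⊗[ℤ] Coker N :=
  CentralPairing.Ext.fstHom (CentralPairing.ofBilin (Tensor.rho M N)) |>.comp (Tensor.HExt M N)

@[simp] theorem tensorFst_tl (x : M.e) (y : N.e) :
    tensorFst M N (tl x y) = M.toCoker x ⊗ₜ N.toCoker y :=
  congrArg CentralPairing.Ext.fst (Tensor.HExt_tl x y)

@[simp] theorem tensorFst_P (t : (tensor M N).ee) : tensorFst M N ((tensor M N).P t) = 0 :=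
  Tensor.HExt_P_fst t

/-- The homomorphism from the cokernel of a tensor product to the tensor product of cokernels. -/
noncomputable def tensorCoker (M N : SquareGroup.{u}) :
    Coker (tensor M N) →ₗ[ℤ] Coker M ⊗[ℤ] Coker N := cokerLift (tensorFst M N) tensorFst_P

@[simp] theorem tensorCoker_toCoker (u : (tensor M N).e) :
    tensorCoker M N ((tensor M N).toCoker u) = tensorFst M N u := rfl

/-- The homomorphism `x ⊗ y ↦ x ⊚ y` to the cokernel of the tensor product. -/
noncomputable def tensorCokerInv (M N : SquareGroup.{u}) :
    Coker M ⊗[ℤ] Coker N →ₗ[ℤ] Coker (tensor M N) :=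
  TensorProduct.lift (cokerLift₂ (fun x y => (tensor M N).toCoker (tl x y))
    -- In each defining relation the deviation from biadditivity, or the value on an image of P, is
    -- some a ⊗̄ b, which lies in the image of P.
    (fun x x' y => by rw [add_tl, map_add, map_add, toCoker_P, add_zero])
    (fun x y y' => by rw [tl_add, map_add])
    (fun a y => by rw [P_tl, toCoker_P])
    (fun x b => by rw [tl_P, toCoker_P]))

@[simp] theorem tensorCokerInv_tmul (x : M.e) (y : N.e) :
    tensorCokerInv M N (M.toCoker x ⊗ₜ N.toCoker y) = (tensor M N).toCoker (tl x y) := rfl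

theorem tensorCoker_tensorCokerInv (t : Coker M ⊗[ℤ] Coker N) :
    tensorCoker M N (tensorCokerInv M N t) = t := by
  induction t with
  | zero => simp
  | tmul a b =>
    obtain ⟨x, rfl⟩ := M.toCoker_surjective a
    obtain ⟨y, rfl⟩ := N.toCoker_surjective b
    simp
  | add s t hs ht => rw [map_add, map_add, hs, ht]

/-- The generators a ⊗̄ b vanish in the cokernel, so the classes of the x ⊚ y generate it. -/
theorem tensorCokerInv_surjective : Function.Surjective (tensorCokerInv M N) := by
  intro u
  obtain ⟨u, rfl⟩ := (tensor M N).toCoker_surjective u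
  induction u using tl_induction with
  | htl x y => exact ⟨_, tensorCokerInv_tmul x y⟩
  | hP a b => exact ⟨0, by rw [map_zero, toCoker_P]⟩
  | hadd u v hu hv =>
    obtain ⟨s, hs⟩ := hu
    obtain ⟨t, ht⟩ := hv
    exact ⟨s + t, by rw [map_add, map_add, hs, ht]⟩

theorem tensorCokerInv_injective : Function.Injective (tensorCokerInv M N) :=
  Function.LeftInverse.injective tensorCoker_tensorCokerInv

theorem tensorCoker_bijective : Function.Bijective (tensorCoker M N) :=
  ⟨(Function.LeftInverse.rightInverse_of_surjective tensorCoker_tensorCokerInv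
    tensorCokerInv_surjective).injective, fun t => ⟨_, tensorCoker_tensorCokerInv t⟩⟩

/-- Up to the identification of the cokernels and the interchange of the two middle factors, the
cross-effect homomorphism of M ⊚ N is the tensor product of those of M and N. -/
theorem isSigma_tensor (hM : isSigma M) (hN : isSigma N) : isSigma (tensor M N) := by
  have h : ⇑(TensorProduct.lift (tensor M N).crC) =
      TensorProduct.map (TensorProduct.lift M.crC) (TensorProduct.lift N.crC) ∘
        TensorProduct.tensorTensorTensorComm ℤ (Coker M) (Coker N) (Coker M) (Coker N) ∘
          TensorProduct.map (tensorCoker M N) (tensorCoker M N) := by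
    -- `Tensor.rho` is the pairing through which the cross-effect of M ⊚ N was defined; on pure
    -- tensors both sides are (x|x')_H ⊗ (y|y')_H.
    have hr : ∀ s t : Coker M ⊗[ℤ] Coker N, Tensor.rho M N s t =
        TensorProduct.map (TensorProduct.lift M.crC) (TensorProduct.lift N.crC)
          (TensorProduct.tensorTensorTensorComm ℤ _ _ _ _ (s ⊗ₜ t)) := by
      intro s t
      induction s with
      | zero => simp
      | tmul a b =>
        induction t with
        | zero => simp
        | tmul c d => rfl
        | add s t hs ht => simp only [map_add, TensorProduct.tmul_add, hs, ht]
      | add s t hs ht =>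
        simp only [map_add, TensorProduct.add_tmul, LinearMap.add_apply, hs, ht]
    funext t
    simp only [Function.comp_apply]
    induction t with
    | zero => simp only [map_zero]; rfl
    | tmul a b =>
      obtain ⟨u, rfl⟩ := (tensor M N).toCoker_surjective a
      obtain ⟨v, rfl⟩ := (tensor M N).toCoker_surjective b
      refine (cr_eq_rho u v).trans ?_
      exact hr _ _
    | add s t hs ht =>
      refine (map_add _ s t).trans ((congrArg₂ (· + ·) hs ht).trans ?_)
      refine (((congrArg (fun w => TensorProduct.map (TensorProduct.lift M.crC)
        (TensorProduct.lift N.crC) (TensorProduct.tensorTensorTensorComm ℤ _ _ _ _ w))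
        (map_add (TensorProduct.map (tensorCoker M N) (tensorCoker M N)) s t))).trans
        ((congrArg _ (map_add (TensorProduct.tensorTensorTensorComm ℤ _ _ _ _) _ _)).trans
          (map_add _ _ _))).symm
  change Function.Bijective _
  rw [h]
  exact (map_bijective hM hN).comp ((TensorProduct.tensorTensorTensorComm ℤ (Coker M)
    (Coker N) (Coker M) (Coker N)).bijective.comp
      (map_bijective (tensorCoker_bijective (M := M) (N := N)) tensorCoker_bijective))

/-! ### The product □ and the morphism σ -/

/-- The homomorphism `x ⊗ z ↦ x ⊗ z` to the cokernel of the product `□`. -/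
noncomputable def squareCokerInv (M N : SquareGroup.{u}) :
    Coker M ⊗[ℤ] Coker N →ₗ[ℤ] Coker (square M N) :=
  TensorProduct.lift (cokerLift₂ (fun x z => (square M N).toCoker (Square.ts x z))
    (fun x x' z => by
      have h := toCoker_P (M := square M N)
        (Square.tb (M.toCoker x) (M.toCoker x') (N.H z))
      rw [Square.add_ts, ← Square.P_tb]
      refine (map_add (square M N).toCoker _ _).trans ?_
      refine (congrArg₂ (· + ·) (map_add (square M N).toCoker _ _) h).trans (add_zero _))
    (fun x z z' => by
      rw [Square.ts_add]
      exact map_add (square M N).toCoker _ _)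
    (fun a z => by
      rw [← Square.P_ta]
      exact toCoker_P (M := square M N) _)
    (fun x c => by
      rw [Square.ts_P, ← Square.P_tb]
      exact toCoker_P (M := square M N) _))

/-- The generators [x, y] ⊗ c come from P, so only the x ⊗ z survive in the cokernel. -/
theorem squareCokerInv_surjective : Function.Surjective (squareCokerInv M N) := by
  intro u
  obtain ⟨u, rfl⟩ := (square M N).toCoker_surjective u
  induction u using Square.induction with
  | hts x z => exact ⟨M.toCoker x ⊗ₜ N.toCoker z, rfl⟩
  | hbr x y c =>
    refine ⟨0, ?_⟩
    rw [map_zero, ← Square.P_tb]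
    exact (toCoker_P (M := square M N) _).symm
  | hadd u v hu hv =>
    obtain ⟨s, hs⟩ := hu
    obtain ⟨t, ht⟩ := hv
    refine ⟨s + t, ?_⟩
    rw [map_add, hs, ht]
    exact (map_add (square M N).toCoker u v).symm

theorem cokerMap_sigma_squareCokerInv (t : Coker M ⊗[ℤ] Coker N) :
    cokerMap (sigma M N) (squareCokerInv M N t) = tensorCokerInv M N t := by
  induction t with
  | zero => simp
  | tmul a b =>
    obtain ⟨x, rfl⟩ := M.toCoker_surjective a
    obtain ⟨y, rfl⟩ := N.toCoker_surjective b
    exact congrArg (tensor M N).toCoker (Square.sigmaE_ts x y)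
  | add s t hs ht => rw [map_add, map_add, map_add, hs, ht]

/-- The surjection from the tensor product of the cokernels, followed by the map induced by σ, is
the isomorphism `tensorCokerInv`; hence both factors are bijective. -/
theorem cokerMap_sigma_bijective : Function.Bijective (cokerMap (sigma M N)) := by
  constructor
  · intro u v h
    obtain ⟨s, rfl⟩ := squareCokerInv_surjective u
    obtain ⟨t, rfl⟩ := squareCokerInv_surjective v
    rw [cokerMap_sigma_squareCokerInv, cokerMap_sigma_squareCokerInv] at h
    rw [tensorCokerInv_injective h]
  · intro u
    obtain ⟨s, rfl⟩ := tensorCokerInv_surjective u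
    exact ⟨_, cokerMap_sigma_squareCokerInv s⟩

/-- Since every element of M_ee is a sum of cross-effects, the relation (x|y)_H ⊗ z ∼ y ⊗ x ⊗ Δ(z)
absorbs the first summand of (M □ N)_ee into the second, and the second is identified with M_ee ⊗
N_ee by the cross-effect isomorphism of M. -/
theorem sigmaEE_bijective (hM : isSigma M) : Function.Bijective (Square.sigmaEE M N) := by
  let i := LinearEquiv.ofBijective (TensorProduct.lift M.crC) hM
  -- The inverse decomposes the left factor into cross-effects. The interchange is there because σ
  -- sends x ⊗ y ⊗ c to (y|x)_H ⊗ c, with the arguments reversed.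
  let g : (tensor M N).ee →ₗ[ℤ] Square.EE M N := tmLift
    (Square.liftEE₂ Square.tb ∘ₗ (TensorProduct.comm ℤ (Coker M) (Coker M)).toLinearMap ∘ₗ
      i.symm.toLinearMap)
  have hg : ∀ x y c, g (tm (M.cr x y) c) = Square.tb (M.toCoker y) (M.toCoker x) c := by
    intro x y c
    have h : i.symm (M.cr x y) = M.toCoker x ⊗ₜ M.toCoker y :=
      i.symm_apply_apply (M.toCoker x ⊗ₜ M.toCoker y)
    change Square.liftEE₂ Square.tb (TensorProduct.comm ℤ _ _ (i.symm (M.cr x y))) c = _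
    rw [h]
    rfl
  constructor
  · refine Function.LeftInverse.injective (g := g) fun s => ?_
    induction s using Square.EE_induction with
    | ha a z =>
      -- For a = (x|y)_H the defining relation of the ee-level turns the value of g back into a ⊗ z.
      obtain ⟨t, rfl⟩ := hM.2 a
      rw [Square.sigmaEE_ta]
      induction t with
      | zero => simp only [map_zero, LinearMap.zero_apply]
      | tmul a b =>
        obtain ⟨x, rfl⟩ := M.toCoker_surjective a
        obtain ⟨y, rfl⟩ := M.toCoker_surjective b
        rw [TensorProduct.lift.tmul, crC_apply, hg, Square.ta_cr]
      | add s t hs ht => simp only [map_add, LinearMap.add_apply, hs, ht]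
    | hb x y c => rw [Square.sigmaEE_tb, hg]
    | hadd s t hs ht => rw [map_add, map_add, hs, ht]
  · intro t
    induction t using tm_induction with
    | htm a c =>
      obtain ⟨t, rfl⟩ := hM.2 a
      induction t with
      | zero => exact ⟨0, by simp only [map_zero, LinearMap.zero_apply]⟩
      | tmul a b =>
        obtain ⟨x, rfl⟩ := M.toCoker_surjective a
        obtain ⟨y, rfl⟩ := M.toCoker_surjective b
        exact ⟨_, Square.sigmaEE_tb y x c⟩
      | add s t hs ht =>
        obtain ⟨s', hs⟩ := hs
        obtain ⟨t', ht⟩ := ht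
        exact ⟨s' + t', by simp only [map_add, LinearMap.add_apply, hs, ht]⟩
    | hadd s t hs ht =>
      obtain ⟨s', hs⟩ := hs
      obtain ⟨t', ht⟩ := ht
      exact ⟨s' + t', by rw [map_add, hs, ht]⟩

/-- The two bijectivity statements for σ transfer the property from M ⊚ N; no separate study of the
e-level of M □ N is needed. -/
theorem isSigma_square (hM : isSigma M) (hN : isSigma N) : isSigma (square M N) :=
  isSigma_of_bijective (sigma M N) (isSigma_tensor hM hN) cokerMap_sigma_bijective
    (sigmaEE_bijective hM)

theorem isIso_sigma (hM : isSigma M) (hN : isSigma N) : IsIso (sigma M N) :=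
  isIso_of_cokerMap_bijective _ (isSigma_square hM hN) (isSigma_tensor hM hN)
    cokerMap_sigma_bijective

end Products

end SquareGroup

/-! ### Morphisms into the square groups `J A` -/

theorem tpToSym_surjective (X : Type u) [AddCommGroup X] : Function.Surjective (tpToSym X) := by
  intro s
  induction s using sym_induction with
  | hsm a b => exact ⟨tp a b, rfl⟩
  | hadd s t hs ht =>
    obtain ⟨s', rfl⟩ := hs
    obtain ⟨t', rfl⟩ := ht
    exact ⟨s' + t', map_add _ _ _⟩

/-- The quotient of X ⊗ X by the image of 1 - τ receives a symmetric bilinear map from X. The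
universal property of the symmetric square then factors the quotient map through π, which gives ker
π ⊆ im(1 - τ). -/
theorem exists_sub_tpComm_of_tpToSym_eq_zero {X : Type u} [AddCommGroup X] {t : TP X X}
    (h : tpToSym X t = 0) : ∃ s, t = s - tpComm X X s := by
  let R : AddSubgroup (TP X X) := (LinearMap.id - tpComm X X).toAddMonoidHom.range
  let q : TP X X →ₗ[ℤ] TP X X ⧸ R := (QuotientAddGroup.mk' R).toIntLinearMap
  have hq : ∀ a b, q (tp a b) = q (tp b a) := fun a b => by
    rw [← sub_eq_zero, ← map_sub]
    exact (QuotientAddGroup.eq_zero_iff _).2 ⟨tp a b, rfl⟩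
  let B : X →ₗ[ℤ] X →ₗ[ℤ] TP X X ⧸ R := mkBilin (fun a b => q (tp a b))
    (fun a a' b => by rw [map_add, LinearMap.add_apply, map_add])
    (fun a b b' => by rw [map_add, map_add])
  -- Both homomorphisms send a ⊗ b to its class in the quotient.
  have e : (symLift B hq).comp (tpToSym X) = q := tp_ext fun a b => symLift_sm B hq a b
  have h0 : q t = 0 := by rw [← e, LinearMap.comp_apply, h, map_zero]
  obtain ⟨s, hs⟩ := (QuotientAddGroup.eq_zero_iff (N := R) t).1 h0
  exact ⟨s, hs.symm⟩

namespace Cos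

open SquareGroup

section Morphisms

variable {M : SquareGroup.{u}} {A B C : Cos.{u}}

/-- The first projection `(a, x) ↦ a`. -/
noncomputable def JFst (A : Cos.{u}) : (JObj A).e →+ A.carrier where
  toFun p := (show JE A from p).1.fst
  map_zero' := rfl
  map_add' _ _ := rfl

theorem J_ext {p q : (JObj A).e} (h : JFst A p = JFst A q) (h' : (JObj A).H p = (JObj A).H q) :
    p = q := Subtype.ext (CentralPairing.Ext.ext h h')

theorem JFst_P (t : (JObj A).ee) : JFst A ((JObj A).P t) = 0 := rfl

theorem H_JP (t : TP A.carrier A.carrier) :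
    (JObj A).H ((JObj A).P t) = t - tpComm A.carrier A.carrier t := rfl

theorem T_J (t : TP A.carrier A.carrier) : (JObj A).T t = -tpComm A.carrier A.carrier t := by
  refine (T_apply (M := JObj A) t).trans ?_
  rw [H_JP]
  exact sub_sub_cancel_left t _

theorem cr_J (p q : (JObj A).e) : (JObj A).cr p q = tp (JFst A p) (JFst A q) := JE_cross _ _

theorem tpToSym_H (p : (JObj A).e) : tpToSym A.carrier ((JObj A).H p) = A.δ (JFst A p) :=
  (show JE A from p).2

theorem exists_J {a : A.carrier} {t : TP A.carrier A.carrier} (h : tpToSym A.carrier t = A.δ a) :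
    ∃ p : (JObj A).e, JFst A p = a ∧ (JObj A).H p = t :=
  ⟨(⟨⟨a, t⟩, h⟩ : JE A), rfl, rfl⟩

theorem JFst_surjective : Function.Surjective (JFst A) := by
  intro a
  obtain ⟨t, ht⟩ := tpToSym_surjective _ (A.δ a)
  obtain ⟨p, hp, -⟩ := exists_J ht
  exact ⟨p, hp⟩

/-- The isomorphism between the cokernel of `P` for `J A` and the underlying group of `A`. -/
noncomputable def JCoker (A : Cos.{u}) : Coker (JObj A) →ₗ[ℤ] A.carrier :=
  cokerLift (JFst A) JFst_P

@[simp] theorem JCoker_toCoker (p : (JObj A).e) : JCoker A ((JObj A).toCoker p) = JFst A p := rfl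

/-- A pair (0, x) has π(x) = δ(0) = 0, so x = s - τ(s) and the pair is P(s). Every a occurs as a
first coordinate because π is surjective. -/
theorem JCoker_bijective : Function.Bijective (JCoker A) := by
  constructor
  · refine (injective_iff_map_eq_zero _).2 fun u hu => ?_
    obtain ⟨p, rfl⟩ := (JObj A).toCoker_surjective u
    rw [JCoker_toCoker] at hu
    obtain ⟨s, hs⟩ := exists_sub_tpComm_of_tpToSym_eq_zero
      (t := (JObj A).H p) (by rw [tpToSym_H, hu, δ_zero])
    have e : p = (JObj A).P s := J_ext (hu.trans (JFst_P s).symm) (hs.trans (H_JP s).symm)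
    rw [e]
    exact toCoker_P (M := JObj A) s
  · intro a
    obtain ⟨p, rfl⟩ := JFst_surjective a
    exact ⟨(JObj A).toCoker p, rfl⟩

/-- The cross-effect of (a, x) and (b, y) is a ⊗ b, so after identifying the cokernel with A the
cross-effect homomorphism is the identity of A ⊗ A. -/
theorem isSigma_JObj (A : Cos.{u}) : isSigma (JObj A) := by
  have h : ⇑(TensorProduct.lift (JObj A).crC) = TensorProduct.map (JCoker A) (JCoker A) := by
    funext t
    induction t with
    | zero => simp only [map_zero]; rfl
    | tmul a b =>
      obtain ⟨p, rfl⟩ := (JObj A).toCoker_surjective a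
      obtain ⟨q, rfl⟩ := (JObj A).toCoker_surjective b
      exact cr_J p q
    | add s t hs ht =>
      refine (map_add _ s t).trans ((congrArg₂ (· + ·) hs ht).trans ?_)
      exact (map_add (TensorProduct.map (JCoker A) (JCoker A)) s t).symm
  change Function.Bijective _
  rw [h]
  exact map_bijective JCoker_bijective JCoker_bijective

/-- Morphisms to `J A` from homomorphisms on both levels. -/
noncomputable def homToJ {S : Set M.e} (hS : IsGen S) (g : M.e →+ A.carrier)
    (φ : M.ee →ₗ[ℤ] TP A.carrier A.carrier) (hP : ∀ a, g (M.P a) = 0)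
    (hT : ∀ a, φ (M.T a) = -tpComm _ _ (φ a))
    (hcr : ∀ x ∈ S, ∀ y ∈ S, φ (M.cr x y) = tp (g x) (g y))
    (hδ : ∀ x ∈ S, tpToSym A.carrier (φ (M.H x)) = A.δ (g x)) : M ⟶ JObj A :=
  -- Both sides are biadditive and vanish on images of P, so agreement on generators is enough.
  have hcr' : ∀ x y, φ (M.cr x y) = tp (g x) (g y) := fun x y => by
    induction x using hS.induction with
    | h x hx =>
      induction y using hS.induction with
      | h y hy => exact hcr x hx y hy
      | hP a => rw [cr_P_right, hP, map_zero, map_zero]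
      | hadd y y' h h' => rw [cr_add_right, map_add, map_add, map_add, h, h']
    | hP a => rw [cr_P_left, hP, map_zero, map_zero, LinearMap.zero_apply]
    | hadd x x' h h' => rw [cr_add_left, map_add, map_add, map_add, h, h', LinearMap.add_apply]
  have hHP : ∀ a, φ (M.H (M.P a)) = φ a - tpComm _ _ (φ a) := fun a => by
    rw [H_P, map_add, hT, sub_eq_add_neg]
  -- Both sides deviate from additivity by the same product g(x)g(y), and on P(a) the left side is
  -- π(φ(a) - τ(φ(a))) = 0. This is the condition for (g(x), φ(H(x))) to lie in J A.
  have hδ' : ∀ x, tpToSym A.carrier (φ (M.H x)) = A.δ (g x) := fun x => by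
    induction x using hS.induction with
    | h x hx => exact hδ x hx
    | hP a => rw [hHP, map_sub, tpToSym_comm, sub_self, hP, δ_zero]
    | hadd x x' h h' =>
      rw [H_add, map_add, map_add, map_add, map_add, map_add, hcr', A.δ_add, h, h', tpToSym_tp]
  SquareGroup.Hom.mk (M := M) (N := JObj A)
    (AddMonoidHom.mk' (fun x => (⟨⟨g x, φ (M.H x)⟩, hδ' x⟩ : JE A))
      (fun x y => J_ext (map_add g x y)
        ((by rw [H_add, map_add, map_add, hcr'] :
          φ (M.H (x + y)) = φ (M.H x) + φ (M.H y) + tp (g x) (g y)))))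
    φ (fun a => J_ext (hP a) (hHP a)) (fun _ => rfl)

/-- Morphisms to `J A` are determined by their first components on generators. -/
theorem homToJ_ext (hM : isSigma M) {S : Set M.e} (hS : IsGen S) {f f' : M ⟶ JObj A}
    (h : ∀ x ∈ S, JFst A (f.e x) = JFst A (f'.e x)) : f = f' := by
  have h' : ∀ x, JFst A (f.e x) = JFst A (f'.e x) := by
    intro x
    induction x using hS.induction with
    | h x hx => exact h x hx
    | hP a => rw [f.e_P, f'.e_P, JFst_P, JFst_P]
    | hadd x y hx hy => rw [map_add, map_add, map_add, map_add, hx, hy]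
  -- Every element of M_ee is a sum of cross-effects, and a cross-effect in J A sees only first
  -- coordinates.
  have hee : f.ee = f'.ee := by
    refine LinearMap.ext fun a => ?_
    obtain ⟨t, rfl⟩ := hM.2 a
    induction t with
    | zero => rw [map_zero, map_zero, map_zero]
    | tmul a b =>
      obtain ⟨x, rfl⟩ := M.toCoker_surjective a
      obtain ⟨y, rfl⟩ := M.toCoker_surjective b
      rw [TensorProduct.lift.tmul, crC_apply, ee_cr, ee_cr, cr_J, cr_J, h', h']
    | add s t hs ht => rw [map_add, map_add, map_add, hs, ht]
  -- The second coordinate in J A is H, so it is governed by the ee-level, where the morphisms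
  -- already agree.
  refine SquareGroup.hom_ext (fun x => J_ext (h' x) ?_) hee
  rw [← f.ee_H, ← f'.ee_H, hee]

@[simp] theorem JFst_map (g : A ⟶ B) (p : (JObj A).e) :
    JFst B ((J.map g).e p) = g.f (JFst A p) := rfl

end Morphisms

/-! ### The equivalence of categories -/

section Equivalence

/-- Homomorphisms on underlying groups which are first components of morphisms of square groups. -/
theorem exists_map_eq {A B : Cos.{u}} (f : JObj A ⟶ JObj B) : ∃ g : A ⟶ B, J.map g = f := by
  let i := LinearEquiv.ofBijective (JCoker A) JCoker_bijective
  -- The only candidate: the map induced by f on the cokernels of P.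
  let g : A.carrier →ₗ[ℤ] B.carrier := JCoker B ∘ₗ cokerMap f ∘ₗ i.symm.toLinearMap
  have hg : ∀ p, g (JFst A p) = JFst B (f.e p) := fun p =>
    congrArg (fun u => JCoker B (cokerMap f u)) (i.symm_apply_apply ((JObj A).toCoker p))
  -- A pure tensor a ⊗ b is the cross-effect of any two elements lying over a and b.
  have hee : f.ee = tpMap g g := tp_ext (A := A.carrier) (B := A.carrier) fun a b => by
    obtain ⟨p, rfl⟩ := JFst_surjective a
    obtain ⟨q, rfl⟩ := JFst_surjective b
    refine (congrArg f.ee (cr_J p q).symm).trans ((ee_cr f p q).trans ((cr_J _ _).trans ?_))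
    exact ((tpMap_tp g g _ _).trans (by rw [hg, hg])).symm
  refine ⟨⟨g, fun a => ?_⟩, homToJ_ext (isSigma_JObj A) isGen_univ fun p _ => hg p⟩
  obtain ⟨p, rfl⟩ := JFst_surjective a
  -- With δ written as π H on both sides, compatibility with δ becomes compatibility of f with H.
  rw [hg, ← tpToSym_H, ← tpToSym_H, ← f.ee_H, hee]
  exact (tpToSym_map g _).symm

instance : J.{u}.Full := ⟨fun f => exists_map_eq f⟩

instance : J.{u}.Faithful where
  map_injective {A B} g h e := hom_ext (LinearMap.ext fun a => by
    obtain ⟨p, rfl⟩ := JFst_surjective a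
    rw [← JFst_map, ← JFst_map, e])

variable {M : SquareGroup.{u}} (hM : isSigma M)

/-! ### The cosymmetry on the cokernel and essential surjectivity -/

/-- The inverse of the cross-effect isomorphism. -/
noncomputable def crInv : M.ee →ₗ[ℤ] TP (Coker M) (Coker M) :=
  AddMonoidHom.toIntLinearMap
    (LinearEquiv.ofBijective (TensorProduct.lift M.crC) hM).symm.toLinearMap.toAddMonoidHom

theorem crInv_cr (x y : M.e) : crInv hM (M.cr x y) = tp (M.toCoker x) (M.toCoker y) :=
  (LinearEquiv.ofBijective (TensorProduct.lift M.crC) hM).symm_apply_apply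
    (M.toCoker x ⊗ₜ M.toCoker y)

theorem crInv_T (a : M.ee) : crInv hM (M.T a) = -tpComm _ _ (crInv hM a) := by
  obtain ⟨t, rfl⟩ := hM.2 a
  induction t with
  | zero => simp only [map_zero, neg_zero]
  | tmul a b =>
    obtain ⟨x, rfl⟩ := M.toCoker_surjective a
    obtain ⟨y, rfl⟩ := M.toCoker_surjective b
    rw [TensorProduct.lift.tmul, crC_apply, T_cr, map_neg, crInv_cr, crInv_cr, tpComm_tp]
  | add s t hs ht => simp only [map_add, hs, ht, neg_add]

/-- The cosymmetry on the cokernel of `P`. -/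
noncomputable def cokerδ (u : Coker M) : SymSq (Coker M) :=
  tpToSym _ (crInv hM (M.H (Function.surjInv M.toCoker_surjective u)))

/-- Independence of the chosen representative: adding P(a) changes H by a + T(a), which corresponds
to s - τ(s) in the tensor square of the cokernel and vanishes in the symmetric square. -/
theorem cokerδ_toCoker (x : M.e) : cokerδ hM (M.toCoker x) = tpToSym _ (crInv hM (M.H x)) := by
  obtain ⟨a, ha⟩ := exists_add_P_of_toCoker_eq
    (Function.surjInv_eq M.toCoker_surjective (M.toCoker x))
  rw [cokerδ, ha, H_add, cr_P_right, add_zero, H_P, map_add, map_add, map_add, map_add, crInv_T,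
    map_neg, tpToSym_comm, add_neg_cancel, add_zero]

/-- The abelian group with cosymmetry associated with a square group. -/
noncomputable def ofSigma : Cos.{u} where
  carrier := Coker M
  δ := cokerδ hM
  δ_add u v := by
    obtain ⟨x, rfl⟩ := M.toCoker_surjective u
    obtain ⟨y, rfl⟩ := M.toCoker_surjective v
    rw [← map_add, cokerδ_toCoker, cokerδ_toCoker, cokerδ_toCoker, H_add, map_add, map_add,
      crInv_cr, map_add, map_add, tpToSym_tp]

/-- The comparison morphism `x ↦ (x, H x)`. -/
noncomputable def toJOfSigma : M ⟶ JObj (ofSigma hM) :=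
  homToJ (A := ofSigma hM) isGen_univ M.toCoker (crInv hM) toCoker_P (crInv_T hM)
    (fun x _ y _ => crInv_cr hM x y) (fun x _ => (cokerδ_toCoker hM x).symm)

/-- The comparison morphism induces the identity on cokernels, so the criterion of (ii) applies. -/
theorem isIso_toJOfSigma : IsIso (toJOfSigma hM) := by
  refine isIso_of_cokerMap_bijective _ hM (isSigma_JObj _)
    ((Function.Bijective.of_comp_iff' (JCoker_bijective (A := ofSigma hM)) _).1 ?_)
  have h : JCoker (ofSigma hM) ∘ cokerMap (toJOfSigma hM) = id := by
    funext u
    obtain ⟨x, rfl⟩ := M.toCoker_surjective u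
    rfl
  rw [h]
  exact Function.bijective_id

theorem isSigma_J (A : Cos.{u}) : isSigma (J.obj A) := isSigma_JObj A

theorem isEquivalence_lift : (isSigma.lift J.{u} isSigma_J).IsEquivalence where
  faithful := inferInstance
  full := inferInstance
  essSurj := ⟨fun M => by
    have := isIso_toJOfSigma M.2
    exact ⟨ofSigma M.2, ⟨isSigma.isoMk (asIso (toJOfSigma M.2)).symm⟩⟩⟩

end Equivalence

end Cos

/-! ### The monoidal structure -/

/-! ### Interchange of the middle factors and symmetric squares -/

section Shuffle

variable {A B : Type u} [AddCommGroup A] [AddCommGroup B]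

/-- The homomorphism `(a ⊗ a') ⊗ (b ⊗ b') ↦ (a ⊗ b) ⊗ (a' ⊗ b')`. -/
noncomputable def tpShuffle : TP A A →ₗ[ℤ] TP B B →ₗ[ℤ] TP (TP A B) (TP A B) :=
  tpLift (mkBilin (fun a a' => tpMap (tp a) (tp a'))
    (fun a₁ a₂ a' => tp_ext fun b b' => by simp)
    (fun a a₁ a₂ => tp_ext fun b b' => by simp))

@[simp] theorem tpShuffle_tp (a a' : A) (b b' : B) :
    tpShuffle (tp a a') (tp b b') = tp (tp a b) (tp a' b') := rfl

theorem tpShuffle_tpComm (s : TP A A) (t : TP B B) :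
    tpShuffle (tpComm A A s) (tpComm B B t) = tpComm _ _ (tpShuffle s t) := by
  induction s using tp_induction with
  | htp a a' =>
    induction t using tp_induction with
    | htp b b' => rfl
    | hadd s t hs ht => simp only [map_add, hs, ht]
  | hadd s t hs ht => simp only [map_add, LinearMap.add_apply, hs, ht]

/-- Together with the next two lemmas this realises the three products * on symmetric squares as
images of tensors, one for each term in the cosymmetry of a tensor product. -/
theorem tpToSym_tpShuffle_left (a : A) (t : TP B B) :
    tpToSym _ (tpShuffle (tp a a) t) = mulL a (tpToSym B t) := by
  induction t using tp_induction with
  | htp b b' => exact (mulL_sm a b b').symm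
  | hadd s t hs ht => simp only [map_add, hs, ht]

theorem tpToSym_tpShuffle_right (s : TP A A) (b : B) :
    tpToSym _ (tpShuffle s (tp b b)) = mulR b (tpToSym A s) := by
  induction s using tp_induction with
  | htp a a' => exact (mulR_sm a a' b).symm
  | hadd s t hs ht => simp only [map_add, LinearMap.add_apply, hs, ht]

/-- Adding the interchange of t produces the second of the two summands in (aa') * (bb'), up to
commutativity of the symmetric square. -/
theorem tpToSym_tpShuffle (s : TP A A) (t : TP B B) :
    tpToSym _ (tpShuffle s (t + tpComm B B t)) = mulS (tpToSym A s) (tpToSym B t) := by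
  induction s using tp_induction with
  | htp a a' =>
    induction t using tp_induction with
    | htp b b' =>
      rw [map_add, tpComm_tp, tpShuffle_tp, tpShuffle_tp, map_add, tpToSym_tp, tpToSym_tp,
        tpToSym_tp, tpToSym_tp, mulS_sm, sm_comm (tp a b')]
    | hadd s t hs ht =>
      rw [map_add (tpComm B B), add_add_add_comm, map_add, map_add, hs, ht, map_add, map_add]
  | hadd s t hs ht => simp only [map_add, LinearMap.add_apply] at hs ht ⊢; rw [← hs, ← ht]; abel

end Shuffle

namespace Cos

open SquareGroup (tl tm Znil zn znn zval tensorFst isGen_tensor isGen_univ tm_induction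
  isSigma isSigma_tensor Coker cokerMap tensorCoker tensorCoker_bijective)

variable {A B : Cos.{u}}

/-! ### The comparison of J A ⊚ J B with J(A ⊗ B) -/

/-- The homomorphism `(a, x) ⊚ (b, y) ↦ a ⊗ b`. -/
noncomputable def muFst (A B : Cos.{u}) :
    (SquareGroup.tensor (JObj A) (JObj B)).e →+ TP A.carrier B.carrier :=
  (TensorProduct.map (JCoker A) (JCoker B)).toAddMonoidHom.comp (tensorFst (JObj A) (JObj B))

theorem muFst_tl (p : (JObj A).e) (q : (JObj B).e) :
    muFst A B (tl p q) = tp (JFst A p) (JFst B q) :=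
  congrArg (TensorProduct.map (JCoker A) (JCoker B)) (SquareGroup.tensorFst_tl p q)

theorem muFst_P (t : (SquareGroup.tensor (JObj A) (JObj B)).ee) :
    muFst A B ((SquareGroup.tensor (JObj A) (JObj B)).P t) = 0 :=
  (congrArg (TensorProduct.map (JCoker A) (JCoker B)) (SquareGroup.tensorFst_P t)).trans
    (map_zero _)

/-- The homomorphism `(a ⊗ a') ⊗ (b ⊗ b') ↦ (a ⊗ b) ⊗ (a' ⊗ b')`. -/
noncomputable def muEE (A B : Cos.{u}) : (SquareGroup.tensor (JObj A) (JObj B)).ee →ₗ[ℤ]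
    TP (TP A.carrier B.carrier) (TP A.carrier B.carrier) :=
  SquareGroup.tmLift (M := JObj A) (N := JObj B) (tpShuffle (A := A.carrier) (B := B.carrier))

/-- On the product, T acts as -(T ⊗ T), and on each J it is minus the interchange. The two inner
signs cancel, and interchanging both pairs corresponds after the shuffle to interchanging the two
copies of A ⊗ B. -/
theorem muEE_T (t : (SquareGroup.tensor (JObj A) (JObj B)).ee) :
    muEE A B ((SquareGroup.tensor (JObj A) (JObj B)).T t) = -tpComm _ _ (muEE A B t) := by
  induction t using tm_induction with
  | htm a b =>
    rw [SquareGroup.T_tm, map_neg]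
    refine congrArg Neg.neg ?_
    refine (congrArg₂ (fun s t => tpShuffle (A := A.carrier) (B := B.carrier) s t)
      (T_J a) (T_J b)).trans ?_
    rw [map_neg, map_neg, LinearMap.neg_apply, neg_neg]
    exact tpShuffle_tpComm (A := A.carrier) (B := B.carrier) a b
  | hadd s t hs ht => simp only [map_add, hs, ht, neg_add]

/-- The factor b ⊗ b - t - τ(t) is the value of Δ on (b, t). Expanding it gives the terms a * δ(b),
δ(a) * b and -δ(a) * δ(b) in turn. -/
theorem tpToSym_tensorδ {a : A.carrier} {b : B.carrier} {s : TP A.carrier A.carrier}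
    {t : TP B.carrier B.carrier} (hs : tpToSym _ s = A.δ a) (ht : tpToSym _ t = B.δ b) :
    tpToSym _ (tpShuffle (tp a a) t + tpShuffle s (tp b b - t + -tpComm _ _ t)) =
      tensorδ A B (tp a b) := by
  rw [sub_add_eq_add_sub, ← sub_eq_add_neg, sub_right_comm, sub_sub, map_add, map_sub, map_sub,
    tpToSym_tpShuffle_left, tpToSym_tpShuffle_right, tpToSym_tpShuffle, hs, ht, tensorδ_tp,
    add_sub_assoc]

/-- The membership condition for the image of p ⊚ q in J of the tensor product: the formula for H on
p ⊚ q matches the cosymmetry defined on A ⊗ B. -/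
theorem tpToSym_muEE_H (p : (JObj A).e) (q : (JObj B).e) :
    tpToSym _ (muEE A B ((SquareGroup.tensor (JObj A) (JObj B)).H (tl p q))) =
      tensorδ A B (tp (JFst A p) (JFst B q)) := by
  rw [SquareGroup.H_tl, SquareGroup.Δe_eq]
  refine Eq.trans ?_ (tpToSym_tensorδ (tpToSym_H p) (tpToSym_H q))
  exact congrArg₂ (fun u v => tpToSym _ (tpShuffle (A := A.carrier) (B := B.carrier) u
    ((JObj B).H q) + tpShuffle (A := A.carrier) (B := B.carrier) ((JObj A).H p) v)) (cr_J p p)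
    (congrArg₂ (fun u v : TP B.carrier B.carrier =>
      u - (show TP B.carrier B.carrier from (JObj B).H q) + v) (cr_J q q) (T_J _))

/-- The comparison morphism `J A ⊚ J B ⟶ J (A ⊗ B)`. -/
noncomputable def muHom (A B : Cos.{u}) :
    SquareGroup.tensor (JObj A) (JObj B) ⟶ JObj (tensor A B) :=
  homToJ (A := tensor A B) (isGen_tensor isGen_univ isGen_univ) (muFst A B) (muEE A B) muFst_P
    muEE_T
    (by
      -- The cross-effect is (a ⊗ a') ⊗ (b ⊗ b'), and the shuffle carries it to (a ⊗ b) ⊗ (a' ⊗ b').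
      rintro _ ⟨p, -, q, -, rfl⟩ _ ⟨p', -, q', -, rfl⟩
      rw [SquareGroup.cr_tl]
      refine Eq.trans ?_ (congrArg₂ (fun s t => tp s t) (muFst_tl p q) (muFst_tl p' q')).symm
      exact congrArg₂ (fun s t => tpShuffle (A := A.carrier) (B := B.carrier) s t)
        (cr_J p p') (cr_J q q'))
    (by
      rintro _ ⟨p, -, q, -, rfl⟩
      exact (tpToSym_muEE_H p q).trans (congrArg (tensorδ A B) (muFst_tl p q)).symm)

theorem JFst_muHom_tl (p : (JObj A).e) (q : (JObj B).e) :
    JFst (tensor A B) ((muHom A B).e (tl p q)) = tp (JFst A p) (JFst B q) := muFst_tl p q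

theorem isSigma_tensor_J (A B : Cos.{u}) : isSigma (SquareGroup.tensor (JObj A) (JObj B)) :=
  isSigma_tensor (isSigma_JObj A) (isSigma_JObj B)

/-- Source and target lie in SG_Σ, and on cokernels the morphism is the known isomorphism of the
cokernel of the product with the tensor product of the cokernels, followed by the identifications
with A and B. -/
instance isIso_muHom (A B : Cos.{u}) : IsIso (muHom A B) := by
  refine SquareGroup.isIso_of_cokerMap_bijective _ (isSigma_tensor_J A B) (isSigma_JObj _)
    ((Function.Bijective.of_comp_iff' (JCoker_bijective (A := tensor A B)) _).1 ?_)
  have h : JCoker (tensor A B) ∘ cokerMap (muHom A B) =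
      TensorProduct.map (JCoker A) (JCoker B) ∘ tensorCoker (JObj A) (JObj B) := by
    funext u
    obtain ⟨x, rfl⟩ := (SquareGroup.tensor (JObj A) (JObj B)).toCoker_surjective u
    rfl
  rw [h]
  exact (SquareGroup.map_bijective JCoker_bijective JCoker_bijective).comp tensorCoker_bijective

/-! ### The unit -/

theorem toCoker_Znil_injective : Function.Injective Znil.{u}.toCoker := by
  refine (injective_iff_map_eq_zero _).2 fun x hx => ?_
  obtain ⟨a, rfl⟩ := SquareGroup.exists_P_of_toCoker_eq_zero hx
  rfl

/-- As P = 0, the cokernel is ℤ, and the cross-effect of the binomial coefficient is multiplication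
ℤ ⊗ ℤ → ℤ, with inverse n ↦ 1 ⊗ n. -/
theorem isSigma_Znil : isSigma Znil.{u} := by
  let g : Znil.{u}.ee →ₗ[ℤ] Coker Znil.{u} ⊗[ℤ] Coker Znil.{u} :=
    TensorProduct.mk ℤ _ _ (Znil.toCoker (zn 1)) ∘ₗ
      AddMonoidHom.toIntLinearMap (AddMonoidHom.mk' (fun a => Znil.toCoker (zn (zval a)))
        (fun a b => by rw [map_add, SquareGroup.zn_add, map_add]))
  have hg : ∀ a, g a = Znil.toCoker (zn 1) ⊗ₜ Znil.toCoker (zn (zval a)) := fun _ => rfl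
  constructor
  · refine Function.LeftInverse.injective (g := g) fun t => ?_
    induction t with
    | zero => simp only [map_zero]
    | tmul a b =>
      obtain ⟨x, rfl⟩ := Znil.toCoker_surjective a
      obtain ⟨y, rfl⟩ := Znil.toCoker_surjective b
      obtain ⟨m, rfl⟩ := SquareGroup.zn_surj x
      obtain ⟨n, rfl⟩ := SquareGroup.zn_surj y
      have h : ∀ m n : ℤ, zn.{u} (m * n) = m • zn n := fun m n =>
        congrArg ULift.up (smul_eq_mul m n).symm
      rw [TensorProduct.lift.tmul, SquareGroup.crC_apply, SquareGroup.cr_zn, hg,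
        SquareGroup.zval_znn, h, map_zsmul, TensorProduct.tmul_smul, TensorProduct.smul_tmul',
        ← map_zsmul, ← h, mul_one]
    | add s t hs ht => simp only [map_add, hs, ht]
  · intro a
    obtain ⟨n, rfl⟩ := SquareGroup.znn_surj a
    refine ⟨Znil.toCoker (zn 1) ⊗ₜ Znil.toCoker (zn n), ?_⟩
    rw [TensorProduct.lift.tmul, SquareGroup.crC_apply, SquareGroup.cr_zn, one_mul]

/-- The isomorphism between the `e`-level of `ℤ_nil` and the unit. -/
def epsFst : Znil.{u}.e →+ ULift.{u} ℤ := AddMonoidHom.id (ULift.{u} ℤ)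

theorem epsFst_zn (n : ℤ) : epsFst.{u} (zn n) = ⟨n⟩ := rfl

/-- The homomorphism `n ↦ n (1 ⊗ 1)`. -/
noncomputable def epsEE : Znil.{u}.ee →ₗ[ℤ] TP (ULift.{u} ℤ) (ULift.{u} ℤ) :=
  (LinearMap.toSpanSingleton ℤ _ (tp (⟨1⟩ : ULift.{u} ℤ) ⟨1⟩)).comp zval

theorem epsEE_znn (n : ℤ) : epsEE.{u} (znn n) = n • tp (⟨1⟩ : ULift.{u} ℤ) ⟨1⟩ := rfl

theorem epsEE_T (a : Znil.{u}.ee) : epsEE (Znil.T a) = -tpComm _ _ (epsEE a) := by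
  obtain ⟨n, rfl⟩ := SquareGroup.znn_surj a
  rw [SquareGroup.T_znn, map_neg, epsEE_znn, map_zsmul, tpComm_tp]

/-- This is mn(1 ⊗ 1) = m ⊗ n. -/
theorem epsEE_cr (x y : Znil.{u}.e) : epsEE (Znil.cr x y) = tp (epsFst x) (epsFst y) := by
  obtain ⟨m, rfl⟩ := SquareGroup.zn_surj x
  obtain ⟨n, rfl⟩ := SquareGroup.zn_surj y
  have e : ∀ k : ℤ, (⟨k⟩ : ULift.{u} ℤ) = k • (⟨1⟩ : ULift.{u} ℤ) := fun k => by
    ext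
    simp
  rw [SquareGroup.cr_zn, epsEE_znn, epsFst_zn, epsFst_zn, mul_zsmul, e m, e n, map_zsmul,
    map_zsmul, LinearMap.smul_apply, zsmul_comm]

theorem tpToSym_epsEE_H (x : Znil.{u}.e) :
    tpToSym _ (epsEE (Znil.H x)) = unit.δ (epsFst x) := by
  obtain ⟨n, rfl⟩ := SquareGroup.zn_surj x
  rw [SquareGroup.H_zn, epsEE_znn, map_zsmul, tpToSym_tp]
  rfl

/-- The comparison morphism from `ℤ_nil` to `J` of the unit. -/
noncomputable def epsHom : Znil.{u} ⟶ JObj unit :=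
  homToJ (A := unit) isGen_univ epsFst epsEE (fun _ => rfl) epsEE_T (fun x _ y _ => epsEE_cr x y)
    (fun x _ => tpToSym_epsEE_H x)

/-- The map on cokernels becomes the identity of ℤ once the two bijections identifying the cokernels
with ℤ are composed with it. -/
instance isIso_epsHom : IsIso epsHom.{u} := by
  refine SquareGroup.isIso_of_cokerMap_bijective _ isSigma_Znil (isSigma_JObj _)
    ((Function.Bijective.of_comp_iff' (JCoker_bijective (A := unit)) _).1
      ((Function.Bijective.of_comp_iff _ ⟨toCoker_Znil_injective,
        Znil.toCoker_surjective⟩).1 ?_))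
  exact Function.bijective_id

/-! ### Coherence of the comparison isomorphisms -/

/-- The monoidal structure on `J`. -/
noncomputable def JCoreMonoidal : J.{u}.CoreMonoidal where
  εIso := @asIso _ _ _ _ epsHom isIso_epsHom
  μIso A B := @asIso _ _ _ _ (muHom A B) (isIso_muHom A B)
  μIso_hom_natural_left {A B} g C := by
    -- The source is in SG_Σ, so it suffices to compare first coordinates on p ⊚ q; both composites
    -- give g(a) ⊗ c there.
    refine homToJ_ext (A := tensor B C) (isSigma_tensor_J A C)
      (isGen_tensor isGen_univ isGen_univ) ?_
    rintro _ ⟨p, -, q, -, rfl⟩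
    exact (congrArg (fun u => JFst (tensor B C) ((muHom B C).e u))
      (SquareGroup.tensorMap_tl (J.map g) (𝟙 (JObj C)) p q)).trans
      ((JFst_muHom_tl _ _).trans (congrArg (tensorMap g (𝟙 C)).f (JFst_muHom_tl p q)).symm)
  μIso_hom_natural_right {A B} C g := by
    refine homToJ_ext (A := tensor C B) (isSigma_tensor_J C A)
      (isGen_tensor isGen_univ isGen_univ) ?_
    rintro _ ⟨p, -, q, -, rfl⟩
    exact (congrArg (fun u => JFst (tensor C B) ((muHom C B).e u))
      (SquareGroup.tensorMap_tl (𝟙 (JObj C)) (J.map g) p q)).trans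
      ((JFst_muHom_tl _ _).trans (congrArg (tensorMap (𝟙 C) g).f (JFst_muHom_tl p q)).symm)
  associativity A B C := by
    refine homToJ_ext (A := tensor A (tensor B C))
      (isSigma_tensor (isSigma_tensor_J A B) (isSigma_JObj C))
      (isGen_tensor (isGen_tensor isGen_univ isGen_univ) isGen_univ) ?_
    rintro _ ⟨_, ⟨p, -, q, -, rfl⟩, r, -, rfl⟩
    -- In first coordinates the two routes give (a ⊗ b) ⊗ c and a ⊗ (b ⊗ c), which the associativity
    -- of the tensor product of abelian groups relates.
    have h₁ : JFst (tensor (tensor A B) C) ((muHom (tensor A B) C).e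
        ((SquareGroup.tensorMap (muHom A B) (𝟙 (JObj C))).e (tl (tl p q) r))) =
          tp (A := TP A.carrier B.carrier) (tp (JFst A p) (JFst B q)) (JFst C r) := by
      rw [SquareGroup.tensorMap_tl]
      refine (JFst_muHom_tl _ _).trans ?_
      exact congrArg (fun t => tp (A := TP A.carrier B.carrier) t (JFst C r)) (JFst_muHom_tl p q)
    have h₂ : JFst (tensor A (tensor B C)) ((muHom A (tensor B C)).e
        ((SquareGroup.tensorMap (𝟙 (JObj A)) (muHom B C)).e
          ((SquareGroup.assocIso _ _ _).hom.e (tl (tl p q) r)))) =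
          tp (B := TP B.carrier C.carrier) (JFst A p) (tp (JFst B q) (JFst C r)) := by
      rw [SquareGroup.assocIso_hom_tl, SquareGroup.tensorMap_tl]
      refine (JFst_muHom_tl _ _).trans ?_
      exact congrArg (fun t => tp (B := TP B.carrier C.carrier) (JFst A p) t) (JFst_muHom_tl q r)
    exact (congrArg (assocIso A B C).hom.f h₁).trans h₂.symm
  left_unitality A := by
    refine homToJ_ext (isSigma_tensor isSigma_Znil (isSigma_JObj A))
      (isGen_tensor isGen_univ isGen_univ) ?_
    rintro _ ⟨n, -, p, -, rfl⟩
    obtain ⟨n, rfl⟩ := SquareGroup.zn_surj n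
    -- The binomial correction in the left unit isomorphism lies in the image of P, so only n times
    -- the first coordinate remains.
    have h₁ : JFst A ((SquareGroup.leftUnitIso (JObj A)).hom.e (tl (zn n) p)) = n • JFst A p := by
      rw [SquareGroup.leftUnitIso_hom_tl, SquareGroup.zact, map_add, map_zsmul, JFst_P, add_zero]
    have h₂ : JFst (tensor unit A) ((muHom unit A).e
        ((SquareGroup.tensorMap epsHom (𝟙 (JObj A))).e (tl (zn n) p))) =
          tp (⟨n⟩ : ULift.{u} ℤ) (JFst A p) := by
      rw [SquareGroup.tensorMap_tl]
      exact JFst_muHom_tl _ _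
    exact h₁.trans (congrArg (leftUnitIso A).hom.f h₂).symm
  right_unitality A := by
    refine homToJ_ext (isSigma_tensor (isSigma_JObj A) isSigma_Znil)
      (isGen_tensor isGen_univ isGen_univ) ?_
    rintro _ ⟨p, -, n, -, rfl⟩
    obtain ⟨n, rfl⟩ := SquareGroup.zn_surj n
    have h₁ : JFst A ((SquareGroup.rightUnitIso (JObj A)).hom.e (tl p (zn n))) = n • JFst A p := by
      rw [SquareGroup.rightUnitIso_hom_tl, map_zsmul]
    have h₂ : JFst (tensor A unit) ((muHom A unit).e
        ((SquareGroup.tensorMap (𝟙 (JObj A)) epsHom).e (tl p (zn n)))) =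
          tp (JFst A p) (⟨n⟩ : ULift.{u} ℤ) := by
      rw [SquareGroup.tensorMap_tl]
      exact JFst_muHom_tl _ _
    exact h₁.trans (congrArg (rightUnitIso A).hom.f h₂).symm

/-- The symmetry of ⊚ differs from p ⊚ q ↦ q ⊚ p only by an element of the image of P, which is
invisible in the first coordinate; what is left is a ⊗ b ↦ b ⊗ a. -/
theorem muHom_braid (A B : Cos.{u}) : muHom A B ≫ J.map (braidIso A B).hom =
    (SquareGroup.braidIso (JObj A) (JObj B)).hom ≫ muHom B A := by
  refine homToJ_ext (A := tensor B A) (isSigma_tensor_J A B)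
    (isGen_tensor isGen_univ isGen_univ) ?_
  rintro _ ⟨p, -, q, -, rfl⟩
  have h : JFst (tensor B A) ((muHom B A).e
      ((SquareGroup.braidIso (JObj A) (JObj B)).hom.e (tl p q))) =
        tp (JFst B q) (JFst A p) := by
    rw [SquareGroup.braidIso_hom_tl, map_add, map_add]
    refine (congrArg₂ (· + ·) (JFst_muHom_tl q p) ?_).trans (add_zero _)
    exact muFst_P (A := B) (B := A) (-tm ((JObj B).H q) ((JObj A).T ((JObj A).H p)))
  exact (congrArg (braidIso A B).hom.f (JFst_muHom_tl p q)).trans h.symm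

theorem nonempty_braided_J : Nonempty J.{u}.Braided :=
  ⟨{ toMonoidal := JCoreMonoidal.toMonoidal
     braided := muHom_braid }⟩

end Cos

/-- Fullness in the last clause refers to all square groups as target; it amounts to fullness into
SG_Σ, because SG_Σ is a full subcategory. -/
theorem mainTheorem8 :
    (∃ h : ∀ X : Cos.{u}, SquareGroup.isSigma (Cos.J.obj X),
      (SquareGroup.isSigma.lift Cos.J h).IsEquivalence) ∧
    (∀ (M N : SquareGroup.isSigma.{u}.FullSubcategory) (f : M ⟶ N),
      IsIso f ↔ Function.Bijective (SquareGroup.cokerMap f.hom)) ∧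
    (∀ M N : SquareGroup.{u}, SquareGroup.isSigma M → SquareGroup.isSigma N →
      SquareGroup.isSigma (SquareGroup.tensor M N) ∧ SquareGroup.isSigma (SquareGroup.square M N) ∧
        IsIso (SquareGroup.sigma M N)) ∧
    Nonempty (Cos.J.{u}.Braided) ∧ Cos.J.{u}.Full :=
  ⟨⟨Cos.isSigma_J, Cos.isEquivalence_lift⟩,
    fun _ _ f => SquareGroup.isIso_iff_cokerMap_bijective f,
    fun _ _ hM hN => ⟨SquareGroup.isSigma_tensor hM hN, SquareGroup.isSigma_square hM hN,
      SquareGroup.isIso_sigma hM hN⟩,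
    Cos.nonempty_braided_J, inferInstance⟩
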